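/- **Model.** Let $W\ge 1$, $K\ge 2$, $N\ge 2$. Let $\beta\in\mathbb R^{W\times K}$ be a column-stochastic matrix with nonnegative entries and no zero row, and let a prior be a probability measure on the simplex of topic proportions $\theta\in\mathbb R^K$, with mean $a$ (all $a_k>0$), correlation matrix $R=\mathbb E(\theta\theta^\top)$ and $R'=\operatorname{diag}(a)^{-1}R\operatorname{diag}(a)^{-1}$. Each of $M$ independent documents draws $\theta$ from the prior and then $N$ independent words from the distribution $\beta\theta$. A word $i$ is a novel word of topic $k$ if $\beta_{ik}>0$ and $\beta_{il}=0$ for $l\ne k$; $\beta$ is separable if every topic has a novel word. $R'$ is simplicial if for some $\gamma>0$ each of its rows has Euclidean distance at least $\gamma$ from the convex hull of the other rows. **Algorithm.** Split each document into its first $\lfloor N/2\rfloor$ and its remaining words, and let $\widetilde X,\widetilde X'$ be the $W\times M$ word frequency matrices of the two parts with rows scaled to sum $1$ (zero rows stay zero). Put $C=M\widetilde X'\widetilde X^\top$ and $\mathrm{Nbd}(i)=\{j: C_{ii}-2C_{ij}+C_{jj}\ge d/2\}$. Draw independent standard Gaussian vectors $u_1,\dots,u_P$ in $\mathbb R^W$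 and let $\hat p_i$ be the fraction of those $r$ for which $C_iu_r\ge C_ju_r$ for all $j\in \mathrm{Nbd}(i)$. Go through the words in decreasing order of $\hat p_i$ (ties broken arbitrarily) and put a word into $\mathcal I$ if it lies in $\mathrm{Nbd}(l)$ for all $l$ already in $\mathcal I$, until $|\mathcal I|=K$. The algorithm succeeds if $\mathcal I$ consists of exactly one novel word of each of the $K$ topics and, for each $i\in\mathcal I$, the words outside $\mathrm{Nbd}(i)$ are precisely all the novel words of the topic of $i$; it fails otherwise (for at least one way of breaking ties). **Constants.** Let $E=\bar\beta R'\bar\beta^\top$ with $\bar\beta=\operatorname{diag}(\beta a)^{-1}\beta\operatorname{diag}(a)$. Put $\eta=\min_i(\beta a)_i$ and $\phi=1/\max_{k,l}R'_{kl}$. Over all pairs of a novel word $i$ and a word $j$ that is not a novel word of the same topic, let $d$ be the minimum of $E_{ii}-2E_{ij}+E_{jj}$ and $\rho$ the minimum of $\|E_i-E_j\|_2$. Let $q_\wedge$ be the minimum, over novel words $i$, of the probability that $E_iu\ge E_ju$ for all $j$ that are not novel words of the topic of $i$, where $u$ is standard Gaussian in $\mathbb R^W$. The algorithm is run with this $d$.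 **Lemma.** There are absolute constants $c_1,c_2,c_3>0$ such that, whenever $\beta$ is separable and $R'$ is simplicial, the constants $d,\phi,\eta,\rho,q_\wedge$ are positive and: (i) the failure probability tends to $0$ as $M\to\infty$ and $P\to\infty$ (jointly); (ii) for every $\delta>0$, the failure probability is at most $\delta$ if $$M\ge\max\Big\{c_1\frac{\log(3W/\delta)}{d^2\phi^2\eta^4},\ c_2\frac{W^2\log(2W/q_\wedge)\log(3W/\delta)}{\rho^2q_\wedge^2\phi^2\eta^4}\Big\},\qquad P\ge c_3\frac{\log(3W/\delta)}{q_\wedge^2}.$$ For $\delta<1$ these bounds imply $P\ge1$ and $MN\ge W^2$. (iii) The running time is $O(MNP+WP+K^2)$ for such corpora: there are a single program for a random access machine with unit-cost arithmetic on natural and real numbers and an absolute constant $c$ such that for all $W,P\ge1$ and all $K,M,N$ with $MN\ge W^2$, for every real $d$, every corpus of $M$ documents of $N$ words and all vectors $u_1,\dots,u_P$, the program halts after at most $c\,(MNP+WP+K^2)$ steps with the output of the algorithm (for some way of breaking ties). -/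

import Mathlib

open MeasureTheory ProbabilityTheory Filter Topology Matrix

noncomputable section

namespace TopicRP

/-! ### Separable and simplicial matrices -/

/-- Word `i` is a novel word of topic `k`. -/
def Novel {W K : ℕ} (β : Matrix (Fin W) (Fin K) ℝ) (i : Fin W) (k : Fin K) : Prop :=
  0 < β i k ∧ ∀ l, l ≠ k → β i l = 0

/-- Every topic has a novel word. -/
def Separable {W K : ℕ} (β : Matrix (Fin W) (Fin K) ℝ) : Prop :=
  ∀ k, ∃ i, Novel β i k

/-- Every row is at Euclidean distance at least some `γ > 0` from the convex hull of the
remaining rows. -/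
def Simplicial {m n : ℕ} (A : Matrix (Fin m) (Fin n) ℝ) : Prop :=
  ∃ γ : ℝ, 0 < γ ∧ ∀ k : Fin m,
    ∀ y ∈ convexHull ℝ ((fun l : Fin m => (WithLp.toLp 2 (A l) : EuclideanSpace ℝ (Fin n))) ''
        {l | l ≠ k}),
      γ ≤ dist (WithLp.toLp 2 (A k) : EuclideanSpace ℝ (Fin n)) y

/-! ### The generative model -/

/-- A topic model: a column-stochastic topic matrix in which every word has positive probability
in some topic, and a prior on the probability simplex of topic proportions, with positive mean. -/
structure TopicModel (W K : ℕ) where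
  β : Matrix (Fin W) (Fin K) ℝ
  β_nonneg : ∀ i k, 0 ≤ β i k
  β_sum : ∀ k, ∑ i, β i k = 1
  β_row : ∀ i, ∃ k, 0 < β i k
  prior : Measure (Fin K → ℝ)
  prior_prob : IsProbabilityMeasure prior
  prior_simplex : ∀ᵐ θ ∂prior, θ ∈ stdSimplex ℝ (Fin K)
  mean_pos : ∀ k, 0 < ∫ θ, θ k ∂prior

/-- The mean of the prior. -/
def TopicModel.a {W K : ℕ} (T : TopicModel W K) : Fin K → ℝ :=
  fun k => ∫ θ, θ k ∂T.prior

/-- The correlation matrix of the prior. -/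
def TopicModel.R {W K : ℕ} (T : TopicModel W K) : Matrix (Fin K) (Fin K) ℝ :=
  fun k l => ∫ θ, θ k * θ l ∂T.prior

/-- The normalized correlation matrix `diag(a)⁻¹ R diag(a)⁻¹`. -/
def TopicModel.R' {W K : ℕ} (T : TopicModel W K) : Matrix (Fin K) (Fin K) ℝ :=
  fun k l => T.R k l / (T.a k * T.a l)

/-- The law of one word that equals `w` with probability `p w`. -/
def wordLaw {W : ℕ} (p : Fin W → ℝ) : Measure (Fin W) :=
  ∑ w, ENNReal.ofReal (p w) • Measure.dirac w

instance {W : ℕ} (p : Fin W → ℝ) : IsFiniteMeasure (wordLaw p) := by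
  refine ⟨?_⟩
  simp [wordLaw, ENNReal.sum_lt_top]

theorem wordLaw_singleton {W : ℕ} (p : Fin W → ℝ) (w : Fin W) :
    wordLaw p {w} = ENNReal.ofReal (p w) := by
  classical
  simp [wordLaw, Measure.finsetSum_apply, Set.indicator_apply]

/-- Given topic proportions `θ`, the `N` words of a document are independent draws from `β θ`. -/
def docKernel {W K : ℕ} (β : Matrix (Fin W) (Fin K) ℝ) (N : ℕ) :
    Kernel (Fin K → ℝ) (Fin N → Fin W) where
  toFun θ := Measure.pi fun _ : Fin N => wordLaw (β *ᵥ θ)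
  measurable' := by
    refine Measure.measurable_of_measurable_coe _ fun s _ => ?_
    have h : ∀ θ : Fin K → ℝ, (Measure.pi fun _ : Fin N => wordLaw (β *ᵥ θ)) s =
        ∑ x : Fin N → Fin W, s.indicator 1 x * ∏ n, ENNReal.ofReal ((β *ᵥ θ) (x n)) := by
      intro θ
      classical
      rw [← Measure.tsum_indicator_apply_singleton _ s (Set.toFinite s).measurableSet, tsum_fintype]
      refine Finset.sum_congr rfl fun x _ => ?_
      by_cases hx : x ∈ s
      · simp [hx, Measure.pi_singleton, wordLaw_singleton]
      · simp [hx]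
    simp_rw [h]
    refine Finset.measurable_sum _ fun x _ => Measurable.const_mul ?_ _
    refine Finset.measurable_prod _ fun n _ => ENNReal.measurable_ofReal.comp ?_
    simp only [Matrix.mulVec, dotProduct]
    fun_prop

/-- The law of one document of `N` words. -/
def TopicModel.docLaw {W K : ℕ} (T : TopicModel W K) (N : ℕ) : Measure (Fin N → Fin W) :=
  T.prior.bind (docKernel T.β N)

/-- The standard Gaussian law on `ℝ^W`. -/
def stdGauss (W : ℕ) : Measure (Fin W → ℝ) :=
  Measure.pi fun _ => gaussianReal 0 1

/-- The joint law of `M` independent documents of `N` words each and of `P` independent standard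
Gaussian directions. -/
def TopicModel.law {W K : ℕ} (T : TopicModel W K) (N M P : ℕ) :
    Measure ((Fin M → Fin N → Fin W) × (Fin P → Fin W → ℝ)) :=
  (Measure.pi fun _ : Fin M => T.docLaw N).prod (Measure.pi fun _ : Fin P => stdGauss W)

/-! ### The random projection algorithm -/

/-- Each document is split in two: the first `⌊N/2⌋` words and the remaining ones. This is the word
count matrix of the first parts (the division by the length of the part, which gives
frequencies, is immaterial since the rows are rescaled below). -/
def count₁ {W M N : ℕ} (docs : Fin M → Fin N → Fin W) : Matrix (Fin W) (Fin M) ℝ :=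
  fun i m => ((Finset.univ.filter fun n : Fin N => n.val < N / 2 ∧ docs m n = i).card : ℝ)

/-- The word count matrix of the second parts. -/
def count₂ {W M N : ℕ} (docs : Fin M → Fin N → Fin W) : Matrix (Fin W) (Fin M) ℝ :=
  fun i m => ((Finset.univ.filter fun n : Fin N => N / 2 ≤ n.val ∧ docs m n = i).card : ℝ)

/-- Scaling of the rows to sum one (a zero row stays zero). -/
def rowNormalize {W M : ℕ} (A : Matrix (Fin W) (Fin M) ℝ) : Matrix (Fin W) (Fin M) ℝ :=
  fun i m => A i m / ∑ m', A i m'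

/-- The co-occurrence matrix `C = M X̃' X̃ᵀ`. -/
def cooc {W M N : ℕ} (docs : Fin M → Fin N → Fin W) : Matrix (Fin W) (Fin W) ℝ :=
  (M : ℝ) • (rowNormalize (count₂ docs) * (rowNormalize (count₁ docs))ᵀ)

/-- The set `Nbd(i) = {j : C_ii - 2 C_ij + C_jj ≥ d / 2}`. -/
def Nbd {W : ℕ} (C : Matrix (Fin W) (Fin W) ℝ) (d : ℝ) (i : Fin W) : Set (Fin W) :=
  {j | d / 2 ≤ C i i - 2 * C i j + C j j}

open Classical in
/-- The frequency with which word `i` is maximal among the words of `Nbd(i)`. -/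
def phat {W P : ℕ} (C : Matrix (Fin W) (Fin W) ℝ) (d : ℝ) (u : Fin P → Fin W → ℝ)
    (i : Fin W) : ℝ :=
  ((Finset.univ.filter fun r : Fin P => ∀ j ∈ Nbd C d i, C j ⬝ᵥ u r ≤ C i ⬝ᵥ u r).card : ℝ) / P

open Classical in
/-- Go through a list of words and keep those that lie in `Nbd(l)` for all words `l` kept so far,
until `K` words are kept. -/
def select {W : ℕ} (C : Matrix (Fin W) (Fin W) ℝ) (d : ℝ) (K : ℕ) (ws : List (Fin W)) :
    Finset (Fin W) :=
  ws.foldl (fun I j => if I.card < K ∧ ∀ l ∈ I, j ∈ Nbd C d l then insert j I else I) ∅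

/-- `I` is an output of the algorithm: the words are listed in decreasing order of their
frequencies `phat` (ties may be broken in any way) and then selected. -/
def IsOutput {W M N P : ℕ} (d : ℝ) (K : ℕ) (docs : Fin M → Fin N → Fin W)
    (u : Fin P → Fin W → ℝ) (I : Finset (Fin W)) : Prop :=
  ∃ σ : Equiv.Perm (Fin W), Antitone (phat (cooc docs) d u ∘ σ) ∧
    I = select (cooc docs) d K (List.ofFn σ)

/-- `I` consists of exactly one novel word of each topic, and for each of them the words outside
its `Nbd` are precisely all the novel words of its topic. -/
def Detects {W K : ℕ} (β : Matrix (Fin W) (Fin K) ℝ) (C : Matrix (Fin W) (Fin W) ℝ) (d : ℝ)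
    (I : Finset (Fin W)) : Prop :=
  (∀ k, ∃! i, i ∈ I ∧ Novel β i k) ∧ (∀ i ∈ I, ∃ k, Novel β i k) ∧
    ∀ i ∈ I, ∀ k, Novel β i k → ∀ j, j ∉ Nbd C d i ↔ Novel β j k

/-- The event that, for some way of breaking ties, the algorithm fails. -/
def failure {W K : ℕ} (β : Matrix (Fin W) (Fin K) ℝ) (d : ℝ) (N M P : ℕ) :
    Set ((Fin M → Fin N → Fin W) × (Fin P → Fin W → ℝ)) :=
  {ω | ∃ I, IsOutput d K ω.1 ω.2 I ∧ ¬ Detects β (cooc ω.1) d I}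

/-! ### The constants of the model, as functions of `β`, `a` and `R'` -/

/-- The matrix `diag(β a)⁻¹ β diag(a)`. -/
def betaBar {W K : ℕ} (β : Matrix (Fin W) (Fin K) ℝ) (a : Fin K → ℝ) :
    Matrix (Fin W) (Fin K) ℝ :=
  fun i k => β i k * a k / (β *ᵥ a) i

/-- The limit of the co-occurrence matrix as `M → ∞`. -/
def limitCooc {W K : ℕ} (β : Matrix (Fin W) (Fin K) ℝ) (a : Fin K → ℝ)
    (R' : Matrix (Fin K) (Fin K) ℝ) : Matrix (Fin W) (Fin W) ℝ :=
  betaBar β a * R' * (betaBar β a)ᵀ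

/-- The smallest probability of a word. -/
def etaC {W K : ℕ} (β : Matrix (Fin W) (Fin K) ℝ) (a : Fin K → ℝ) : ℝ :=
  ⨅ i, (β *ᵥ a) i

/-- The inverse of the largest entry of `R'`. -/
def phiC {K : ℕ} (R' : Matrix (Fin K) (Fin K) ℝ) : ℝ :=
  (⨆ p : Fin K × Fin K, R' p.1 p.2)⁻¹

/-- The smallest value of `E_ii - 2 E_ij + E_jj` over novel words `i` and words `j` that are not
novel words of the same topic. -/
def dC {W K : ℕ} (β : Matrix (Fin W) (Fin K) ℝ) (a : Fin K → ℝ)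
    (R' : Matrix (Fin K) (Fin K) ℝ) : ℝ :=
  sInf {x | ∃ k i j, Novel β i k ∧ ¬ Novel β j k ∧
    x = limitCooc β a R' i i - 2 * limitCooc β a R' i j + limitCooc β a R' j j}

/-- The smallest Euclidean distance of the rows `E_i`, `E_j`, over the same pairs. -/
def rhoC {W K : ℕ} (β : Matrix (Fin W) (Fin K) ℝ) (a : Fin K → ℝ)
    (R' : Matrix (Fin K) (Fin K) ℝ) : ℝ :=
  sInf {x | ∃ k i j, Novel β i k ∧ ¬ Novel β j k ∧
    x = √(∑ w, (limitCooc β a R' i w - limitCooc β a R' j w) ^ 2)}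

/-- The smallest normalized solid angle of a row `E_i` of a novel word: the probability that a
Gaussian direction is maximized by it among the rows that are not those of novel words of the
same topic. -/
def qC {W K : ℕ} (β : Matrix (Fin W) (Fin K) ℝ) (a : Fin K → ℝ)
    (R' : Matrix (Fin K) (Fin K) ℝ) : ℝ :=
  sInf {x | ∃ k i, Novel β i k ∧
    x = (stdGauss W).real {u | ∀ j, ¬ Novel β j k →
      limitCooc β a R' j ⬝ᵥ u ≤ limitCooc β a R' i ⬝ᵥ u}}

/-! ### A random access machine with unit cost arithmetic

Programs over registers and arrays that hold natural numbers or real numbers. Every arithmetic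
operation, comparison, memory access and assignment takes one step. -/

structure State where
  natReg : ℕ → ℕ
  natArr : ℕ → ℕ → ℕ
  realReg : ℕ → ℝ
  realArr : ℕ → ℕ → ℝ

inductive NatExp
  | lit (n : ℕ)
  | reg (x : ℕ)
  | get (x : ℕ) (i : NatExp)
  | add (e f : NatExp)
  | sub (e f : NatExp)
  | mul (e f : NatExp)
  | div (e f : NatExp)

def NatExp.eval (s : State) : NatExp → ℕ
  | lit n => n
  | reg x => s.natReg x
  | get x i => s.natArr x (i.eval s)
  | add e f => e.eval s + f.eval s
  | sub e f => e.eval s - f.eval s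
  | mul e f => e.eval s * f.eval s
  | div e f => e.eval s / f.eval s

def NatExp.cost : NatExp → ℕ
  | lit _ => 1
  | reg _ => 1
  | get _ i => i.cost + 1
  | add e f => e.cost + f.cost + 1
  | sub e f => e.cost + f.cost + 1
  | mul e f => e.cost + f.cost + 1
  | div e f => e.cost + f.cost + 1

inductive RealExp
  | ofNat (e : NatExp)
  | reg (x : ℕ)
  | get (x : ℕ) (i : NatExp)
  | add (e f : RealExp)
  | sub (e f : RealExp)
  | mul (e f : RealExp)
  | div (e f : RealExp)

def RealExp.eval (s : State) : RealExp → ℝ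
  | ofNat e => (e.eval s : ℝ)
  | reg x => s.realReg x
  | get x i => s.realArr x (i.eval s)
  | add e f => e.eval s + f.eval s
  | sub e f => e.eval s - f.eval s
  | mul e f => e.eval s * f.eval s
  | div e f => e.eval s / f.eval s

def RealExp.cost : RealExp → ℕ
  | ofNat e => e.cost + 1
  | reg _ => 1
  | get _ i => i.cost + 1
  | add e f => e.cost + f.cost + 1
  | sub e f => e.cost + f.cost + 1
  | mul e f => e.cost + f.cost + 1
  | div e f => e.cost + f.cost + 1

inductive Test
  | natLe (e f : NatExp)
  | realLe (e f : RealExp)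

def Test.holds (s : State) : Test → Prop
  | natLe e f => e.eval s ≤ f.eval s
  | realLe e f => e.eval s ≤ f.eval s

def Test.cost : Test → ℕ
  | natLe e f => e.cost + f.cost + 1
  | realLe e f => e.cost + f.cost + 1

inductive Program
  | skip
  | setNat (x : ℕ) (e : NatExp)
  | setReal (x : ℕ) (e : RealExp)
  | putNat (x : ℕ) (i e : NatExp)
  | putReal (x : ℕ) (i : NatExp) (e : RealExp)
  | seq (p q : Program)
  | ite (c : Test) (p q : Program)
  | loop (c : Test) (p : Program)

/-- `Runs p s s' t`: started in the state `s`, the program `p` halts in the state `s'` after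
`t` steps. -/
inductive Runs : Program → State → State → ℕ → Prop
  | skip (s : State) : Runs .skip s s 1
  | setNat (x : ℕ) (e : NatExp) (s : State) :
      Runs (.setNat x e) s
        { s with natReg := Function.update s.natReg x (e.eval s) } (e.cost + 1)
  | setReal (x : ℕ) (e : RealExp) (s : State) :
      Runs (.setReal x e) s
        { s with realReg := Function.update s.realReg x (e.eval s) } (e.cost + 1)
  | putNat (x : ℕ) (i e : NatExp) (s : State) :
      Runs (.putNat x i e) s
        { s with natArr := Function.update s.natArr x
                  (Function.update (s.natArr x) (i.eval s) (e.eval s)) } (i.cost + e.cost + 1)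
  | putReal (x : ℕ) (i : NatExp) (e : RealExp) (s : State) :
      Runs (.putReal x i e) s
        { s with realArr := Function.update s.realArr x
                  (Function.update (s.realArr x) (i.eval s) (e.eval s)) } (i.cost + e.cost + 1)
  | seq {p q : Program} {s s₁ s₂ : State} {t₁ t₂ : ℕ} :
      Runs p s s₁ t₁ → Runs q s₁ s₂ t₂ → Runs (.seq p q) s s₂ (t₁ + t₂)
  | iteTrue {c : Test} {p q : Program} {s s' : State} {t : ℕ} :
      c.holds s → Runs p s s' t → Runs (.ite c p q) s s' (c.cost + t)
  | iteFalse {c : Test} {p q : Program} {s s' : State} {t : ℕ} :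
      ¬ c.holds s → Runs q s s' t → Runs (.ite c p q) s s' (c.cost + t)
  | loopTrue {c : Test} {p : Program} {s s₁ s₂ : State} {t₁ t₂ : ℕ} :
      c.holds s → Runs p s s₁ t₁ → Runs (.loop c p) s₁ s₂ t₂ →
        Runs (.loop c p) s s₂ (c.cost + t₁ + t₂)
  | loopFalse {c : Test} {p : Program} {s : State} :
      ¬ c.holds s → Runs (.loop c p) s s c.cost

/-- The initial state: the numbers `W, K, M, N, P` in the first five natural number registers, the
constant `d` in the first real register, the documents in the first natural number array
(word `n` of document `m` in cell `m N + n`), the Gaussian directions in the first real array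
(coordinate `i` of direction `r` in cell `r W + i`), and zeros elsewhere. -/
def initial {W M N P : ℕ} (d : ℝ) (K : ℕ) (docs : Fin M → Fin N → Fin W)
    (u : Fin P → Fin W → ℝ) : State where
  natReg x := match x with
    | 0 => W
    | 1 => K
    | 2 => M
    | 3 => N
    | 4 => P
    | _ => 0
  natArr x c := if h : x = 0 ∧ c < M * N then
      ((docs (finProdFinEquiv.symm ⟨c, h.2⟩).1 (finProdFinEquiv.symm ⟨c, h.2⟩).2 : Fin W) : ℕ)
    else 0
  realReg x := if x = 0 then d else 0
  realArr x c := if h : x = 0 ∧ c < P * W then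
      u (finProdFinEquiv.symm ⟨c, h.2⟩).1 (finProdFinEquiv.symm ⟨c, h.2⟩).2
    else 0

/-- The output is read off the second natural number array: its cell `i` holds `1` if `i ∈ I` and
`0` otherwise. -/
def HoldsOutput {W : ℕ} (s : State) (I : Finset (Fin W)) : Prop :=
  ∀ i : Fin W, s.natArr 1 i = if i ∈ I then 1 else 0

end TopicRP

end

noncomputable section

namespace TopicRP

/-! ### Concentration of averages of bounded variables -/

/-! Geometry of the limit. By Bayes' rule, row `i` of `bbar` is the distribution of the topic given
the word `i`; it is the unit vector of topic `k` exactly when `i` is a novel word of `k`. Hence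
every row of `E` is a convex combination of rows of novel words. The form `E_ii - 2 E_ij + E_jj` is
the positive semidefinite form of `R'` at `bbar i - bbar j`. It vanishes for two novel words of one
topic, and it is positive for a novel word and a word that is not novel for its topic, since
otherwise a row of `R'` would be an average of the other rows. The same fact separates the rows of
`E`, and a separating hyperplane provides a cone of directions of positive Gaussian measure in which
a given topic wins. So `d`, `ρ` and `q` are positive.

Sampling. The two halves of a document use different positions, and words are conditionally
independent given `θ`, so the mean product of two frequencies is exactly `p_i p_j E_ij`. Each entry
of the co-occurrence matrix is a quotient of three empirical means. A Chernoff bound whose error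
scales with the square root of the mean shows that all entries are within `12 y / (η φ)` of `E`,
where `y² = L / M` (`abs_ratio_sub_le`, `TopicModel.measureReal_cooc_deviation_le`). Only one factor
`η⁻¹` is lost; the second one present in the sample size pays for a factor `W`, because `W η ≤ 1`.

Robustness. An entrywise error below `d / 8` leaves the neighbourhoods of novel words exact.
Gaussian anti-concentration makes near ties between rows of `E` rare, and Gaussian tails make large
perturbations of the projections rare; each costs probability `q / 8`. Thus a novel word wins with
probability at least `3q/4`, and any other word with probability at most `q/4`
(`TopicModel.solidAngle_novel_ge`, `TopicModel.solidAngle_not_novel_le`). With enough directions the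
threshold `q / 2` separates the empirical frequencies, so all novel words precede all others, and
the greedy selection keeps one per topic (`detects_select`).

Running time. Multiplying the count matrices directly is too slow. The counts of the first half of a
document are packed into one natural number in a base that exceeds every entry of the product; each
word of the second half then adds a whole packed row in constant time. Since `W² ≤ M N`, reading off
the matrix, the `P` projections and a quadratic selection sort all fit into `O(M N P)`. -/

theorem mgf_sum_le {Ω : Type*} [MeasurableSpace Ω] (ν : Measure Ω) [IsProbabilityMeasure ν]
    {Z : Ω → ℝ} (hm : Measurable Z) (h0 : ∀ ω, 0 ≤ Z ω) (h1 : ∀ ω, Z ω ≤ 1) (n : ℕ) {s : ℝ}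
    (hs : |s| ≤ 1) :
    mgf (fun ω : Fin n → Ω => ∑ m, Z (ω m)) (Measure.pi fun _ => ν) s ≤
      Real.exp (n * (∫ x, Z x ∂ν) * (s + s ^ 2)) := by
  have hZ : Integrable Z ν := Integrable.of_bound hm.aestronglyMeasurable 1
    (Eventually.of_forall fun ω => by rw [Real.norm_eq_abs, abs_of_nonneg (h0 ω)]; exact h1 ω)
  set μ := ∫ x, Z x ∂ν with hμ
  have hμ0 : 0 ≤ μ := integral_nonneg h0
  have key : ∫ x, Real.exp (s * Z x) ∂ν ≤ Real.exp (μ * (s + s ^ 2)) := by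
    -- Convexity: on `[0, 1]` the function `z ↦ exp (s z)` lies below its chord.
    have hb : ∀ x, Real.exp (s * Z x) ≤ 1 + Z x * (Real.exp s - 1) := by
      intro x
      have h := convexOn_exp.2 (Set.mem_univ s) (Set.mem_univ 0) (h0 x)
        (sub_nonneg.2 (h1 x)) (by ring)
      simp only [smul_eq_mul, mul_zero, add_zero, Real.exp_zero, mul_one] at h
      rw [mul_comm s]
      linarith
    have hint : Integrable (fun x => Real.exp (s * Z x)) ν := by
      refine Integrable.of_bound (by fun_prop) (1 + |Real.exp s - 1|)
        (Eventually.of_forall fun x => ?_)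
      rw [Real.norm_eq_abs, abs_of_pos (Real.exp_pos _)]
      refine (hb x).trans (add_le_add le_rfl ?_)
      calc Z x * (Real.exp s - 1) ≤ Z x * |Real.exp s - 1| :=
            mul_le_mul_of_nonneg_left (le_abs_self _) (h0 x)
        _ ≤ 1 * |Real.exp s - 1| := mul_le_mul_of_nonneg_right (h1 x) (abs_nonneg _)
        _ = _ := one_mul _
    calc ∫ x, Real.exp (s * Z x) ∂ν ≤ ∫ x, (1 + Z x * (Real.exp s - 1)) ∂ν :=
          integral_mono hint ((integrable_const 1).add (hZ.mul_const _)) hb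
      _ = 1 + μ * (Real.exp s - 1) := by
          rw [integral_add (integrable_const 1) (hZ.mul_const _), integral_mul_const]
          simp [hμ]
      _ ≤ 1 + μ * (s + s ^ 2) := by
          have := (abs_le.1 (Real.abs_exp_sub_one_sub_id_le hs)).2
          have : Real.exp s - 1 ≤ s + s ^ 2 := by linarith
          nlinarith
      _ ≤ Real.exp (μ * (s + s ^ 2)) := by
          have := Real.add_one_le_exp (μ * (s + s ^ 2)); linarith
  have hprod : mgf (fun ω : Fin n → Ω => ∑ m, Z (ω m)) (Measure.pi fun _ => ν) s =
      (∫ x, Real.exp (s * Z x) ∂ν) ^ n := by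
    unfold mgf
    have := integral_fintype_prod_eq_pow (𝕜 := ℝ) (ι := Fin n) (fun x => Real.exp (s * Z x))
      (μ := ν)
    simp only [Fintype.card_fin] at this
    rw [← this]
    congr 1
    ext ω
    change Real.exp (s * ∑ m, Z (ω m)) = _
    rw [Finset.mul_sum, Real.exp_sum]
  rw [hprod]
  calc (∫ x, Real.exp (s * Z x) ∂ν) ^ n ≤ (Real.exp (μ * (s + s ^ 2))) ^ n :=
        pow_le_pow_left₀ (integral_nonneg fun x => (Real.exp_pos _).le) key n
    _ = _ := by rw [← Real.exp_nat_mul]; ring_nf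

/-- Chernoff's method at the two parameters `s` and `-s`. The term of the deviation proportional to
the mean absorbs the quadratic term of the exponent, so that exactly `-L` remains. Leaving `s` free
permits both a fixed choice and the optimal one. -/
theorem measureReal_deviation_le {Ω : Type*} [MeasurableSpace Ω] (ν : Measure Ω)
    [IsProbabilityMeasure ν] {Z : Ω → ℝ} (hm : Measurable Z) (h0 : ∀ ω, 0 ≤ Z ω)
    (h1 : ∀ ω, Z ω ≤ 1) {n : ℕ} (hn : 0 < n) {s : ℝ} (hs : 0 < s) (hs1 : s ≤ 1) (L : ℝ) :
    (Measure.pi fun _ : Fin n => ν).real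
      {ω | (∫ x, Z x ∂ν) * s + L / (n * s) < |(∑ m, Z (ω m)) / n - ∫ x, Z x ∂ν|} ≤
      2 * Real.exp (-L) := by
  set μ := ∫ x, Z x ∂ν with hμ
  have hn' : (0 : ℝ) < n := by exact_mod_cast hn
  set ν' := (Measure.pi fun _ : Fin n => ν)
  have hint : ∀ c : ℝ, Integrable (fun ω : Fin n → Ω => Real.exp (c * ∑ m, Z (ω m))) ν' := by
    intro c
    have := Integrable.fintype_prod (𝕜 := ℝ) (μ := fun _ : Fin n => ν)
      (f := fun _ x => Real.exp (c * Z x)) (fun _ => by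
        refine Integrable.of_bound (by fun_prop) (Real.exp |c|) (Eventually.of_forall fun x => ?_)
        rw [Real.norm_eq_abs, abs_of_pos (Real.exp_pos _), Real.exp_le_exp]
        calc c * Z x ≤ |c| * Z x := mul_le_mul_of_nonneg_right (le_abs_self _) (h0 x)
          _ ≤ |c| * 1 := mul_le_mul_of_nonneg_left (h1 x) (abs_nonneg _)
          _ = _ := mul_one _)
    refine this.congr (Eventually.of_forall fun ω => ?_)
    simp only [Finset.mul_sum, Real.exp_sum]
  have up := measure_ge_le_exp_mul_mgf (μ := ν') (X := fun ω => ∑ m, Z (ω m)) (t := s)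
    (n * μ + n * (μ * s) + L / s) hs.le (hint s)
  have lo := measure_le_le_exp_mul_mgf (μ := ν') (X := fun ω => ∑ m, Z (ω m)) (t := -s)
    (n * μ - n * (μ * s) - L / s) (by linarith) (hint (-s))
  have hu := mgf_sum_le ν hm h0 h1 n (s := s) (by rw [abs_of_pos hs]; exact hs1)
  have hl := mgf_sum_le ν hm h0 h1 n (s := -s) (by rw [abs_neg, abs_of_pos hs]; exact hs1)
  have up' := up.trans (mul_le_mul_of_nonneg_left hu (Real.exp_pos _).le)
  have lo' := lo.trans (mul_le_mul_of_nonneg_left hl (Real.exp_pos _).le)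
  rw [← Real.exp_add] at up' lo'
  have e1 : -s * (n * μ + n * (μ * s) + L / s) + n * (∫ x, Z x ∂ν) * (s + s ^ 2) = -L := by
    rw [← hμ]; field_simp; ring
  have e2 : - -s * (n * μ - n * (μ * s) - L / s) + n * (∫ x, Z x ∂ν) * (-s + (-s) ^ 2) = -L := by
    rw [← hμ]; field_simp; ring
  rw [e1] at up'
  rw [e2] at lo'
  calc ν'.real {ω | μ * s + L / (n * s) < |(∑ m, Z (ω m)) / n - μ|}
      ≤ ν'.real ({ω | n * μ + n * (μ * s) + L / s ≤ ∑ m, Z (ω m)} ∪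
        {ω | ∑ m, Z (ω m) ≤ n * μ - n * (μ * s) - L / s}) := by
        refine measureReal_mono fun ω hω => ?_
        simp only [Set.mem_ofPred_eq, Set.mem_union] at hω ⊢
        have e3 : L / s = n * (L / (n * s)) := by field_simp
        have e4 : ∑ m, Z (ω m) = n * ((∑ m, Z (ω m)) / n) := by field_simp
        rw [e3, e4]
        rcases lt_abs.1 hω with h | h
        · left; nlinarith
        · right; nlinarith
    _ ≤ _ := measureReal_union_le _ _
    _ ≤ 2 * Real.exp (-L) := by linarith

/-- With probability `1 - 2 exp (-L)`, the mean of `n` independent copies of a variable in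
`[0, 1]` with expectation `μ` deviates from it by at most `2 max (√(μ L / n)) (L / n)`. -/
theorem measureReal_deviation_le_max {Ω : Type*} [MeasurableSpace Ω] (ν : Measure Ω)
    [IsProbabilityMeasure ν] {Z : Ω → ℝ} (hm : Measurable Z) (h0 : ∀ ω, 0 ≤ Z ω)
    (h1 : ∀ ω, Z ω ≤ 1) {n : ℕ} (hn : 0 < n) {L y : ℝ} (hy : 0 < y) (hL : y ^ 2 = L / n) :
    (Measure.pi fun _ : Fin n => ν).real
      {ω | 2 * max (√(∫ x, Z x ∂ν) * y) (y ^ 2) < |(∑ m, Z (ω m)) / n - ∫ x, Z x ∂ν|} ≤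
      2 * Real.exp (-L) := by
  set μ := ∫ x, Z x ∂ν with hμ
  have hn' : (0 : ℝ) < n := by exact_mod_cast hn
  have hμ0 : 0 ≤ μ := integral_nonneg h0
  have hLs : ∀ s : ℝ, L / (n * s) = y ^ 2 / s := fun s => by rw [hL, div_div]
  -- The parameter that balances the two terms of the deviation is `y / √μ`. It is admissible as
  -- long as it is at most one; for smaller means `s = 1` suffices.
  by_cases h : y ^ 2 ≤ μ
  · have hμp : 0 < √μ := Real.sqrt_pos.2 (lt_of_lt_of_le (by positivity) h)
    have hs1 : y / √μ ≤ 1 := by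
      rw [div_le_one hμp]; exact Real.le_sqrt_of_sq_le h
    refine (measureReal_mono fun ω hω => ?_).trans
      (measureReal_deviation_le ν hm h0 h1 hn (s := y / √μ) (by positivity) hs1 L)
    simp only [Set.mem_ofPred_eq] at hω ⊢
    refine lt_of_le_of_lt ?_ hω
    have e : (∫ x, Z x ∂ν) * (y / √μ) + L / (n * (y / √μ)) = 2 * (√μ * y) := by
      rw [hLs, ← hμ]
      have : μ = √μ * √μ := (Real.mul_self_sqrt hμ0).symm
      nth_rewrite 1 [this]
      field_simp
      ring
    rw [e]
    exact mul_le_mul_of_nonneg_left (le_max_left _ _) (by norm_num)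
  · refine (measureReal_mono fun ω hω => ?_).trans
      (measureReal_deviation_le ν hm h0 h1 hn (s := 1) (by norm_num) le_rfl L)
    simp only [Set.mem_ofPred_eq] at hω ⊢
    refine lt_of_le_of_lt ?_ hω
    rw [hLs, ← hμ]
    have := le_max_right (√μ * y) (y ^ 2)
    push Not at h
    linarith

/-! ### Gaussian vectors -/

instance (W : ℕ) : IsProbabilityMeasure (stdGauss W) := by
  unfold stdGauss; infer_instance

/-- The characteristic function of the image factors over the coordinates, and the variances add up
in the exponent. -/
theorem map_dotProduct_stdGauss {W : ℕ} (v : Fin W → ℝ) :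
    (stdGauss W).map (fun u => v ⬝ᵥ u) = gaussianReal 0 (∑ i, v i ^ 2).toNNReal := by
  have hmeas : Measurable fun u : Fin W → ℝ => v ⬝ᵥ u := by
    simp only [dotProduct]; fun_prop
  have : IsProbabilityMeasure ((stdGauss W).map (fun u => v ⬝ᵥ u)) :=
    Measure.isProbabilityMeasure_map hmeas.aemeasurable
  refine Measure.ext_of_charFun (funext fun t => ?_)
  rw [charFun_gaussianReal, charFun_apply_real, integral_map hmeas.aemeasurable (by fun_prop)]
  have h1 : ∀ u : Fin W → ℝ, Complex.exp (t * ((v ⬝ᵥ u : ℝ) : ℂ) * Complex.I) =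
      ∏ i, Complex.exp (((t * v i : ℝ) : ℂ) * (u i : ℂ) * Complex.I) := by
    intro u
    rw [← Complex.exp_sum, dotProduct]
    congr 1
    push_cast
    rw [Finset.mul_sum, Finset.sum_mul]
    exact Finset.sum_congr rfl fun i _ => by ring
  simp_rw [h1]
  unfold stdGauss
  rw [integral_fintype_prod_eq_prod (𝕜 := ℂ)
    (fun i (x : ℝ) => Complex.exp (((t * v i : ℝ) : ℂ) * (x : ℂ) * Complex.I))]
  have h2 : ∀ i, ∫ x, Complex.exp (((t * v i : ℝ) : ℂ) * (x : ℂ) * Complex.I) ∂(gaussianReal 0 1) =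
      Complex.exp (-(((t * v i) ^ 2 / 2 : ℝ) : ℂ)) := by
    intro i
    rw [← charFun_apply_real, charFun_gaussianReal]
    push_cast; congr 1; simp
  rw [Finset.prod_congr rfl fun i _ => h2 i, ← Complex.exp_sum]
  congr 1
  have h3 : ((∑ i, v i ^ 2).toNNReal : ℝ) = ∑ i, v i ^ 2 :=
    Real.coe_toNNReal _ (Finset.sum_nonneg fun i _ => sq_nonneg _)
  have h4 : (((∑ i, v i ^ 2).toNNReal : NNReal) : ℂ) = ((∑ i, v i ^ 2 : ℝ) : ℂ) := by
    rw [← h3]; simp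
  rw [h4]
  push_cast
  simp only [mul_zero, zero_mul, zero_sub]
  rw [Finset.sum_mul, Finset.sum_div, ← Finset.sum_neg_distrib]
  exact Finset.sum_congr rfl fun i _ => by ring

theorem measurable_dotProduct {W : ℕ} (v : Fin W → ℝ) : Measurable fun u : Fin W → ℝ => v ⬝ᵥ u := by
  simp only [dotProduct]; fun_prop

/-- Anti-concentration: the density of a centred Gaussian of variance at least `r²` is at most `1 /
(2 r)`, because `2 π ≥ 4`, and the interval has length `2 t`. -/
theorem stdGauss_abs_dotProduct_le {W : ℕ} (v : Fin W → ℝ) {r t : ℝ} (hr : 0 < r) (ht : 0 ≤ t)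
    (hv : r ^ 2 ≤ ∑ i, v i ^ 2) :
    (stdGauss W).real {u | |v ⬝ᵥ u| ≤ t} ≤ t / r := by
  have hpos : 0 < ∑ i, v i ^ 2 := lt_of_lt_of_le (by positivity) hv
  have hset : {u : Fin W → ℝ | |v ⬝ᵥ u| ≤ t} = (fun u => v ⬝ᵥ u) ⁻¹' (Set.Icc (-t) t) := by
    ext u; simp [abs_le]
  rw [hset, ← map_measureReal_apply (measurable_dotProduct v) measurableSet_Icc,
    map_dotProduct_stdGauss, measureReal_def,
    gaussianReal_apply_eq_integral _ (by simpa using hpos)]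
  set V := (∑ i, v i ^ 2).toNNReal with hV
  have hVr : (V : ℝ) = ∑ i, v i ^ 2 := Real.coe_toNNReal _ hpos.le
  rw [ENNReal.toReal_ofReal (integral_nonneg fun x => gaussianPDFReal_nonneg _ _ _)]
  calc ∫ x in Set.Icc (-t) t, gaussianPDFReal 0 V x
      ≤ ∫ x in Set.Icc (-t) t, (1 / (2 * r)) := by
        refine setIntegral_mono_on (integrable_gaussianPDFReal 0 V).integrableOn ?_
          measurableSet_Icc fun x _ => ?_
        · exact integrableOn_const (by simp)
        rw [gaussianPDFReal]
        calc (√(2 * Real.pi * V))⁻¹ * Real.exp (-(x - 0) ^ 2 / (2 * V))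
            ≤ (√(2 * Real.pi * V))⁻¹ * 1 := by
              refine mul_le_mul_of_nonneg_left (Real.exp_le_one_iff.2 ?_) (by positivity)
              rw [neg_div]; exact neg_nonpos.2 (by positivity)
          _ = (√(2 * Real.pi * V))⁻¹ := mul_one _
          _ ≤ (2 * r)⁻¹ := by
              refine inv_anti₀ (by positivity) (Real.le_sqrt_of_sq_le ?_)
              rw [hVr]
              have := Real.pi_gt_three
              nlinarith
          _ = _ := by rw [one_div]
    _ = t / r := by
        rw [setIntegral_const]
        simp only [measureReal_def, Real.volume_Icc, smul_eq_mul]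
        rw [ENNReal.toReal_ofReal (by linarith)]
        field_simp; ring

/-- Chernoff's method with parameter `t / σ`. Only an upper bound `σ` of the variance enters, so a
degenerate projection is covered. -/
theorem stdGauss_dotProduct_ge {W : ℕ} (v : Fin W → ℝ) {σ t : ℝ} (hσ : 0 < σ) (ht : 0 ≤ t)
    (hv : ∑ i, v i ^ 2 ≤ σ) :
    (stdGauss W).real {u | t ≤ v ⬝ᵥ u} ≤ Real.exp (-(t ^ 2 / (2 * σ))) := by
  have hmap := map_dotProduct_stdGauss v
  have hs : 0 ≤ ∑ i, v i ^ 2 := Finset.sum_nonneg fun i _ => sq_nonneg _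
  have hint : Integrable (fun u => Real.exp (t / σ * (v ⬝ᵥ u))) (stdGauss W) := by
    have := integrable_exp_mul_gaussianReal (μ := 0) (v := (∑ i, v i ^ 2).toNNReal) (t / σ)
    rw [← hmap] at this
    exact this.comp_measurable (measurable_dotProduct v)
  refine (measure_ge_le_exp_mul_mgf (X := fun u => v ⬝ᵥ u) (t := t / σ) t (by positivity)
    hint).trans ?_
  rw [mgf_gaussianReal hmap, ← Real.exp_add, Real.exp_le_exp, Real.coe_toNNReal _ hs]
  have h1 : (∑ i, v i ^ 2) * (t / σ) ^ 2 ≤ σ * (t / σ) ^ 2 :=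
    mul_le_mul_of_nonneg_right hv (sq_nonneg _)
  have h2 : σ * (t / σ) ^ 2 = t ^ 2 / σ := by field_simp
  have h3 : t / σ * t = t ^ 2 / σ := by ring
  have h4 : t ^ 2 / (2 * σ) = t ^ 2 / σ / 2 := by field_simp
  rw [h2] at h1
  rw [h4]
  linarith

theorem stdGauss_abs_dotProduct_gt {W : ℕ} (v : Fin W → ℝ) {σ t : ℝ} (hσ : 0 < σ) (ht : 0 ≤ t)
    (hv : ∑ i, v i ^ 2 ≤ σ) :
    (stdGauss W).real {u | t < |v ⬝ᵥ u|} ≤ 2 * Real.exp (-(t ^ 2 / (2 * σ))) := by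
  have h1 := stdGauss_dotProduct_ge v hσ ht hv
  have h2 := stdGauss_dotProduct_ge (-v) hσ ht (by simpa using hv)
  calc (stdGauss W).real {u | t < |v ⬝ᵥ u|}
      ≤ (stdGauss W).real ({u | t ≤ v ⬝ᵥ u} ∪ {u | t ≤ (-v) ⬝ᵥ u}) := by
        refine measureReal_mono fun u hu => ?_
        simp only [Set.mem_ofPred_eq, Set.mem_union, neg_dotProduct] at hu ⊢
        rcases lt_abs.1 hu with h | h
        · exact Or.inl h.le
        · exact Or.inr h.le
    _ ≤ _ := measureReal_union_le _ _
    _ ≤ _ := by linarith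

/-! ### The moments of the prior -/

section Model

variable {W K : ℕ} (T : TopicModel W K)

instance : IsProbabilityMeasure T.prior := T.prior_prob

theorem TopicModel.ae_bounds : ∀ᵐ θ ∂T.prior, (∀ k, 0 ≤ θ k) ∧ (∀ k, θ k ≤ 1) ∧ ∑ k, θ k = 1 := by
  filter_upwards [T.prior_simplex] with θ hθ
  refine ⟨hθ.1, fun k => ?_, hθ.2⟩
  rw [← hθ.2]
  exact Finset.single_le_sum (fun l _ => hθ.1 l) (Finset.mem_univ k)

theorem TopicModel.integrable_coord (k : Fin K) : Integrable (fun θ => θ k) T.prior := by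
  refine Integrable.of_bound (measurable_pi_apply k).aestronglyMeasurable 1 ?_
  filter_upwards [T.ae_bounds] with θ hθ
  rw [Real.norm_eq_abs, abs_of_nonneg (hθ.1 k)]
  exact hθ.2.1 k

theorem TopicModel.integrable_mul_coord (k l : Fin K) :
    Integrable (fun θ => θ k * θ l) T.prior := by
  refine Integrable.of_bound (by fun_prop) 1 ?_
  filter_upwards [T.ae_bounds] with θ hθ
  rw [Real.norm_eq_abs, abs_of_nonneg (mul_nonneg (hθ.1 k) (hθ.1 l))]
  exact mul_le_one₀ (hθ.2.1 k) (hθ.1 l) (hθ.2.1 l)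

theorem TopicModel.a_pos (k : Fin K) : 0 < T.a k := T.mean_pos k

theorem TopicModel.R_nonneg (k l : Fin K) : 0 ≤ T.R k l := by
  refine integral_nonneg_of_ae ?_
  filter_upwards [T.ae_bounds] with θ hθ
  exact mul_nonneg (hθ.1 k) (hθ.1 l)

theorem TopicModel.sum_a : ∑ k, T.a k = 1 := by
  unfold TopicModel.a
  rw [← integral_finsetSum _ fun k _ => T.integrable_coord k]
  rw [integral_congr_ae (g := fun _ => 1)]
  · simp
  · filter_upwards [T.ae_bounds] with θ hθ using hθ.2.2

/-- Makes quadratic forms of `R` second moments. It serves for the semidefiniteness of `R'` and,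
with all coefficients one, for the total mass of `R`. -/
theorem TopicModel.sum_R (c : Fin K → ℝ) :
    ∑ k, ∑ l, c k * c l * T.R k l = ∫ θ, (∑ k, c k * θ k) ^ 2 ∂T.prior := by
  have h : ∀ θ : Fin K → ℝ, (∑ k, c k * θ k) ^ 2 = ∑ k, ∑ l, c k * c l * (θ k * θ l) := by
    intro θ
    rw [sq, Finset.sum_mul_sum]
    exact Finset.sum_congr rfl fun k _ => Finset.sum_congr rfl fun l _ => by ring
  simp_rw [h]
  rw [integral_finsetSum _ fun k _ => integrable_finsetSum _ fun l _ =>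
    (T.integrable_mul_coord k l).const_mul _]
  refine Finset.sum_congr rfl fun k _ => ?_
  rw [integral_finsetSum _ fun l _ => (T.integrable_mul_coord k l).const_mul _]
  refine Finset.sum_congr rfl fun l _ => ?_
  rw [integral_const_mul]
  rfl

theorem TopicModel.R'_nonneg (k l : Fin K) : 0 ≤ T.R' k l :=
  div_nonneg (T.R_nonneg k l) (mul_pos (T.a_pos k) (T.a_pos l)).le

theorem TopicModel.R'_symm (k l : Fin K) : T.R' k l = T.R' l k := by
  simp only [TopicModel.R', TopicModel.R, mul_comm]

theorem TopicModel.R'_posSemidef : T.R'.PosSemidef := by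
  refine Matrix.PosSemidef.of_dotProduct_mulVec_nonneg ?_ fun x => ?_
  · ext k l; simp [T.R'_symm l k]
  · have h : star x ⬝ᵥ T.R' *ᵥ x = ∑ k, ∑ l, (x k / T.a k) * (x l / T.a l) * T.R k l := by
      simp only [dotProduct, mulVec, Finset.mul_sum, TopicModel.R', star_trivial]
      refine Finset.sum_congr rfl fun k _ => Finset.sum_congr rfl fun l _ => ?_
      have := (T.a_pos k).ne'
      have := (T.a_pos l).ne'
      field_simp
    rw [h, T.sum_R]
    exact integral_nonneg fun θ => sq_nonneg _

theorem TopicModel.R'_le (k l : Fin K) : T.R' k l ≤ ⨆ p : Fin K × Fin K, T.R' p.1 p.2 :=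
  le_ciSup (f := fun p : Fin K × Fin K => T.R' p.1 p.2) (Set.finite_range _).bddAbove (k, l)

/-- The average of the entries of `R'` with weights `a k * a l` is the second moment of `∑ k, θ k =
1`, hence one; the largest entry is at least the average. -/
theorem TopicModel.one_le_iSup_R' : 1 ≤ ⨆ p : Fin K × Fin K, T.R' p.1 p.2 := by
  set S := ⨆ p : Fin K × Fin K, T.R' p.1 p.2 with hS
  have h1 : ∑ k, ∑ l, T.R k l = 1 := by
    have h := T.sum_R (fun _ => 1)
    simp only [one_mul] at h
    rw [h, integral_congr_ae (g := fun _ => 1)]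
    · simp
    · filter_upwards [T.ae_bounds] with θ hθ
      rw [hθ.2.2, one_pow]
  calc (1 : ℝ) = ∑ k, ∑ l, T.R k l := h1.symm
    _ ≤ ∑ k, ∑ l, S * (T.a k * T.a l) := by
        refine Finset.sum_le_sum fun k _ => Finset.sum_le_sum fun l _ => ?_
        have h := T.R'_le k l
        rwa [TopicModel.R', div_le_iff₀ (mul_pos (T.a_pos k) (T.a_pos l))] at h
    _ = S := by
        simp_rw [← Finset.mul_sum, T.sum_a, mul_one, T.sum_a, mul_one]

theorem TopicModel.phi_pos : 0 < phiC T.R' :=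
  inv_pos.2 (lt_of_lt_of_le one_pos T.one_le_iSup_R')

theorem TopicModel.phi_le_one : phiC T.R' ≤ 1 :=
  inv_le_one_of_one_le₀ T.one_le_iSup_R'

theorem TopicModel.R'_le_inv_phi (k l : Fin K) : T.R' k l ≤ (phiC T.R')⁻¹ := by
  rw [phiC, inv_inv]; exact T.R'_le k l

/-! ### Word probabilities -/

theorem TopicModel.word_pos (i : Fin W) : 0 < (T.β *ᵥ T.a) i := by
  obtain ⟨k, hk⟩ := T.β_row i
  exact Finset.sum_pos' (fun l _ => mul_nonneg (T.β_nonneg i l) (T.a_pos l).le)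
    ⟨k, Finset.mem_univ k, mul_pos hk (T.a_pos k)⟩

theorem TopicModel.sum_mulVec (θ : Fin K → ℝ) : ∑ i, (T.β *ᵥ θ) i = ∑ k, θ k := by
  simp only [mulVec, dotProduct]
  rw [Finset.sum_comm]
  refine Finset.sum_congr rfl fun k _ => ?_
  rw [← Finset.sum_mul, T.β_sum, one_mul]

theorem TopicModel.eta_le (i : Fin W) : etaC T.β T.a ≤ (T.β *ᵥ T.a) i :=
  ciInf_le (f := fun i => (T.β *ᵥ T.a) i) (Set.finite_range _).bddBelow i

theorem TopicModel.eta_pos [Nonempty (Fin W)] : 0 < etaC T.β T.a := by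
  obtain ⟨i, hi⟩ := exists_eq_ciInf_of_finite (f := fun i => (T.β *ᵥ T.a) i)
  rw [etaC, ← hi]
  exact T.word_pos i

/-- The word probabilities sum to one. This inequality trades a factor `W` for a factor `η⁻¹` in the
sample size. -/
theorem TopicModel.eta_mul_le : W * etaC T.β T.a ≤ 1 := by
  calc W * etaC T.β T.a = ∑ _i : Fin W, etaC T.β T.a := by simp
    _ ≤ ∑ i, (T.β *ᵥ T.a) i := Finset.sum_le_sum fun i _ => T.eta_le i
    _ = 1 := by rw [T.sum_mulVec, T.sum_a]

/-! ### The rows of `betaBar` -/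

/-- The row-stochastic matrix `betaBar` of the model. -/
abbrev TopicModel.bbar : Matrix (Fin W) (Fin K) ℝ := betaBar T.β T.a

/-- The limit co-occurrence matrix of the model. -/
abbrev TopicModel.E : Matrix (Fin W) (Fin W) ℝ := limitCooc T.β T.a T.R'

theorem TopicModel.bbar_nonneg (i : Fin W) (k : Fin K) : 0 ≤ T.bbar i k :=
  div_nonneg (mul_nonneg (T.β_nonneg i k) (T.a_pos k).le) (T.word_pos i).le

theorem TopicModel.bbar_sum (i : Fin W) : ∑ k, T.bbar i k = 1 := by
  simp only [TopicModel.bbar, betaBar]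
  rw [← Finset.sum_div]
  exact div_self (T.word_pos i).ne'

theorem TopicModel.bbar_eq_zero {i : Fin W} {k : Fin K} : T.bbar i k = 0 ↔ T.β i k = 0 := by
  simp only [TopicModel.bbar, betaBar, div_eq_zero_iff, mul_eq_zero, (T.word_pos i).ne',
    (T.a_pos k).ne', or_false]

/-- A novel word reveals its topic: all the mass of its row, which sums to one, sits on that topic.
-/
theorem TopicModel.bbar_novel {i : Fin W} {k : Fin K} (h : Novel T.β i k) :
    T.bbar i = Pi.single k 1 := by
  have h0 : ∀ l, l ≠ k → T.bbar i l = 0 := fun l hl => T.bbar_eq_zero.2 (h.2 l hl)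
  have h1 : T.bbar i k = 1 := by
    rw [← T.bbar_sum i]
    exact (Finset.sum_eq_single k (fun l _ hl => h0 l hl) (by simp)).symm
  ext l
  by_cases hl : l = k
  · subst hl; simp [h1]
  · simp [hl, h0 l hl]

theorem TopicModel.bbar_lt_one {j : Fin W} {k : Fin K} (h : ¬ Novel T.β j k) :
    T.bbar j k < 1 := by
  by_contra hge
  push Not at hge
  have hz : ∀ l, l ≠ k → T.bbar j l = 0 := by
    intro l hl
    have h2 : T.bbar j k + T.bbar j l ≤ 1 := by
      rw [← T.bbar_sum j, ← Finset.sum_pair hl.symm]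
      exact Finset.sum_le_sum_of_subset_of_nonneg (Finset.subset_univ _)
        fun m _ _ => T.bbar_nonneg j m
    have := T.bbar_nonneg j l
    linarith
  refine h ⟨lt_of_le_of_ne (T.β_nonneg j k) fun h0 => ?_, fun l hl => T.bbar_eq_zero.1 (hz l hl)⟩
  have : T.bbar j k = 0 := T.bbar_eq_zero.2 h0.symm
  linarith

theorem Novel.eq {β : Matrix (Fin W) (Fin K) ℝ} {i : Fin W} {k l : Fin K} (h : Novel β i k)
    (h' : Novel β i l) : k = l := by
  by_contra hne
  exact h.1.ne' (h'.2 k hne)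

/-! ### The limit co-occurrence matrix -/

theorem TopicModel.E_apply (i j : Fin W) :
    T.E i j = ∑ k, ∑ l, T.bbar i k * T.bbar j l * T.R' k l := by
  simp only [TopicModel.E, limitCooc, Matrix.mul_apply, Matrix.transpose_apply, Finset.sum_mul]
  rw [Finset.sum_comm]
  exact Finset.sum_congr rfl fun k _ => Finset.sum_congr rfl fun l _ => by ring

theorem TopicModel.E_symm (i j : Fin W) : T.E i j = T.E j i := by
  rw [T.E_apply, T.E_apply, Finset.sum_comm]
  refine Finset.sum_congr rfl fun k _ => Finset.sum_congr rfl fun l _ => ?_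
  rw [T.R'_symm]; ring

theorem TopicModel.E_nonneg (i j : Fin W) : 0 ≤ T.E i j := by
  rw [T.E_apply]
  exact Finset.sum_nonneg fun k _ => Finset.sum_nonneg fun l _ =>
    mul_nonneg (mul_nonneg (T.bbar_nonneg i k) (T.bbar_nonneg j l)) (T.R'_nonneg k l)

theorem TopicModel.E_le (i j : Fin W) : T.E i j ≤ (phiC T.R')⁻¹ := by
  rw [T.E_apply]
  calc ∑ k, ∑ l, T.bbar i k * T.bbar j l * T.R' k l
      ≤ ∑ k, ∑ l, T.bbar i k * T.bbar j l * (phiC T.R')⁻¹ :=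
        Finset.sum_le_sum fun k _ => Finset.sum_le_sum fun l _ =>
          mul_le_mul_of_nonneg_left (T.R'_le_inv_phi k l)
            (mul_nonneg (T.bbar_nonneg i k) (T.bbar_nonneg j l))
    _ = (phiC T.R')⁻¹ := by
        simp_rw [← Finset.sum_mul, ← Finset.mul_sum, T.bbar_sum, mul_one, T.bbar_sum, one_mul]

/-- The covariance form of the word pair `(i, j)`. -/
theorem TopicModel.word_mul_E (i j : Fin W) :
    (T.β *ᵥ T.a) i * (T.β *ᵥ T.a) j * T.E i j = ∑ k, ∑ l, T.β i k * T.β j l * T.R k l := by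
  rw [T.E_apply, Finset.mul_sum]
  refine Finset.sum_congr rfl fun k _ => ?_
  rw [Finset.mul_sum]
  refine Finset.sum_congr rfl fun l _ => ?_
  simp only [TopicModel.bbar, betaBar, TopicModel.R']
  have := (T.word_pos i).ne'
  have := (T.word_pos j).ne'
  have := (T.a_pos k).ne'
  have := (T.a_pos l).ne'
  field_simp

/-- In every direction each topic has a value, and a word receives the average of these values under
its topic distribution. A novel word receives the value of its own topic, so no word can exceed all
novel words. -/
theorem TopicModel.E_row_dot (i : Fin W) (u : Fin W → ℝ) :
    T.E i ⬝ᵥ u = ∑ k, T.bbar i k * ((T.R' k) ⬝ᵥ (u ᵥ* T.bbar)) := by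
  simp only [dotProduct, vecMul, T.E_apply, Finset.mul_sum, Finset.sum_mul]
  rw [Finset.sum_comm]
  refine Finset.sum_congr rfl fun k _ => ?_
  rw [Finset.sum_comm]
  refine Finset.sum_congr rfl fun l _ => Finset.sum_congr rfl fun j _ => by ring

theorem TopicModel.E_row_dot_novel {i : Fin W} {k : Fin K} (h : Novel T.β i k) (u : Fin W → ℝ) :
    T.E i ⬝ᵥ u = (T.R' k) ⬝ᵥ (u ᵥ* T.bbar) := by
  rw [T.E_row_dot, T.bbar_novel h, Finset.sum_eq_single k]
  · simp
  · intro l _ hl; simp [hl]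
  · simp

/-- The quadratic form `E_ii - 2 E_ij + E_jj`. -/
theorem TopicModel.E_quad (i j : Fin W) :
    T.E i i - 2 * T.E i j + T.E j j =
      (T.bbar i - T.bbar j) ⬝ᵥ T.R' *ᵥ (T.bbar i - T.bbar j) := by
  have h : ∀ i j, T.E i j = T.bbar i ⬝ᵥ T.R' *ᵥ T.bbar j := by
    intro i j
    rw [T.E_apply]
    simp only [dotProduct, mulVec, Finset.mul_sum]
    exact Finset.sum_congr rfl fun k _ => Finset.sum_congr rfl fun l _ => by ring
  rw [Matrix.mulVec_sub, dotProduct_sub, sub_dotProduct, sub_dotProduct, ← h, ← h, ← h, ← h,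
    T.E_symm j i]
  ring

theorem TopicModel.E_quad_novel {i j : Fin W} {k : Fin K} (hi : Novel T.β i k)
    (hj : Novel T.β j k) : T.E i i - 2 * T.E i j + T.E j j = 0 := by
  rw [T.E_quad, T.bbar_novel hi, T.bbar_novel hj]
  simp

theorem simplicial_notMem {m n : ℕ} {A : Matrix (Fin m) (Fin n) ℝ} (hA : Simplicial A)
    (k : Fin m) : (WithLp.toLp 2 (A k) : EuclideanSpace ℝ (Fin n)) ∉
      convexHull ℝ ((fun l : Fin m => (WithLp.toLp 2 (A l) : EuclideanSpace ℝ (Fin n))) ''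
        {l | l ≠ k}) := by
  obtain ⟨γ, hγ, h⟩ := hA
  intro hmem
  have := h k _ hmem
  rw [dist_self] at this
  linarith

/-- A row of a simplicial matrix is not a nontrivial average of all rows. -/
theorem simplicial_vecMul_ne {m n : ℕ} {A : Matrix (Fin m) (Fin n) ℝ} (hA : Simplicial A)
    (k : Fin m) {b : Fin m → ℝ} (h0 : ∀ l, 0 ≤ b l) (h1 : ∑ l, b l = 1) (hk : b k < 1) :
    ∃ w, A k w ≠ ∑ l, b l * A l w := by
  by_contra hcon
  push Not at hcon
  refine simplicial_notMem hA k ?_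
  have hsum : ∑ l ∈ Finset.univ.erase k, b l = 1 - b k := by
    rw [← h1, ← Finset.add_sum_erase _ _ (Finset.mem_univ k)]; ring
  have hpos : 0 < 1 - b k := by linarith
  -- Moving the share `b k` of row `k` to the other side and dividing by `1 - b k` writes row `k` as
  -- a convex combination of the other rows.
  have hmem := (convex_convexHull ℝ ((fun l : Fin m =>
      (WithLp.toLp 2 (A l) : EuclideanSpace ℝ (Fin n))) '' {l | l ≠ k})).sum_mem
    (t := Finset.univ.erase k) (w := fun l => b l / (1 - b k))
    (z := fun l => (WithLp.toLp 2 (A l) : EuclideanSpace ℝ (Fin n)))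
    (fun l _ => div_nonneg (h0 l) hpos.le)
    (by rw [← Finset.sum_div, hsum, div_self hpos.ne'])
    (fun l hl => subset_convexHull ℝ _ ⟨l, Finset.ne_of_mem_erase hl, rfl⟩)
  convert hmem using 1
  ext w
  have hw := hcon w
  rw [← Finset.add_sum_erase _ _ (Finset.mem_univ k)] at hw
  simp only [WithLp.ofLp_sum, WithLp.ofLp_smul, Finset.sum_apply, Pi.smul_apply, smul_eq_mul]
  have : ∑ l ∈ Finset.univ.erase k, b l / (1 - b k) * A l w =
      (∑ l ∈ Finset.univ.erase k, b l * A l w) / (1 - b k) := by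
    rw [Finset.sum_div]
    exact Finset.sum_congr rfl fun l _ => by ring
  rw [this, eq_div_iff hpos.ne']
  linarith

/-! ### Consequences of simpliciality and separability -/

section Separation

variable (hR : Simplicial T.R')
include hR

/-- Otherwise row `k` of `R'` would be the average of the rows with weights `bbar j`, and the weight
at `k` is below one because `j` is not novel for `k`. The positivity of both `d` and `ρ` rests on
this. -/
theorem TopicModel.vecMul_ne_zero {i j : Fin W} {k : Fin K} (hi : Novel T.β i k)
    (hj : ¬ Novel T.β j k) : ∃ l, ((T.bbar i - T.bbar j) ᵥ* T.R') l ≠ 0 := by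
  obtain ⟨w, hw⟩ := simplicial_vecMul_ne hR k (T.bbar_nonneg j) (T.bbar_sum j) (T.bbar_lt_one hj)
  refine ⟨w, fun h => hw ?_⟩
  rw [Matrix.sub_vecMul, T.bbar_novel hi, Matrix.single_one_vecMul, Pi.sub_apply, sub_eq_zero] at h
  exact h

/-- A positive semidefinite form vanishes only on the kernel of its matrix, and `bbar i - bbar j` is
not in the kernel of `R'`. -/
theorem TopicModel.E_quad_pos {i j : Fin W} {k : Fin K} (hi : Novel T.β i k)
    (hj : ¬ Novel T.β j k) : 0 < T.E i i - 2 * T.E i j + T.E j j := by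
  obtain ⟨l, hl⟩ := T.vecMul_ne_zero hR hi hj
  rw [T.E_quad]
  have h0 := T.R'_posSemidef.dotProduct_mulVec_nonneg (T.bbar i - T.bbar j)
  rw [star_trivial] at h0
  refine lt_of_le_of_ne h0 fun h => hl ?_
  have h2 := (T.R'_posSemidef.dotProduct_mulVec_zero_iff (T.bbar i - T.bbar j)).1
    (by rw [star_trivial]; exact h.symm)
  have hsymm : T.R'ᵀ = T.R' := by ext k l; exact T.R'_symm l k
  rw [← Matrix.mulVec_transpose, hsymm, h2]
  rfl

/-- The column of `E` that belongs to a novel word of topic `l` reads off coordinate `l` of `bbar *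
R'`. By separability every coordinate is visible in this way. -/
theorem TopicModel.E_row_ne (hS : Separable T.β) {i j : Fin W} {k : Fin K} (hi : Novel T.β i k)
    (hj : ¬ Novel T.β j k) : ∃ w, T.E i w ≠ T.E j w := by
  obtain ⟨l, hl⟩ := T.vecMul_ne_zero hR hi hj
  obtain ⟨w, hw⟩ := hS l
  refine ⟨w, fun h => hl ?_⟩
  rw [T.E_symm i, T.E_symm j, T.E_apply, T.E_apply, T.bbar_novel hw] at h
  have e : ∀ j : Fin W, ∑ x, ∑ l', Pi.single (M := fun _ => ℝ) l 1 x * T.bbar j l' * T.R' x l' =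
      (T.bbar j ᵥ* T.R') l := by
    intro j
    rw [Finset.sum_eq_single l]
    · simp only [Pi.single_eq_same, one_mul, vecMul, dotProduct]
      exact Finset.sum_congr rfl fun m _ => by rw [T.R'_symm]
    · intro m _ hm; simp [hm]
    · simp
  rw [e, e] at h
  rw [Matrix.sub_vecMul, Pi.sub_apply, h, sub_self]

/-- Hahn–Banach separates row `k` of `R'` strictly from the hull of the other rows. In the
separating direction topic `k` has the largest value, and a word that is not novel for `k` puts
positive weight on a smaller one. -/
theorem TopicModel.exists_direction (hS : Separable T.β) (k : Fin K) :
    ∃ u : Fin W → ℝ, ∀ i, Novel T.β i k → ∀ j, ¬ Novel T.β j k → T.E j ⬝ᵥ u < T.E i ⬝ᵥ u := by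
  classical
  obtain ⟨f, c, hf1, hf2⟩ := geometric_hahn_banach_closed_point
    (convex_convexHull ℝ ((fun l : Fin K =>
      (WithLp.toLp 2 (T.R' l) : EuclideanSpace ℝ (Fin K))) '' {l | l ≠ k}))
    (((Set.toFinite _).isCompact_convexHull (𝕜 := ℝ)).isClosed) (simplicial_notMem hR k)
  choose n hn using hS
  set v : Fin K → ℝ := fun l => f (EuclideanSpace.single l 1) with hv
  have hfv : ∀ x : Fin K → ℝ, f (WithLp.toLp 2 x) = x ⬝ᵥ v := by
    intro x
    have hx : (WithLp.toLp 2 x : EuclideanSpace ℝ (Fin K)) =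
        ∑ l, x l • EuclideanSpace.single l (1 : ℝ) := by
      ext m
      simp [Finset.sum_apply, Pi.single_apply]
    rw [hx, map_sum]
    simp [dotProduct, hv]
  -- The separating functional lives on topics. Placing its coefficients on one chosen novel word
  -- per topic lifts it to words, since the corresponding rows of `bbar` are the unit vectors.
  set u : Fin W → ℝ := ∑ l, v l • Pi.single (n l) 1 with hu
  have huv : u ᵥ* T.bbar = v := by
    rw [hu, Matrix.sum_vecMul]
    ext m
    simp only [Finset.sum_apply, Matrix.smul_vecMul, Matrix.single_one_vecMul, Pi.smul_apply,
      smul_eq_mul]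
    rw [Finset.sum_eq_single m]
    · have := congrFun (T.bbar_novel (hn m)) m
      simp only [Matrix.row] at *
      rw [this]; simp
    · intro l _ hl
      have := congrFun (T.bbar_novel (hn l)) m
      simp only [Matrix.row] at *
      rw [this]; simp [hl.symm]
    · simp
  refine ⟨u, fun i hi j hj => ?_⟩
  have hlt : ∀ l, l ≠ k → T.R' l ⬝ᵥ v < T.R' k ⬝ᵥ v := by
    intro l hl
    have h1 := hf1 _ (subset_convexHull ℝ _ ⟨l, hl, rfl⟩)
    rw [hfv] at h1 hf2
    exact h1.trans hf2
  rw [T.E_row_dot_novel hi, T.E_row_dot, huv]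
  have hk : ∃ l, l ≠ k ∧ 0 < T.bbar j l := by
    by_contra hcon
    push Not at hcon
    have h1 := T.bbar_sum j
    rw [Finset.sum_eq_single k (fun l _ hl => le_antisymm (hcon l hl) (T.bbar_nonneg j l))
      (by simp)] at h1
    exact (T.bbar_lt_one hj).ne h1
  obtain ⟨l, hl, hlp⟩ := hk
  calc ∑ m, T.bbar j m * (T.R' m ⬝ᵥ v) < ∑ m, T.bbar j m * (T.R' k ⬝ᵥ v) := by
        refine Finset.sum_lt_sum (fun m _ => ?_) ⟨l, Finset.mem_univ l, ?_⟩
        · refine mul_le_mul_of_nonneg_left ?_ (T.bbar_nonneg j m)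
          by_cases hm : m = k
          · rw [hm]
          · exact (hlt m hm).le
        · exact mul_lt_mul_of_pos_left (hlt l hl) hlp
    _ = _ := by rw [← Finset.sum_mul, T.bbar_sum, one_mul]

end Separation

/-! ### Positivity of the constants -/

theorem exists_mem_sInf {s : Set ℝ} (hf : s.Finite) (hne : s.Nonempty) : sInf s ∈ s :=
  hne.csInf_mem hf

theorem finite_pairs {f : Fin K → Fin W → Fin W → ℝ} (p : Fin K → Fin W → Fin W → Prop) :
    {x | ∃ k i j, p k i j ∧ x = f k i j}.Finite := by
  refine (Set.finite_range fun y : Fin K × Fin W × Fin W => f y.1 y.2.1 y.2.2).subset ?_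
  rintro x ⟨k, i, j, -, rfl⟩
  exact ⟨(k, i, j), rfl⟩

theorem exists_pair (hK : 2 ≤ K) {β : Matrix (Fin W) (Fin K) ℝ} (hS : Separable β) :
    ∃ k i j, Novel β i k ∧ ¬ Novel β j k := by
  obtain ⟨i, hi⟩ := hS ⟨0, by omega⟩
  obtain ⟨j, hj⟩ := hS ⟨1, by omega⟩
  refine ⟨_, i, j, hi, fun h => ?_⟩
  have := h.eq hj
  simp at this

theorem dC_eq : dC T.β T.a T.R' = sInf {x | ∃ k i j, (Novel T.β i k ∧ ¬ Novel T.β j k) ∧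
    x = T.E i i - 2 * T.E i j + T.E j j} := by
  simp only [dC, and_assoc]

theorem rhoC_eq : rhoC T.β T.a T.R' = sInf {x | ∃ k i j, (Novel T.β i k ∧ ¬ Novel T.β j k) ∧
    x = √(∑ w, (T.E i w - T.E j w) ^ 2)} := by
  simp only [rhoC, and_assoc]

theorem TopicModel.d_le {i j : Fin W} {k : Fin K} (hi : Novel T.β i k) (hj : ¬ Novel T.β j k) :
    dC T.β T.a T.R' ≤ T.E i i - 2 * T.E i j + T.E j j := by
  rw [dC_eq]
  exact csInf_le (finite_pairs _).bddBelow ⟨k, i, j, ⟨hi, hj⟩, rfl⟩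

theorem TopicModel.rho_le {i j : Fin W} {k : Fin K} (hi : Novel T.β i k) (hj : ¬ Novel T.β j k) :
    rhoC T.β T.a T.R' ≤ √(∑ w, (T.E i w - T.E j w) ^ 2) := by
  rw [rhoC_eq]
  exact csInf_le (finite_pairs _).bddBelow ⟨k, i, j, ⟨hi, hj⟩, rfl⟩

theorem finite_novel (f : Fin K → Fin W → ℝ) (p : Fin K → Fin W → Prop) :
    {x | ∃ k i, p k i ∧ x = f k i}.Finite := by
  refine (Set.finite_range fun y : Fin K × Fin W => f y.1 y.2).subset ?_
  rintro x ⟨k, i, -, rfl⟩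
  exact ⟨(k, i), rfl⟩

theorem TopicModel.q_le {i : Fin W} {k : Fin K} (hi : Novel T.β i k) :
    qC T.β T.a T.R' ≤ (stdGauss W).real {u | ∀ j, ¬ Novel T.β j k → T.E j ⬝ᵥ u ≤ T.E i ⬝ᵥ u} :=
  csInf_le (finite_novel _ _).bddBelow ⟨k, i, hi, rfl⟩

theorem TopicModel.q_le_one (hK : 2 ≤ K) (hS : Separable T.β) : qC T.β T.a T.R' ≤ 1 := by
  obtain ⟨k, i, -, hi, -⟩ := exists_pair hK hS
  exact (T.q_le hi).trans measureReal_le_one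

theorem TopicModel.d_pos (hK : 2 ≤ K) (hS : Separable T.β) (hR : Simplicial T.R') :
    0 < dC T.β T.a T.R' := by
  obtain ⟨k, i, j, h⟩ := exists_pair hK hS
  rw [dC_eq]
  obtain ⟨k', i', j', h', e⟩ := exists_mem_sInf
    (finite_pairs (f := fun _ i j => T.E i i - 2 * T.E i j + T.E j j)
      fun k i j => Novel T.β i k ∧ ¬ Novel T.β j k) ⟨_, k, i, j, h, rfl⟩
  rw [e]
  exact T.E_quad_pos hR h'.1 h'.2

theorem TopicModel.rho_pos (hK : 2 ≤ K) (hS : Separable T.β) (hR : Simplicial T.R') :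
    0 < rhoC T.β T.a T.R' := by
  obtain ⟨k, i, j, h⟩ := exists_pair hK hS
  rw [rhoC_eq]
  obtain ⟨k', i', j', h', e⟩ := exists_mem_sInf
    (finite_pairs (f := fun _ i j => √(∑ w, (T.E i w - T.E j w) ^ 2))
      fun k i j => Novel T.β i k ∧ ¬ Novel T.β j k) ⟨_, k, i, j, h, rfl⟩
  rw [e]
  obtain ⟨w, hw⟩ := T.E_row_ne hR hS h'.1 h'.2
  refine Real.sqrt_pos.2 (Finset.sum_pos' (fun _ _ => sq_nonneg _) ⟨w, Finset.mem_univ w, ?_⟩)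
  have := sub_ne_zero.2 hw
  positivity

instance (W : ℕ) : (stdGauss W).IsOpenPosMeasure := by
  have : (gaussianReal 0 1).IsOpenPosMeasure :=
    (gaussianReal_absolutelyContinuous' 0 one_ne_zero).isOpenPosMeasure
  unfold stdGauss
  infer_instance

/-- The strict inequalities define an open set of directions, nonempty by
`TopicModel.exists_direction`, and the Gaussian law charges every nonempty open set. -/
theorem TopicModel.q_pos (hK : 2 ≤ K) (hS : Separable T.β) (hR : Simplicial T.R') :
    0 < qC T.β T.a T.R' := by
  obtain ⟨k, i, -, hi, -⟩ := exists_pair hK hS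
  obtain ⟨k', i', h', e⟩ := exists_mem_sInf (finite_novel (fun k i => (stdGauss W).real
    {u | ∀ j, ¬ Novel T.β j k → T.E j ⬝ᵥ u ≤ T.E i ⬝ᵥ u}) (fun k i => Novel T.β i k))
    ⟨_, k, i, hi, rfl⟩
  rw [qC, e]
  obtain ⟨u, hu⟩ := T.exists_direction hR hS k'
  have hopen : IsOpen {u : Fin W → ℝ | ∀ j, ¬ Novel T.β j k' → T.E j ⬝ᵥ u < T.E i' ⬝ᵥ u} := by
    simp only [Set.ofPred_forall]
    refine isOpen_iInter_of_finite fun j => isOpen_iInter_of_finite fun _ => ?_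
    exact isOpen_lt (Continuous.dotProduct continuous_const continuous_id)
      (Continuous.dotProduct continuous_const continuous_id)
  refine lt_of_lt_of_le ?_ (measureReal_mono (s₁ := {u : Fin W → ℝ | ∀ j, ¬ Novel T.β j k' →
    T.E j ⬝ᵥ u < T.E i' ⬝ᵥ u}) fun u hu j hj => (hu j hj).le)
  exact ENNReal.toReal_pos (hopen.measure_pos _ ⟨u, fun j hj => hu i' h' j hj⟩).ne'
    (measure_ne_top _ _)

/-- The entries of `E` lie between `0` and `φ⁻¹`. This turns an accuracy of order `d φ η²` into one
of order `η²`. -/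
theorem TopicModel.d_mul_phi_le (hK : 2 ≤ K) (hS : Separable T.β) :
    dC T.β T.a T.R' * phiC T.R' ≤ 2 := by
  obtain ⟨k, i, j, hi, hj⟩ := exists_pair hK hS
  have h1 := T.d_le hi hj
  have h2 := T.E_le i i
  have h3 := T.E_le j j
  have h4 := T.E_nonneg i j
  have hφ := T.phi_pos
  have : dC T.β T.a T.R' ≤ 2 * (phiC T.R')⁻¹ := by linarith
  calc dC T.β T.a T.R' * phiC T.R' ≤ 2 * (phiC T.R')⁻¹ * phiC T.R' :=
        mul_le_mul_of_nonneg_right this hφ.le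
    _ = 2 := by field_simp

/-- A crude bound, needed only to see that the second sample size is at least `W²`. -/
theorem TopicModel.rho_mul_phi_le (hK : 2 ≤ K) (hS : Separable T.β) :
    rhoC T.β T.a T.R' * phiC T.R' ≤ W := by
  obtain ⟨k, i, j, hi, hj⟩ := exists_pair hK hS
  have hφ := T.phi_pos
  have hW : (1 : ℝ) ≤ W := by exact_mod_cast (Fin.pos i)
  have h : rhoC T.β T.a T.R' ≤ W * (phiC T.R')⁻¹ := by
    refine (T.rho_le hi hj).trans (Real.sqrt_le_iff.2 ⟨by positivity, ?_⟩)
    calc ∑ w, (T.E i w - T.E j w) ^ 2 ≤ ∑ _w : Fin W, ((phiC T.R')⁻¹) ^ 2 := by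
          refine Finset.sum_le_sum fun w _ => sq_le_sq' ?_ ?_
          · linarith [T.E_nonneg i w, T.E_le j w]
          · linarith [T.E_nonneg j w, T.E_le i w]
      _ = W * ((phiC T.R')⁻¹) ^ 2 := by simp
      _ ≤ (W * (phiC T.R')⁻¹) ^ 2 := by
          rw [mul_pow]
          exact mul_le_mul_of_nonneg_right (by nlinarith) (by positivity)
  calc rhoC T.β T.a T.R' * phiC T.R' ≤ W * (phiC T.R')⁻¹ * phiC T.R' :=
        mul_le_mul_of_nonneg_right h hφ.le
    _ = W := by field_simp

end Model

/-! ### The moments of a document -/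

section Doc

variable {W K : ℕ} (T : TopicModel W K) {N : ℕ}

theorem docKernel_singleton (β : Matrix (Fin W) (Fin K) ℝ) (θ : Fin K → ℝ) (x : Fin N → Fin W) :
    docKernel β N θ {x} = ∏ n, ENNReal.ofReal ((β *ᵥ θ) (x n)) := by
  change (Measure.pi fun _ : Fin N => wordLaw (β *ᵥ θ)) {x} = _
  rw [Measure.pi_singleton]
  exact Finset.prod_congr rfl fun n _ => wordLaw_singleton _ _

theorem TopicModel.ae_mulVec : ∀ᵐ θ ∂T.prior, (∀ i, 0 ≤ (T.β *ᵥ θ) i) ∧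
    (∀ i, (T.β *ᵥ θ) i ≤ 1) ∧ ∑ i, (T.β *ᵥ θ) i = 1 := by
  filter_upwards [T.ae_bounds] with θ hθ
  have h0 : ∀ i, 0 ≤ (T.β *ᵥ θ) i := fun i => by
    simp only [mulVec, dotProduct]
    exact Finset.sum_nonneg fun k _ => mul_nonneg (T.β_nonneg i k) (hθ.1 k)
  have h1 : ∑ i, (T.β *ᵥ θ) i = 1 := by rw [T.sum_mulVec, hθ.2.2]
  exact ⟨h0, fun i => h1 ▸ Finset.single_le_sum (fun j _ => h0 j) (Finset.mem_univ i), h1⟩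

theorem measurable_mulVec (β : Matrix (Fin W) (Fin K) ℝ) (i : Fin W) :
    Measurable fun θ : Fin K → ℝ => (β *ᵥ θ) i := by
  simp only [mulVec, dotProduct]; fun_prop

/-- Conditional independence of the words of a document, in the form that expectations of products
over positions factor. -/
theorem sum_prod_mul (p : Fin W → ℝ) (f : Fin N → Fin W → ℝ) :
    ∑ x : Fin N → Fin W, (∏ n, f n (x n)) * ∏ n, p (x n) = ∏ n, ∑ w, f n w * p w := by
  classical
  rw [Finset.prod_univ_sum]
  simp only [Fintype.piFinset_univ, Finset.prod_mul_distrib]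

theorem TopicModel.integrable_prod_mulVec (x : Fin N → Fin W) :
    Integrable (fun θ => ∏ n, (T.β *ᵥ θ) (x n)) T.prior := by
  refine Integrable.of_bound (Finset.measurable_fun_prod _ fun n _ =>
    measurable_mulVec _ _).aestronglyMeasurable 1 ?_
  filter_upwards [T.ae_mulVec] with θ hθ
  rw [Real.norm_eq_abs, abs_of_nonneg (Finset.prod_nonneg fun n _ => hθ.1 _)]
  exact Finset.prod_le_one (fun n _ => hθ.1 _) fun n _ => hθ.2.1 _

theorem TopicModel.docLaw_real_singleton (x : Fin N → Fin W) :
    (T.docLaw N).real {x} = ∫ θ, ∏ n, (T.β *ᵥ θ) (x n) ∂T.prior := by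
  rw [measureReal_def, TopicModel.docLaw, Measure.bind_apply (measurableSet_singleton x)
    (docKernel T.β N).measurable.aemeasurable]
  simp_rw [docKernel_singleton]
  rw [integral_eq_lintegral_of_nonneg_ae]
  · congr 1
    refine lintegral_congr_ae ?_
    filter_upwards [T.ae_mulVec] with θ hθ
    rw [ENNReal.ofReal_prod_of_nonneg fun n _ => hθ.1 _]
  · filter_upwards [T.ae_mulVec] with θ hθ
    exact Finset.prod_nonneg fun n _ => hθ.1 _
  · exact (T.integrable_prod_mulVec x).aestronglyMeasurable

theorem TopicModel.lintegral_docLaw_univ : T.docLaw N Set.univ = 1 := by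
  rw [TopicModel.docLaw, Measure.bind_apply MeasurableSet.univ
    (docKernel T.β N).measurable.aemeasurable]
  have : ∫⁻ _, 1 ∂T.prior = 1 := by simp
  rw [← this]
  refine lintegral_congr_ae ?_
  filter_upwards [T.ae_mulVec] with θ hθ
  change (Measure.pi fun _ : Fin N => wordLaw (T.β *ᵥ θ)) Set.univ = 1
  rw [Measure.pi_univ]
  refine Finset.prod_eq_one fun n _ => ?_
  simp only [wordLaw, Measure.finsetSum_apply, Measure.smul_apply, smul_eq_mul, measure_univ,
    mul_one]
  rw [← ENNReal.ofReal_sum_of_nonneg fun i _ => hθ.1 i, hθ.2.2, ENNReal.ofReal_one]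

instance : IsProbabilityMeasure (T.docLaw N) := ⟨T.lintegral_docLaw_univ⟩

theorem TopicModel.integral_docLaw (f : (Fin N → Fin W) → ℝ) :
    ∫ x, f x ∂T.docLaw N = ∫ θ, ∑ x, f x * ∏ n, (T.β *ᵥ θ) (x n) ∂T.prior := by
  rw [integral_fintype (Integrable.of_finite), integral_finsetSum _ fun x _ =>
    (T.integrable_prod_mulVec x).const_mul _]
  refine Finset.sum_congr rfl fun x _ => ?_
  rw [T.docLaw_real_singleton, integral_const_mul, smul_eq_mul, mul_comm]

/-- Given `θ`, words at two distinct positions are independent with law `β θ`; averaging over the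
prior produces the second moments in `R`. Equal positions would add a diagonal bias, which is why
documents are split. -/
theorem TopicModel.integral_pair {n n' : Fin N} (hn : n ≠ n') (i j : Fin W) :
    ∫ x, (if x n = i then 1 else 0) * (if x n' = j then 1 else 0) ∂T.docLaw N =
      (T.β *ᵥ T.a) i * (T.β *ᵥ T.a) j * T.E i j := by
  rw [T.integral_docLaw, T.word_mul_E]
  have h : ∀ θ : Fin K → ℝ, ∑ i, (T.β *ᵥ θ) i = 1 →
      ∑ x : Fin N → Fin W, ((if x n = i then 1 else 0) * (if x n' = j then 1 else 0)) *
        ∏ m, (T.β *ᵥ θ) (x m) = ∑ k, ∑ l, T.β i k * T.β j l * (θ k * θ l) := by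
    intro θ hθ
    -- The test functions are constantly one away from the positions `n` and `n'`, so all other
    -- factors sum to one.
    have h1 := sum_prod_mul (N := N) (T.β *ᵥ θ) fun m w =>
      (if m = n then (if w = i then 1 else 0) else 1) *
        (if m = n' then (if w = j then 1 else 0) else 1)
    simp only [Finset.prod_mul_distrib, Finset.prod_ite_eq', Finset.mem_univ, if_true] at h1
    rw [h1]
    have h2 : ∀ m : Fin N, ∑ w, (if m = n then (if w = i then 1 else 0) else 1) *
        (if m = n' then (if w = j then 1 else 0) else 1) * (T.β *ᵥ θ) w =
        (if m = n then (T.β *ᵥ θ) i else 1) * (if m = n' then (T.β *ᵥ θ) j else 1) := by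
      intro m
      by_cases hm : m = n
      · subst hm; simp [hn]
      · by_cases hm' : m = n'
        · subst hm'; simp [hn.symm]
        · simp [hm, hm', hθ]
    rw [Finset.prod_congr rfl fun m _ => h2 m, Finset.prod_mul_distrib]
    simp only [Finset.prod_ite_eq', Finset.mem_univ, if_true, mulVec, dotProduct,
      Finset.sum_mul_sum]
    exact Finset.sum_congr rfl fun k _ => Finset.sum_congr rfl fun l _ => by ring
  rw [integral_congr_ae (g := fun θ => ∑ k, ∑ l, T.β i k * T.β j l * (θ k * θ l))]
  · rw [integral_finsetSum _ fun k _ => integrable_finsetSum _ fun l _ =>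
      (T.integrable_mul_coord k l).const_mul _]
    refine Finset.sum_congr rfl fun k _ => ?_
    rw [integral_finsetSum _ fun l _ => (T.integrable_mul_coord k l).const_mul _]
    exact Finset.sum_congr rfl fun l _ => integral_const_mul _ _
  · filter_upwards [T.ae_mulVec] with θ hθ using h θ hθ.2.2

theorem TopicModel.integral_single (n : Fin N) (i : Fin W) :
    ∫ x, (if x n = i then (1 : ℝ) else 0) ∂T.docLaw N = (T.β *ᵥ T.a) i := by
  rw [T.integral_docLaw]
  have h : ∀ θ : Fin K → ℝ, ∑ i, (T.β *ᵥ θ) i = 1 →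
      ∑ x : Fin N → Fin W, (if x n = i then 1 else 0) *
        ∏ m, (T.β *ᵥ θ) (x m) = ∑ k, T.β i k * θ k := by
    intro θ hθ
    have h1 := sum_prod_mul (N := N) (T.β *ᵥ θ) fun m w =>
      (if m = n then (if w = i then 1 else 0) else 1)
    simp only [Finset.prod_ite_eq', Finset.mem_univ, if_true] at h1
    rw [h1]
    have h2 : ∀ m : Fin N, ∑ w, (if m = n then (if w = i then 1 else 0) else 1) *
        (T.β *ᵥ θ) w = if m = n then (T.β *ᵥ θ) i else 1 := by
      intro m
      by_cases hm : m = n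
      · subst hm; simp
      · simp [hm, hθ]
    rw [Finset.prod_congr rfl fun m _ => h2 m]
    simp only [Finset.prod_ite_eq', Finset.mem_univ, if_true, mulVec, dotProduct]
  rw [integral_congr_ae (g := fun θ => ∑ k, T.β i k * θ k)]
  · rw [integral_finsetSum _ fun k _ => (T.integrable_coord k).const_mul _]
    exact Finset.sum_congr rfl fun k _ => integral_const_mul _ _
  · filter_upwards [T.ae_mulVec] with θ hθ using h θ hθ.2.2

/-- The frequency of the word `i` among the positions `s` of a document. -/
def freq (s : Finset (Fin N)) (i : Fin W) (x : Fin N → Fin W) : ℝ :=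
  (∑ n ∈ s, if x n = i then 1 else 0) / s.card

theorem freq_nonneg (s : Finset (Fin N)) (i : Fin W) (x : Fin N → Fin W) : 0 ≤ freq s i x :=
  div_nonneg (Finset.sum_nonneg fun n _ => by split_ifs <;> norm_num) (Nat.cast_nonneg _)

theorem freq_le_one (s : Finset (Fin N)) (i : Fin W) (x : Fin N → Fin W) : freq s i x ≤ 1 := by
  refine div_le_one_of_le₀ ?_ (Nat.cast_nonneg _)
  calc (∑ n ∈ s, if x n = i then (1 : ℝ) else 0) ≤ ∑ n ∈ s, 1 :=
        Finset.sum_le_sum fun n _ => by split_ifs <;> norm_num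
    _ = s.card := by simp

theorem TopicModel.integral_freq {s : Finset (Fin N)} (hs : s.Nonempty) (i : Fin W) :
    ∫ x, freq s i x ∂T.docLaw N = (T.β *ᵥ T.a) i := by
  unfold freq
  rw [integral_div, integral_finsetSum _ fun _ _ => Integrable.of_finite]
  simp_rw [T.integral_single]
  have : (s.card : ℝ) ≠ 0 := by exact_mod_cast hs.card_ne_zero
  simp [this]

/-- Disjointness ensures that every pair of positions in the double sum is a pair of distinct ones,
so all terms have the same mean. -/
theorem TopicModel.integral_freq_mul {s s' : Finset (Fin N)} (hs : s.Nonempty) (hs' : s'.Nonempty)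
    (hd : Disjoint s s') (i j : Fin W) :
    ∫ x, freq s i x * freq s' j x ∂T.docLaw N =
      (T.β *ᵥ T.a) i * (T.β *ᵥ T.a) j * T.E i j := by
  have h : ∀ x : Fin N → Fin W, freq s i x * freq s' j x = (∑ n ∈ s, ∑ n' ∈ s',
      (if x n = i then 1 else 0) * (if x n' = j then 1 else 0)) / (s.card * s'.card) := by
    intro x
    rw [freq, freq, div_mul_div_comm, Finset.sum_mul_sum]
  simp_rw [h]
  rw [integral_div, integral_finsetSum _ fun _ _ => Integrable.of_finite]
  have e : ∀ n ∈ s, ∫ x, (∑ n' ∈ s', (if x n = i then (1 : ℝ) else 0) *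
      (if x n' = j then 1 else 0)) ∂T.docLaw N =
      s'.card * ((T.β *ᵥ T.a) i * (T.β *ᵥ T.a) j * T.E i j) := by
    intro n hn
    rw [integral_finsetSum _ fun _ _ => Integrable.of_finite, Finset.sum_congr rfl fun n' hn' =>
      T.integral_pair (fun h : n = n' => Finset.disjoint_left.1 hd hn (by rw [h]; exact hn')) i j]
    simp
  rw [Finset.sum_congr rfl e]
  have h1 : (s.card : ℝ) ≠ 0 := by exact_mod_cast hs.card_ne_zero
  have h2 : (s'.card : ℝ) ≠ 0 := by exact_mod_cast hs'.card_ne_zero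
  simp only [Finset.sum_const, nsmul_eq_mul]
  field_simp

/-- The positions of the first half of a document. -/
def half₁ (N : ℕ) : Finset (Fin N) := Finset.univ.filter fun n => n.val < N / 2

/-- The positions of the second half of a document. -/
def half₂ (N : ℕ) : Finset (Fin N) := Finset.univ.filter fun n => N / 2 ≤ n.val

theorem half₁_nonempty (hN : 2 ≤ N) : (half₁ N).Nonempty :=
  ⟨⟨0, by omega⟩, by simp only [half₁, Finset.mem_filter, Finset.mem_univ, true_and]; omega⟩

theorem half₂_nonempty (hN : 2 ≤ N) : (half₂ N).Nonempty :=
  ⟨⟨N - 1, by omega⟩, by simp only [half₂, Finset.mem_filter, Finset.mem_univ, true_and]; omega⟩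

theorem disjoint_halves : Disjoint (half₂ N) (half₁ N) := by
  rw [Finset.disjoint_left]
  intro n h2 h1
  simp only [half₁, half₂, Finset.mem_filter, Finset.mem_univ, true_and] at h1 h2
  omega

theorem count₁_eq (hN : 2 ≤ N) {M : ℕ} (docs : Fin M → Fin N → Fin W) (i : Fin W) (m : Fin M) :
    count₁ docs i m = freq (half₁ N) i (docs m) * (half₁ N).card := by
  have h : ((half₁ N).card : ℝ) ≠ 0 := by exact_mod_cast (half₁_nonempty hN).card_ne_zero
  rw [freq, div_mul_cancel₀ _ h, count₁, half₁, Finset.sum_filter, ← Finset.sum_boole]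
  refine Finset.sum_congr rfl fun n _ => ?_
  by_cases h1 : n.val < N / 2 <;> simp [h1]

theorem count₂_eq (hN : 2 ≤ N) {M : ℕ} (docs : Fin M → Fin N → Fin W) (i : Fin W) (m : Fin M) :
    count₂ docs i m = freq (half₂ N) i (docs m) * (half₂ N).card := by
  have h : ((half₂ N).card : ℝ) ≠ 0 := by exact_mod_cast (half₂_nonempty hN).card_ne_zero
  rw [freq, div_mul_cancel₀ _ h, count₂, half₂, Finset.sum_filter, ← Finset.sum_boole]
  refine Finset.sum_congr rfl fun n _ => ?_
  by_cases h1 : N / 2 ≤ n.val <;> simp [h1]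

/-- The co-occurrence matrix as a ratio of averages over the documents. -/
theorem cooc_eq (hN : 2 ≤ N) {M : ℕ} (hM : 0 < M) (docs : Fin M → Fin N → Fin W) (i j : Fin W) :
    cooc docs i j = ((∑ m, freq (half₂ N) i (docs m) * freq (half₁ N) j (docs m)) / M) /
      (((∑ m, freq (half₂ N) i (docs m)) / M) * ((∑ m, freq (half₁ N) j (docs m)) / M)) := by
  have h1 : ((half₁ N).card : ℝ) ≠ 0 := by exact_mod_cast (half₁_nonempty hN).card_ne_zero
  have h2 : ((half₂ N).card : ℝ) ≠ 0 := by exact_mod_cast (half₂_nonempty hN).card_ne_zero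
  have hM' : (M : ℝ) ≠ 0 := by exact_mod_cast hM.ne'
  have e1 : ∀ m, rowNormalize (count₁ docs) j m =
      freq (half₁ N) j (docs m) / ∑ m, freq (half₁ N) j (docs m) := by
    intro m
    simp only [rowNormalize, count₁_eq hN, ← Finset.sum_mul]
    rw [mul_div_mul_right _ _ h1]
  have e2 : ∀ m, rowNormalize (count₂ docs) i m =
      freq (half₂ N) i (docs m) / ∑ m, freq (half₂ N) i (docs m) := by
    intro m
    simp only [rowNormalize, count₂_eq hN, ← Finset.sum_mul]
    rw [mul_div_mul_right _ _ h2]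
  simp only [cooc, Matrix.smul_apply, Matrix.mul_apply, Matrix.transpose_apply, e1, e2, smul_eq_mul]
  simp_rw [div_mul_div_comm]
  rw [← Finset.sum_div, div_div_eq_mul_div, mul_div_assoc']
  congr 1
  field_simp

end Doc

/-! ### Deviation of the co-occurrence matrix -/

/-- Everything is measured relative to the true means. The marginals have relative error at most `2
y / η`. The error of the joint frequency, divided by `p' p`, is governed by `y √(E / (p' p))`, hence
again by `y / η` up to a power of `φ⁻¹`; the square root of the mean is what avoids `η⁻²`. -/
theorem abs_ratio_sub_le {p p' E h r r' y η φ : ℝ} (hη : 0 < η) (hφ : 0 < φ) (hφ1 : φ ≤ 1)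
    (hp : η ≤ p) (hp1 : p ≤ 1) (hp' : η ≤ p') (hp1' : p' ≤ 1) (hE : 0 ≤ E) (hE1 : E ≤ φ⁻¹)
    (hy : 0 < y) (hyη : 8 * y ≤ η) (hyη2 : y ≤ η ^ 2)
    (hr : |r - p| ≤ 2 * max (√p * y) (y ^ 2)) (hr' : |r' - p'| ≤ 2 * max (√p' * y) (y ^ 2))
    (hh : |h - p' * p * E| ≤ 2 * max (√(p' * p * E) * y) (y ^ 2)) :
    |h / (r' * r) - E| ≤ 12 * y / (η * φ) := by
  have hη1 : η ≤ 1 := hp.trans hp1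
  have hy1 : y ≤ 1 := by linarith
  have hp0 : 0 < p := lt_of_lt_of_le hη hp
  have hp0' : 0 < p' := lt_of_lt_of_le hη hp'
  have single : ∀ p r : ℝ, η ≤ p → p ≤ 1 → |r - p| ≤ 2 * max (√p * y) (y ^ 2) →
      |r / p - 1| ≤ 2 * (y / η) := by
    intro p r hp hp1 hr
    have hp0 : 0 < p := lt_of_lt_of_le hη hp
    have h1 : max (√p * y) (y ^ 2) ≤ y := by
      refine max_le ?_ (by nlinarith)
      have : √p ≤ 1 := Real.sqrt_le_one.2 hp1
      nlinarith
    have e : r / p - 1 = (r - p) / p := by field_simp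
    rw [e, abs_div, abs_of_pos hp0, div_le_iff₀ hp0]
    calc |r - p| ≤ 2 * y := hr.trans (by linarith)
      _ = 2 * (y / η) * η := by field_simp
      _ ≤ 2 * (y / η) * p := mul_le_mul_of_nonneg_left hp (by positivity)
  have ha := single p r hp hp1 hr
  have ha' := single p' r' hp' hp1' hr'
  have hpp : η ^ 2 ≤ p' * p := by rw [sq]; exact mul_le_mul hp' hp hη.le hp0'.le
  have hpp0 : 0 < p' * p := mul_pos hp0' hp0
  set τ := y / η with hτ
  have hτ0 : 0 < τ := div_pos hy hη
  have hτ1 : τ ≤ 1 / 8 := by rw [hτ, div_le_iff₀ hη]; linarith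
  have hA : |h / (p' * p) - E| ≤ 2 * (τ * φ⁻¹) := by
    have e : h / (p' * p) - E = (h - p' * p * E) / (p' * p) := by field_simp
    rw [e, abs_div, abs_of_pos hpp0, div_le_iff₀ hpp0]
    refine hh.trans ?_
    have hφi : 1 ≤ φ⁻¹ := (one_le_inv₀ hφ).2 hφ1
    -- The first branch uses `p' p ≥ η²` and `φ⁻¹ ≥ 1`, the second one `y ≤ η²`.
    have hmax : max (√(p' * p * E) * y) (y ^ 2) ≤ τ * φ⁻¹ * (p' * p) := by
      refine max_le ?_ ?_
      · have hs : √(p' * p * E) ≤ φ⁻¹ * (p' * p) / η := by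
          refine Real.sqrt_le_iff.2 ⟨by positivity, ?_⟩
          calc p' * p * E ≤ p' * p * φ⁻¹ := mul_le_mul_of_nonneg_left hE1 hpp0.le
            _ ≤ p' * p * φ⁻¹ * (φ⁻¹ * (p' * p / η ^ 2)) := by
                refine le_mul_of_one_le_right (by positivity) ?_
                exact one_le_mul_of_one_le_of_one_le hφi ((one_le_div (by positivity)).2 hpp)
            _ = (φ⁻¹ * (p' * p) / η) ^ 2 := by ring
        calc √(p' * p * E) * y ≤ φ⁻¹ * (p' * p) / η * y := mul_le_mul_of_nonneg_right hs hy.le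
          _ = τ * φ⁻¹ * (p' * p) := by rw [hτ]; ring
      · calc y ^ 2 ≤ y * η ^ 2 := by nlinarith
          _ ≤ y * (p' * p) := mul_le_mul_of_nonneg_left hpp hy.le
          _ ≤ τ * φ⁻¹ * (p' * p) := by
              refine mul_le_mul_of_nonneg_right ?_ hpp0.le
              calc y = τ * η := by rw [hτ]; field_simp
                _ ≤ τ * φ⁻¹ := mul_le_mul_of_nonneg_left (by linarith) hτ0.le
    linarith
  set A := h / (p' * p) with hAdef
  set a := r / p with hadef
  set a' := r' / p' with hadef'
  have hC : h / (r' * r) = A / (a' * a) := by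
    have e1 : r = a * p := by rw [hadef]; field_simp
    have e2 : r' = a' * p' := by rw [hadef']; field_simp
    rw [hAdef, e1, e2, div_div]; congr 1; ring
  obtain ⟨ha1, ha2⟩ := abs_le.1 ha
  obtain ⟨hb1, hb2⟩ := abs_le.1 ha'
  have hφi : 0 < φ⁻¹ := inv_pos.2 hφ
  -- Both quotients are within `2 τ ≤ 1/4` of one. So their product is at least `(3/4)²` and differs
  -- from one by at most `4 τ + 4 τ² ≤ 9/2 τ`. The final constant is `(2 + 9/2) / (9/16) = 104/9 <
  -- 12`.
  have haa : 9 / 16 ≤ a' * a := by nlinarith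
  have haa0 : 0 < a' * a := by linarith
  have hdev : |1 - a' * a| ≤ 9 / 2 * τ := by
    rw [abs_le]; constructor <;> nlinarith
  have e : h / (r' * r) - E = (A - E + E * (1 - a' * a)) / (a' * a) := by
    rw [hC, eq_div_iff haa0.ne', sub_mul, div_mul_cancel₀ _ haa0.ne']; ring
  rw [e, abs_div, abs_of_pos haa0, div_le_iff₀ haa0]
  have h1 : |A - E + E * (1 - a' * a)| ≤ 2 * (τ * φ⁻¹) + φ⁻¹ * (9 / 2 * τ) := by
    refine (abs_add_le _ _).trans (add_le_add hA ?_)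
    rw [abs_mul, abs_of_nonneg hE]
    exact mul_le_mul hE1 hdev (abs_nonneg _) hφi.le
  have h2 : 12 * y / (η * φ) = 12 * (τ * φ⁻¹) := by rw [hτ]; field_simp
  rw [h2]
  have h3 : 0 < τ * φ⁻¹ := mul_pos hτ0 hφi
  nlinarith

section DocEvent

variable {W K : ℕ} (T : TopicModel W K) {N : ℕ}

/-- With high probability, the co-occurrence matrix is close to its limit in every entry. -/
theorem TopicModel.measureReal_cooc_deviation_le (hN : 2 ≤ N) {M : ℕ} (hM : 0 < M) {L y : ℝ}
    (hy : 0 < y) (hL : y ^ 2 = L / M) (hyη : 8 * y ≤ etaC T.β T.a)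
    (hyη2 : y ≤ etaC T.β T.a ^ 2) :
    (Measure.pi fun _ : Fin M => T.docLaw N).real
      {docs | ∃ i j, 12 * y / (etaC T.β T.a * phiC T.R') < |cooc docs i j - T.E i j|} ≤
      (2 * W ^ 2 + 4 * W) * Real.exp (-L) := by
  classical
  set P := (Measure.pi fun _ : Fin M => T.docLaw N)
  set bad : ((Fin N → Fin W) → ℝ) → Set (Fin M → Fin N → Fin W) := fun Z =>
    {ω | 2 * max (√(∫ x, Z x ∂T.docLaw N) * y) (y ^ 2) <
      |(∑ m, Z (ω m)) / M - ∫ x, Z x ∂T.docLaw N|} with hbad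
  have hb : ∀ Z : (Fin N → Fin W) → ℝ, (∀ x, 0 ≤ Z x) → (∀ x, Z x ≤ 1) →
      P.real (bad Z) ≤ 2 * Real.exp (-L) := fun Z h0 h1 =>
    measureReal_deviation_le_max (T.docLaw N) (measurable_of_finite Z) h0 h1 hM hy hL
  -- If the `W²` joint frequencies and the `2 W` marginal frequencies are all accurate, then so is
  -- every entry. Each of these events fails with probability at most `2 exp (-L)`.
  have hsub : {docs : Fin M → Fin N → Fin W | ∃ i j,
      12 * y / (etaC T.β T.a * phiC T.R') < |cooc docs i j - T.E i j|} ⊆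
      ((⋃ i, ⋃ j, bad fun x => freq (half₂ N) i x * freq (half₁ N) j x) ∪
        ⋃ i, bad (freq (half₂ N) i)) ∪ ⋃ i, bad (freq (half₁ N) i) := by
    rintro ω ⟨i, j, hij⟩
    by_contra hcon
    simp only [Set.mem_union, Set.mem_iUnion, not_or, not_exists, hbad, Set.mem_ofPred_eq,
      not_lt] at hcon
    obtain ⟨⟨h1, h2⟩, h3⟩ := hcon
    have h1 := h1 i j
    have h2 := h2 i
    have h3 := h3 j
    rw [T.integral_freq_mul (half₂_nonempty hN) (half₁_nonempty hN) disjoint_halves] at h1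
    rw [T.integral_freq (half₂_nonempty hN)] at h2
    rw [T.integral_freq (half₁_nonempty hN)] at h3
    have hle1 : ∀ i, (T.β *ᵥ T.a) i ≤ 1 := fun i => by
      rw [← T.sum_a, ← T.sum_mulVec]
      exact Finset.single_le_sum (fun j _ => (T.word_pos j).le) (Finset.mem_univ i)
    have : Nonempty (Fin W) := ⟨i⟩
    have := abs_ratio_sub_le T.eta_pos T.phi_pos T.phi_le_one (T.eta_le j) (hle1 j) (T.eta_le i)
      (hle1 i) (T.E_nonneg i j) (T.E_le i j) hy hyη hyη2 h3 h2 h1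
    rw [← cooc_eq hN hM] at this
    linarith
  have hsum : ∀ B : Fin W → Set (Fin M → Fin N → Fin W), ∀ c : ℝ, (∀ i, P.real (B i) ≤ c) →
      P.real (⋃ i, B i) ≤ W * c := by
    intro B c h
    calc P.real (⋃ i, B i) ≤ ∑ i, P.real (B i) := measureReal_iUnion_fintype_le _
      _ ≤ ∑ _i : Fin W, c := Finset.sum_le_sum fun i _ => h i
      _ = W * c := by simp
  calc _ ≤ _ := measureReal_mono hsub
    _ ≤ (W * (W * (2 * Real.exp (-L))) + W * (2 * Real.exp (-L))) + W * (2 * Real.exp (-L)) := by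
        refine (measureReal_union_le _ _).trans (add_le_add
          ((measureReal_union_le _ _).trans (add_le_add ?_ ?_)) ?_)
        · exact hsum _ _ fun i => hsum _ _ fun j => hb _
            (fun x => mul_nonneg (freq_nonneg _ _ _) (freq_nonneg _ _ _))
            (fun x => mul_le_one₀ (freq_le_one _ _ _) (freq_nonneg _ _ _) (freq_le_one _ _ _))
        · exact hsum _ _ fun i => hb _ (freq_nonneg _ _) (freq_le_one _ _)
        · exact hsum _ _ fun i => hb _ (freq_nonneg _ _) (freq_le_one _ _)
    _ = _ := by ring

end DocEvent

/-! ### Neighbourhoods and solid angles of a perturbed co-occurrence matrix -/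

theorem measureReal_iUnion_le_card {W : ℕ} {Ω : Type*} [MeasurableSpace Ω] (P : Measure Ω)
    {B : Fin W → Set Ω} {c : ℝ} (h : ∀ i, P.real (B i) ≤ c) :
    P.real (⋃ i, B i) ≤ W * c := by
  calc P.real (⋃ i, B i) ≤ ∑ i, P.real (B i) := measureReal_iUnion_fintype_le _
    _ ≤ ∑ _i : Fin W, c := Finset.sum_le_sum fun i _ => h i
    _ = W * c := by simp

/-- Near ties are rare. The width of the slab is chosen so that a union over all `W` words costs
only `q / 8`. -/
theorem TopicModel.stdGauss_thin_le {W K : ℕ} (T : TopicModel W K) (hK : 2 ≤ K)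
    (hS : Separable T.β) (hR : Simplicial T.R') {k : Fin K} {i j : Fin W} (hi : Novel T.β i k)
    (hj : ¬ Novel T.β j k) :
    (stdGauss W).real {u | |(T.E i - T.E j) ⬝ᵥ u| ≤
      rhoC T.β T.a T.R' * qC T.β T.a T.R' / (8 * W)} ≤ qC T.β T.a T.R' / (8 * W) := by
  have hρ0 := T.rho_pos hK hS hR
  have hq0 := T.q_pos hK hS hR
  refine (stdGauss_abs_dotProduct_le _ hρ0 (by positivity) ?_).trans_eq (by field_simp)
  have := pow_le_pow_left₀ hρ0.le (T.rho_le hi hj) 2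
  rwa [Real.sq_sqrt (Finset.sum_nonneg fun _ _ => sq_nonneg _)] at this

section Perturbation

variable {W K : ℕ} (T : TopicModel W K) {C : Matrix (Fin W) (Fin W) ℝ} {e : ℝ}
  (hC : ∀ i j, |C i j - T.E i j| ≤ e)
include hC

/-- The quadratic expression involves total weight four, so it moves by at most `4 e < d / 2`. Its
limit is `0` for novel words of the same topic and at least `d` otherwise, so the threshold `d / 2`
still decides. -/
theorem TopicModel.notMem_Nbd_iff (he : 8 * e < dC T.β T.a T.R') {i : Fin W} {k : Fin K}
    (hi : Novel T.β i k) (j : Fin W) : j ∉ Nbd C (dC T.β T.a T.R') i ↔ Novel T.β j k := by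
  have h1 := abs_le.1 (hC i i)
  have h2 := abs_le.1 (hC i j)
  have h3 := abs_le.1 (hC j j)
  simp only [Nbd, Set.mem_ofPred_eq, not_le]
  constructor
  · intro h
    by_contra hj
    have := T.d_le hi hj
    linarith [h1.1, h2.2, h3.1]
  · intro hj
    have := T.E_quad_novel hi hj
    linarith [h1.2, h2.1, h3.2]

/-- Nothing else is claimed about neighbourhoods of words that are not novel: it suffices that such
a word has to compete with every novel word. -/
theorem TopicModel.mem_Nbd_of_novel (he : 8 * e < dC T.β T.a T.R') {i j : Fin W} {k : Fin K}
    (hi : ∀ k, ¬ Novel T.β i k) (hj : Novel T.β j k) : j ∈ Nbd C (dC T.β T.a T.R') i := by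
  have h1 := abs_le.1 (hC i i)
  have h2 := abs_le.1 (hC i j)
  have h3 := abs_le.1 (hC j j)
  have h := T.d_le hj (hi k)
  rw [T.E_symm j i] at h
  simp only [Nbd, Set.mem_ofPred_eq]
  linarith [h1.1, h2.2, h3.1]

variable (hK : 2 ≤ K) (hS : Separable T.β) (hR : Simplicial T.R') (he0 : 0 < e)
  (he : e * (40 * W ^ 2 * √(Real.log (2 * W / qC T.β T.a T.R'))) ≤
    rhoC T.β T.a T.R' * qC T.β T.a T.R')
include hK hS hR he0 he

theorem TopicModel.stdGauss_perturbation_le (hW : 2 ≤ W) :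
    (stdGauss W).real {u | ∃ i, rhoC T.β T.a T.R' * qC T.β T.a T.R' / (8 * W) / 2 <
      |(C i - T.E i) ⬝ᵥ u|} ≤ qC T.β T.a T.R' / 8 := by
  set q := qC T.β T.a T.R' with hq
  set ρ := rhoC T.β T.a T.R' with hρ
  have hq0 : 0 < q := T.q_pos hK hS hR
  have hq1 : q ≤ 1 := T.q_le_one hK hS
  have hρ0 : 0 < ρ := T.rho_pos hK hS hR
  have hW' : (2 : ℝ) ≤ W := by exact_mod_cast hW
  set l := Real.log (2 * W / q) with hl
  have hl0 : 0 ≤ l := by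
    refine Real.log_nonneg ?_
    rw [le_div_iff₀ hq0]; linarith
  set t := ρ * q / (8 * W) with ht
  have ht0 : 0 < t := by positivity
  have hσ : 0 < W * e ^ 2 := by positivity
  have hsub : {u : Fin W → ℝ | ∃ i, t / 2 < |(C i - T.E i) ⬝ᵥ u|} =
      ⋃ i, {u | t / 2 < |(C i - T.E i) ⬝ᵥ u|} := by
    ext u; simp
  have hexp : Real.exp (-((t / 2) ^ 2 / (2 * (W * e ^ 2)))) ≤ Real.exp (-(3 * l)) := by
    rw [Real.exp_le_exp, neg_le_neg_iff, le_div_iff₀ (by positivity)]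
    -- The tail exponent must reach `3 l`, which requires `t² ≥ 24 W e² l`; as `5² ≥ 24`, the
    -- constant `40 = 5 * 8` in the hypothesis suffices, with a factor `W` to spare.
    have h1 : 5 * W * e * √l ≤ t := by
      rw [ht, le_div_iff₀ (by positivity)]
      calc 5 * W * e * √l * (8 * W) = e * (40 * W ^ 2 * √l) := by ring
        _ ≤ _ := he
    have h2 : (5 * W * e * √l) ^ 2 ≤ t ^ 2 := pow_le_pow_left₀ (by positivity) h1 2
    have h3 : (5 * W * e * √l) ^ 2 = 25 * W * (W * e ^ 2 * l) := by
      rw [mul_pow, Real.sq_sqrt hl0]; ring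
    rw [h3] at h2
    have h4 : 0 ≤ W * e ^ 2 * l := by positivity
    nlinarith
  have hexp3 : Real.exp (-(3 * l)) = (q / (2 * W)) ^ 3 := by
    have : Real.exp (-l) = q / (2 * W) := by
      rw [Real.exp_neg, hl, Real.exp_log (by positivity), inv_div]
    rw [← this, ← Real.exp_nat_mul]; congr 1; push_cast; ring
  rw [hsub]
  calc (stdGauss W).real (⋃ i, {u | t / 2 < |(C i - T.E i) ⬝ᵥ u|})
      ≤ W * (2 * Real.exp (-((t / 2) ^ 2 / (2 * (W * e ^ 2))))) := by
        refine measureReal_iUnion_le_card _ fun i =>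
          stdGauss_abs_dotProduct_gt _ hσ (by positivity) ?_
        calc ∑ w, (C i - T.E i) w ^ 2 ≤ ∑ _w : Fin W, e ^ 2 := by
              refine Finset.sum_le_sum fun w _ => ?_
              have := hC i w
              exact sq_le_sq' (abs_le.1 this).1 (abs_le.1 this).2
          _ = W * e ^ 2 := by simp
    _ ≤ W * (2 * (q / (2 * W)) ^ 3) := by rw [← hexp3]; gcongr
    _ = q / 8 * (2 * q ^ 2 / W ^ 2) := by field_simp; ring
    _ ≤ q / 8 * 1 := by
        refine mul_le_mul_of_nonneg_left ?_ (by positivity)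
        rw [div_le_one (by positivity)]
        nlinarith
    _ = q / 8 := mul_one _

/-- Suppose `i` wins in the limit. Off the slabs it wins by more than `t`, and off the perturbation
event the two projections compared move by at most `t / 2` each, so it still wins. The two
exceptional events cost `q / 8` each. -/
theorem TopicModel.solidAngle_novel_ge (hW : 2 ≤ W) {i : Fin W} {k : Fin K}
    (hi : Novel T.β i k) : 3 / 4 * qC T.β T.a T.R' ≤
      (stdGauss W).real {u | ∀ j, ¬ Novel T.β j k → C j ⬝ᵥ u ≤ C i ⬝ᵥ u} := by
  classical
  have hpert := T.stdGauss_perturbation_le hC hK hS hR he0 he hW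
  have hthin := fun j => T.stdGauss_thin_le hK hS hR (j := j) hi
  have hqle := T.q_le hi
  have hq0 := T.q_pos hK hS hR
  set q := qC T.β T.a T.R'
  set t := rhoC T.β T.a T.R' * q / (8 * W)
  set S := {u : Fin W → ℝ | ∀ j, ¬ Novel T.β j k → C j ⬝ᵥ u ≤ C i ⬝ᵥ u}
  set B : Fin W → Set (Fin W → ℝ) := fun j =>
    if Novel T.β j k then ∅ else {u | |(T.E i - T.E j) ⬝ᵥ u| ≤ t} with hB
  have hW' : (2 : ℝ) ≤ W := by exact_mod_cast hW
  have hBle : (stdGauss W).real (⋃ j, B j) ≤ W * (q / (8 * W)) := by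
    refine measureReal_iUnion_le_card _ fun j => ?_
    by_cases hj : Novel T.β j k
    · simp only [hB, if_pos hj, measureReal_empty]; positivity
    · simp only [hB, if_neg hj]; exact hthin j hj
  have hBle' : W * (q / (8 * W)) = q / 8 := by field_simp
  have hsub : {u | ∀ j, ¬ Novel T.β j k → T.E j ⬝ᵥ u ≤ T.E i ⬝ᵥ u} ⊆
      (S ∪ {u | ∃ i, t / 2 < |(C i - T.E i) ⬝ᵥ u|}) ∪ ⋃ j, B j := by
    intro u hu
    by_contra hcon
    simp only [Set.mem_union, Set.mem_iUnion, not_or, not_exists, Set.mem_ofPred_eq, not_lt] at hcon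
    obtain ⟨⟨h1, h2⟩, h3⟩ := hcon
    refine h1 fun j hj => ?_
    have h3j := h3 j
    simp only [hB, if_neg hj, Set.mem_ofPred_eq, not_le, sub_dotProduct] at h3j
    have h4 := hu j hj
    rw [abs_of_nonneg (by linarith)] at h3j
    have h5 := abs_le.1 (h2 i)
    have h6 := abs_le.1 (h2 j)
    rw [sub_dotProduct] at h5 h6
    linarith [h5.1, h6.2]
  have := (measureReal_mono (μ := stdGauss W) hsub).trans ((measureReal_union_le _ _).trans
    (add_le_add_left (measureReal_union_le _ _) _))
  linarith

/-- In the limit some novel word is always at least as good as `i`. Off the slabs it is better by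
more than `t`, and a perturbation by `t / 2` on each side cannot reverse this. So `i` wins only on
two events of probability at most `q / 8` each. -/
theorem TopicModel.solidAngle_not_novel_le (hW : 2 ≤ W) {i : Fin W}
    (hi : ∀ k, ¬ Novel T.β i k) :
      (stdGauss W).real {u | ∀ k j, Novel T.β j k → C j ⬝ᵥ u ≤ C i ⬝ᵥ u} ≤
        1 / 4 * qC T.β T.a T.R' := by
  classical
  have hpert := T.stdGauss_perturbation_le hC hK hS hR he0 he hW
  have hthin := fun j k => T.stdGauss_thin_le hK hS hR (j := i) (i := j) (k := k)
  have hq0 := T.q_pos hK hS hR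
  set q := qC T.β T.a T.R'
  set t := rhoC T.β T.a T.R' * q / (8 * W)
  set B : Fin W → Set (Fin W → ℝ) := fun j =>
    if ∃ k, Novel T.β j k then {u | |(T.E j - T.E i) ⬝ᵥ u| ≤ t} else ∅ with hB
  have hW' : (2 : ℝ) ≤ W := by exact_mod_cast hW
  have hBle : (stdGauss W).real (⋃ j, B j) ≤ W * (q / (8 * W)) := by
    refine measureReal_iUnion_le_card _ fun j => ?_
    by_cases hj : ∃ k, Novel T.β j k
    · simp only [hB, if_pos hj]
      obtain ⟨k, hk⟩ := hj
      exact hthin j k hk (hi k)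
    · simp only [hB, if_neg hj, measureReal_empty]; positivity
  have hBle' : W * (q / (8 * W)) = q / 8 := by field_simp
  have hsub : {u | ∀ k j, Novel T.β j k → C j ⬝ᵥ u ≤ C i ⬝ᵥ u} ⊆
      {u | ∃ i, t / 2 < |(C i - T.E i) ⬝ᵥ u|} ∪ ⋃ j, B j := by
    intro u hu
    by_contra hcon
    simp only [Set.mem_union, Set.mem_iUnion, not_or, not_exists, Set.mem_ofPred_eq, not_lt] at hcon
    obtain ⟨h2, h3⟩ := hcon
    have hS' := hS
    choose n hn using hS
    -- The projection of `E_i` is an average of the projections of the chosen novel rows, so it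
    -- cannot exceed all of them.
    have hex : ∃ k, T.E i ⬝ᵥ u ≤ T.E (n k) ⬝ᵥ u := by
      by_contra hlt
      push Not at hlt
      have h1 : ∑ k, T.bbar i k * (T.E (n k) ⬝ᵥ u) = T.E i ⬝ᵥ u := by
        rw [T.E_row_dot i]
        exact Finset.sum_congr rfl fun k _ => by rw [T.E_row_dot_novel (hn k)]
      have hpos : ∃ k ∈ Finset.univ, 0 < T.bbar i k := by
        by_contra h0
        push Not at h0
        have := Finset.sum_nonpos h0
        rw [T.bbar_sum] at this
        linarith
      obtain ⟨k, -, hk⟩ := hpos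
      have h4 : ∑ k, T.bbar i k * (T.E (n k) ⬝ᵥ u) < ∑ k, T.bbar i k * (T.E i ⬝ᵥ u) :=
        Finset.sum_lt_sum (fun k _ => mul_le_mul_of_nonneg_left (hlt k).le (T.bbar_nonneg i k))
          ⟨k, Finset.mem_univ k, mul_lt_mul_of_pos_left (hlt k) hk⟩
      rw [h1, ← Finset.sum_mul, T.bbar_sum, one_mul] at h4
      exact lt_irrefl _ h4
    obtain ⟨k, hk⟩ := hex
    have h3k := h3 (n k)
    simp only [hB, if_pos (⟨k, hn k⟩ : ∃ k', Novel T.β (n k) k'), Set.mem_ofPred_eq, not_le,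
      sub_dotProduct] at h3k
    rw [abs_of_nonneg (by linarith)] at h3k
    have h4 := hu k (n k) (hn k)
    have h5 := abs_le.1 (h2 i)
    have h6 := abs_le.1 (h2 (n k))
    rw [sub_dotProduct] at h5 h6
    linarith [h5.2, h6.1]
  have := (measureReal_mono (μ := stdGauss W) hsub).trans (measureReal_union_le _ _)
  linarith

/-- With high probability, the frequencies `phat` separate the novel words from the others. -/
theorem TopicModel.measureReal_phat_le (hW : 2 ≤ W) (hed : 8 * e < dC T.β T.a T.R') {P : ℕ}
    (hP : 0 < P) {L : ℝ} (hL : 100 * L ≤ P * qC T.β T.a T.R' ^ 2) :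
    (Measure.pi fun _ : Fin P => stdGauss W).real
      {u | ¬ ∀ i, ((∃ k, Novel T.β i k) → qC T.β T.a T.R' / 2 < phat C (dC T.β T.a T.R') u i) ∧
        ((∀ k, ¬ Novel T.β i k) → phat C (dC T.β T.a T.R') u i < qC T.β T.a T.R' / 2)} ≤
      W * (2 * Real.exp (-L)) := by
  classical
  have hnov := fun i k => T.solidAngle_novel_ge hC hK hS hR he0 he hW (i := i) (k := k)
  have hnot := fun i => T.solidAngle_not_novel_le hC hK hS hR he0 he hW (i := i)
  have hNbd := fun i k => T.notMem_Nbd_iff hC hed (i := i) (k := k)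
  have hNbd' := fun i j k => T.mem_Nbd_of_novel hC hed (i := i) (j := j) (k := k)
  have hq0 := T.q_pos hK hS hR
  have hq1 := T.q_le_one hK hS
  set q := qC T.β T.a T.R'
  set d := dC T.β T.a T.R'
  have hP' : (0 : ℝ) < P := by exact_mod_cast hP
  set S : Fin W → Set (Fin W → ℝ) := fun i => {v | ∀ j ∈ Nbd C d i, C j ⬝ᵥ v ≤ C i ⬝ᵥ v} with hSdef
  have hSm : ∀ i, MeasurableSet (S i) := by
    intro i
    simp only [hSdef, Set.ofPred_forall]
    exact MeasurableSet.iInter fun j => MeasurableSet.iInter fun _ =>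
      measurableSet_le (measurable_dotProduct _) (measurable_dotProduct _)
  set Z : Fin W → (Fin W → ℝ) → ℝ := fun i => (S i).indicator 1 with hZ
  have hZint : ∀ i, ∫ v, Z i v ∂stdGauss W = (stdGauss W).real (S i) := fun i =>
    integral_indicator_one (hSm i)
  have hphat : ∀ u : Fin P → Fin W → ℝ, ∀ i, phat C d u i = (∑ r, Z i (u r)) / P := by
    intro u i
    rw [phat, ← Finset.sum_boole]
    congr 1
    refine Finset.sum_congr rfl fun r _ => ?_
    simp only [hZ, Set.indicator_apply, hSdef, Set.mem_ofPred_eq, Pi.one_apply]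
  have hsub : {u : Fin P → Fin W → ℝ | ¬ ∀ i, ((∃ k, Novel T.β i k) → q / 2 < phat C d u i) ∧
        ((∀ k, ¬ Novel T.β i k) → phat C d u i < q / 2)} ⊆
      ⋃ i, {u | (∫ v, Z i v ∂stdGauss W) * (q / 10) + L / (P * (q / 10)) <
        |(∑ r, Z i (u r)) / P - ∫ v, Z i v ∂stdGauss W|} := by
    intro u hu
    by_contra hcon
    simp only [Set.mem_iUnion, not_exists, Set.mem_ofPred_eq, not_lt] at hcon
    refine hu fun i => ?_
    have h := hcon i
    rw [hZint, ← hphat] at h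
    have hm : (stdGauss W).real (S i) ≤ 1 := measureReal_le_one
    -- With Chernoff parameter `q / 10` the deviation is at most `q / 10` times the mean plus `q /
    -- 10`. This is below `q / 4`, the gap between the solid angles and the threshold `q / 2`.
    have h1 : L / (P * (q / 10)) ≤ q / 10 := by
      rw [div_le_iff₀ (by positivity)]
      nlinarith
    have h2 := abs_le.1 h
    constructor
    · rintro ⟨k, hk⟩
      -- For a novel word the actual neighbourhood contains no novel word of its own topic, so being
      -- maximal there is no harder than beating all words that are not novel for `k`.
      have hle : 3 / 4 * q ≤ (stdGauss W).real (S i) := by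
        refine (hnov i k hk).trans (measureReal_mono fun v hv j hj => ?_)
        exact hv j fun hjk => (hNbd i k hk j).2 hjk hj
      nlinarith [h2.1]
    · intro hi
      have hle : (stdGauss W).real (S i) ≤ 1 / 4 * q := by
        refine (measureReal_mono fun v hv k j hj => ?_).trans (hnot i hi)
        exact hv j (hNbd' i j k hi hj)
      nlinarith [h2.2]
  refine (measureReal_mono hsub).trans (measureReal_iUnion_le_card _ fun i => ?_)
  exact measureReal_deviation_le (stdGauss W) ((measurable_one).indicator (hSm i))
    (fun v => Set.indicator_nonneg (fun _ _ => zero_le_one) v)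
    (fun v => Set.indicator_le_self' (f := 1) (fun _ _ => zero_le_one) v |>.trans le_rfl)
    hP (by positivity) (by linarith) L

end Perturbation

/-! ### The selection step -/

section Selection

variable {W K : ℕ} {β : Matrix (Fin W) (Fin K) ℝ} {C : Matrix (Fin W) (Fin W) ℝ} {d : ℝ}

open Classical in
/-- One step of the selection. -/
def selectStep (C : Matrix (Fin W) (Fin W) ℝ) (d : ℝ) (K : ℕ) (I : Finset (Fin W)) (j : Fin W) :
    Finset (Fin W) :=
  if I.card < K ∧ ∀ l ∈ I, j ∈ Nbd C d l then insert j I else I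

theorem select_eq (K : ℕ) (ws : List (Fin W)) :
    select C d K ws = ws.foldl (selectStep C d K) ∅ := rfl

theorem foldl_selectStep_of_card {I : Finset (Fin W)} (hI : K ≤ I.card) (ws : List (Fin W)) :
    ws.foldl (selectStep C d K) I = I := by
  induction ws with
  | nil => rfl
  | cons j ws ih =>
    rw [List.foldl_cons, selectStep, if_neg (fun h => absurd h.1 (not_lt.2 hI)), ih]

theorem exists_split_of_pairwise {α : Type*} {p : α → Prop} {l : List α}
    (h : l.Pairwise fun a b => p b → p a) :
    ∃ l₁ l₂, l = l₁ ++ l₂ ∧ (∀ a ∈ l₁, p a) ∧ ∀ a ∈ l₂, ¬ p a := by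
  induction l with
  | nil => exact ⟨[], [], rfl, by simp, by simp⟩
  | cons a l ih =>
    rw [List.pairwise_cons] at h
    by_cases ha : p a
    · obtain ⟨l₁, l₂, rfl, h1, h2⟩ := ih h.2
      exact ⟨a :: l₁, l₂, rfl, by simpa [ha] using h1, h2⟩
    · refine ⟨[], a :: l, rfl, by simp, ?_⟩
      intro b hb
      rcases List.mem_cons.1 hb with rfl | hb
      · exact ha
      · exact fun hpb => ha (h.1 b hb hpb)

/-- Among novel words, a word is rejected by a selected one exactly when they share a topic. The
selection therefore chooses the first representative of each topic that occurs in the list. -/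
theorem select_novel_list
    (hNbd : ∀ i k, Novel β i k → ∀ j, j ∉ Nbd C d i ↔ Novel β j k) (l : List (Fin W))
    (hl : ∀ j ∈ l, ∃ k, Novel β j k) :
    (∀ i ∈ select C d K l, i ∈ l) ∧
    (∀ i ∈ select C d K l, ∀ i' ∈ select C d K l, ∀ k, Novel β i k → Novel β i' k → i = i') ∧
    ∀ j ∈ l, ∀ k, Novel β j k → ∃ i ∈ select C d K l, Novel β i k := by
  induction l using List.reverseRecOn with
  | nil => simp [select]
  | append_singleton l j ih =>
    have ih := ih fun i hi => hl i (by simp [hi])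
    obtain ⟨k, hk⟩ := hl j (by simp)
    have hstep : select C d K (l ++ [j]) = selectStep C d K (select C d K l) j := by
      rw [select_eq, List.foldl_append]; rfl
    rw [hstep]
    set I := select C d K l
    obtain ⟨h1, h2, h3⟩ := ih
    have hnov : ∀ i ∈ I, ∃ k, Novel β i k := fun i hi => hl i (by simp [h1 i hi])
    by_cases hex : ∃ i ∈ I, Novel β i k
    · have : selectStep C d K I j = I := by
        refine if_neg fun h => ?_
        obtain ⟨i, hi, hik⟩ := hex
        exact (hNbd i k hik j).2 hk (h.2 i hi)
      rw [this]
      refine ⟨fun i hi => by simp [h1 i hi], h2, fun j' hj' k' hk' => ?_⟩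
      rcases List.mem_append.1 hj' with hj' | hj'
      · exact h3 j' hj' k' hk'
      · rw [List.mem_singleton.1 hj'] at hk'
        rw [hk'.eq hk]; exact hex
    -- The cap `K` does not interfere: the selected words have distinct topics, none of which is
    -- `k`.
    · have hcard : I.card < K := by
        have : Nonempty (Fin K) := ⟨k⟩
        choose! top htop using hnov
        have hinj : Set.InjOn top I := fun i hi i' hi' h =>
          h2 i hi i' hi' (top i) (htop i hi) (h ▸ htop i' hi')
        rw [← Finset.card_image_of_injOn hinj]
        calc (I.image top).card < (Finset.univ : Finset (Fin K)).card := by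
              refine Finset.card_lt_card (Finset.ssubset_univ_iff.2 fun h => hex ?_)
              have := h ▸ Finset.mem_univ k
              obtain ⟨i, hi, rfl⟩ := Finset.mem_image.1 this
              exact ⟨i, hi, htop i hi⟩
          _ = K := by simp
      have : selectStep C d K I j = insert j I := by
        refine if_pos ⟨hcard, fun i hi => ?_⟩
        by_contra hj
        obtain ⟨k', hk'⟩ := hnov i hi
        have := ((hNbd i k' hk' j).1 hj).eq hk
        exact hex ⟨i, hi, this ▸ hk'⟩
      rw [this]
      refine ⟨fun i hi => ?_, fun i hi i' hi' k' hik' hik => ?_, fun j' hj' k' hk' => ?_⟩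
      · rcases Finset.mem_insert.1 hi with rfl | hi
        · simp
        · simp [h1 i hi]
      · rcases Finset.mem_insert.1 hi with hi | hi <;>
          rcases Finset.mem_insert.1 hi' with hi' | hi'
        · rw [hi, hi']
        · rw [hi] at hik'
          exact absurd ⟨i', hi', by rw [hk.eq hik']; exact hik⟩ hex
        · rw [hi'] at hik
          exact absurd ⟨i, hi, by rw [hk.eq hik]; exact hik'⟩ hex
        · exact h2 i hi i' hi' k' hik' hik
      · rcases List.mem_append.1 hj' with hj' | hj'
        · obtain ⟨i, hi, hik⟩ := h3 j' hj' k' hk'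
          exact ⟨i, Finset.mem_insert_of_mem hi, hik⟩
        · rw [List.mem_singleton.1 hj'] at hk'
          exact ⟨j, Finset.mem_insert_self _ _, hk'⟩

/-- If the words are listed with the novel words first, the selection detects the topics. -/
theorem detects_select (hS : Separable β)
    (hNbd : ∀ i k, Novel β i k → ∀ j, j ∉ Nbd C d i ↔ Novel β j k) (ws : List (Fin W))
    (hmem : ∀ j, j ∈ ws)
    (hsort : ws.Pairwise fun a b => (∃ k, Novel β b k) → ∃ k, Novel β a k) :
    Detects β C d (select C d K ws) := by
  obtain ⟨l₁, l₂, rfl, h1, h2⟩ := exists_split_of_pairwise hsort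
  obtain ⟨g1, g2, g3⟩ := select_novel_list (K := K) hNbd l₁ h1
  have hall : ∀ k, ∃ i ∈ select C d K l₁, Novel β i k := by
    intro k
    obtain ⟨j, hj⟩ := hS k
    refine g3 j ?_ k hj
    rcases List.mem_append.1 (hmem j) with h | h
    · exact h
    · exact absurd ⟨k, hj⟩ (h2 j h)
  -- After the novel words all `K` topics are represented, so the cap is reached and the rest of the
  -- list is ignored.
  have hcard : K ≤ (select C d K l₁).card := by
    choose n hn hnk using hall
    have hinj : Function.Injective n := fun k k' h => (hnk k).eq (h ▸ hnk k')
    calc K = (Finset.univ.image n).card := by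
          rw [Finset.card_image_of_injective _ hinj]; simp
      _ ≤ _ := Finset.card_le_card fun i hi => by
          obtain ⟨k, -, rfl⟩ := Finset.mem_image.1 hi
          exact hn k
  have hsel : select C d K (l₁ ++ l₂) = select C d K l₁ := by
    rw [select_eq, List.foldl_append, ← select_eq, foldl_selectStep_of_card hcard]
  rw [hsel]
  refine ⟨fun k => ?_, fun i hi => h1 i (g1 i hi), fun i _ k hk => hNbd i k hk⟩
  obtain ⟨i, hi, hik⟩ := hall k
  exact ⟨i, ⟨hi, hik⟩, fun i' hi' => g2 i' hi'.1 i hi k hi'.2 hik⟩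

end Selection

/-! ### The failure probability -/

/-- Conditioning on the first coordinate without measurability of `S`: the first factor is finite,
so finitely many rectangles cover `S`, and outer measures of rectangles multiply. -/
theorem measureReal_prod_le_of_finite {α γ : Type*} [Finite α] [MeasurableSpace α]
    [MeasurableSingletonClass α] [MeasurableSpace γ] (μ : Measure α) (ν : Measure γ)
    [IsProbabilityMeasure μ] [IsProbabilityMeasure ν] (S : Set (α × γ)) (B : Set α) {b : ℝ}
    (h : ∀ x, x ∉ B → ν.real {y | (x, y) ∈ S} ≤ b) (hb : 0 ≤ b) :
    (μ.prod ν).real S ≤ μ.real B + b := by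
  classical
  have := Fintype.ofFinite α
  set F : α → Set (α × γ) := fun x => {x} ×ˢ (if x ∈ B then ∅ else {y | (x, y) ∈ S}) with hF
  have hsub : S ⊆ B ×ˢ Set.univ ∪ ⋃ x, F x := by
    rintro ⟨x, y⟩ hxy
    by_cases hx : x ∈ B
    · exact Or.inl ⟨hx, trivial⟩
    · exact Or.inr (Set.mem_iUnion.2 ⟨x, rfl, by simpa [hx] using hxy⟩)
  have hFle : ∀ x, (μ.prod ν).real (F x) ≤ μ.real {x} * b := by
    intro x
    rw [hF, measureReal_prod_prod]
    refine mul_le_mul_of_nonneg_left ?_ measureReal_nonneg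
    split_ifs with hx
    · simpa using hb
    · exact h x hx
  calc (μ.prod ν).real S ≤ (μ.prod ν).real (B ×ˢ Set.univ) + (μ.prod ν).real (⋃ x, F x) :=
        (measureReal_mono hsub).trans (measureReal_union_le _ _)
    _ ≤ μ.real B + ∑ x, μ.real {x} * b := by
        refine add_le_add ?_ ((measureReal_iUnion_fintype_le _).trans
          (Finset.sum_le_sum fun x _ => hFle x))
        rw [measureReal_prod_prod]; simp
    _ = μ.real B + b := by
        rw [← Finset.sum_mul, sum_measureReal_singleton]
        simp

instance {W K : ℕ} (T : TopicModel W K) (N M P : ℕ) : IsProbabilityMeasure (T.law N M P) := by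
  unfold TopicModel.law; infer_instance

section Main

variable {W K : ℕ} (T : TopicModel W K) (hK : 2 ≤ K) (hS : Separable T.β)
include hK hS

theorem TopicModel.two_le_words : 2 ≤ W := by
  choose n hn using hS
  have hinj : Function.Injective n := fun k k' h => (hn k).eq (h ▸ hn k')
  have := Fintype.card_le_of_injective n hinj
  simp only [Fintype.card_fin] at this
  omega

/-- An inaccurate corpus has probability at most `(2 W² + 4 W) exp (-L)`. For each accurate corpus,
the directions that fail to separate the frequencies at `q / 2` have probability at most `2 W exp
(-L)`; for all others every ordering compatible with the frequencies lists the novel words first. -/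
theorem TopicModel.failure_le (hR : Simplicial T.R') {N M P : ℕ} (hN : 2 ≤ N) (hM : 0 < M)
    (hP : 0 < P) {L y : ℝ} (hy : 0 < y) (hL : y ^ 2 = L / M)
    (hyη : 8 * y ≤ etaC T.β T.a) (hyη2 : y ≤ etaC T.β T.a ^ 2)
    (hyd : 96 * y < dC T.β T.a T.R' * (etaC T.β T.a * phiC T.R'))
    (hyρ : 12 * y * (40 * W ^ 2 * √(Real.log (2 * W / qC T.β T.a T.R'))) ≤
      rhoC T.β T.a T.R' * qC T.β T.a T.R' * (etaC T.β T.a * phiC T.R'))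
    (hLP : 100 * L ≤ P * qC T.β T.a T.R' ^ 2) :
    (T.law N M P).real (failure T.β (dC T.β T.a T.R') N M P) ≤
      (2 * W ^ 2 + 6 * W) * Real.exp (-L) := by
  have hW := T.two_le_words hK hS
  have : Nonempty (Fin W) := ⟨⟨0, by omega⟩⟩
  have hηφ : 0 < etaC T.β T.a * phiC T.R' := mul_pos T.eta_pos T.phi_pos
  set e := 12 * y / (etaC T.β T.a * phiC T.R') with he
  have he0 : 0 < e := by positivity
  have hed : 8 * e < dC T.β T.a T.R' := by
    rw [he, mul_div_assoc', div_lt_iff₀ hηφ]; linarith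
  have heρ : e * (40 * W ^ 2 * √(Real.log (2 * W / qC T.β T.a T.R'))) ≤
      rhoC T.β T.a T.R' * qC T.β T.a T.R' := by
    rw [he, div_mul_eq_mul_div, div_le_iff₀ hηφ]; exact hyρ
  have hdoc := T.measureReal_cooc_deviation_le hN hM hy hL hyη hyη2
  rw [← he] at hdoc
  have hprod := measureReal_prod_le_of_finite (Measure.pi fun _ : Fin M => T.docLaw N)
    (Measure.pi fun _ : Fin P => stdGauss W) (failure T.β (dC T.β T.a T.R') N M P)
    {docs | ∃ i j, e < |cooc docs i j - T.E i j|} (b := W * (2 * Real.exp (-L))) ?_ (by positivity)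
  · unfold TopicModel.law
    refine hprod.trans ?_
    linarith
  · intro docs hdocs
    simp only [Set.mem_ofPred_eq, not_exists, not_lt] at hdocs
    refine (measureReal_mono fun u hu => ?_).trans
      (T.measureReal_phat_le hdocs hK hS hR he0 heρ hW hed hP hLP)
    intro hgood
    obtain ⟨I, ⟨σ, hσ, rfl⟩, hfail⟩ := hu
    refine hfail (detects_select hS (fun i k hi => T.notMem_Nbd_iff hdocs hed hi) _
      (fun j => ?_) ?_)
    · rw [List.mem_ofFn]; exact ⟨σ.symm j, by simp⟩
    · rw [List.pairwise_ofFn]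
      intro a b hab hb
      by_contra hcon
      push Not at hcon
      have h1 := (hgood (σ b)).1 hb
      have h2 := (hgood (σ a)).2 hcon
      have h3 := hσ hab.le
      simp only [Function.comp_apply] at h3
      linarith

end Main

/-- The accuracy `y = √(L / M)` that a sample of size `M` affords. -/
theorem accuracy_bounds {w d ρ q η φ lam l M : ℝ} (hw : 2 ≤ w) (hd : 0 < d) (hρ : 0 < ρ)
    (hq : 0 < q) (hη : 0 < η) (hφ : 0 < φ) (hwη : w * η ≤ 1) (hdφ : d * φ ≤ 2)
    (hlam : 1 ≤ lam) (hl : 1 ≤ l) (hM : 0 < M)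
    (hM₁ : 30000 * lam / (d ^ 2 * φ ^ 2 * η ^ 4) ≤ M)
    (hM₂ : 1000000 * (w ^ 2 * l * lam) / (ρ ^ 2 * q ^ 2 * φ ^ 2 * η ^ 4) ≤ M) :
    ∃ y, 0 < y ∧ y ^ 2 = 3 * lam / M ∧ 8 * y ≤ η ∧ y ≤ η ^ 2 ∧ 96 * y < d * (η * φ) ∧
      12 * y * (40 * w ^ 2 * √l) ≤ ρ * q * (η * φ) := by
  have hη1 : η ≤ 1 / 2 := by nlinarith
  have hysq : √(3 * lam / M) ^ 2 = 3 * lam / M := Real.sq_sqrt (by positivity)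
  have hy0 : 0 < √(3 * lam / M) := Real.sqrt_pos.2 (by positivity)
  set y := √(3 * lam / M)
  -- The divisor is `100 = √(30000 / 3)`.
  have hy1 : y ≤ d * φ * η ^ 2 / 100 := by
    refine abs_le_of_sq_le_sq' ?_ (by positivity) |>.2
    rw [hysq, div_le_iff₀ hM]
    rw [div_le_iff₀ (by positivity)] at hM₁
    calc 3 * lam = 30000 * lam / 10000 := by ring
      _ ≤ M * (d ^ 2 * φ ^ 2 * η ^ 4) / 10000 := by gcongr
      _ = _ := by ring
  -- Here `480 = 12 * 40`, and `3 * 480² = 691200` is below the constant `1000000` of the sample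
  -- size.
  have hy2 : y * (480 * w ^ 2 * √l) ≤ ρ * q * (η * φ) := by
    refine abs_le_of_sq_le_sq' ?_ (by positivity) |>.2
    rw [div_le_iff₀ (by positivity)] at hM₂
    have e1 : (y * (480 * w ^ 2 * √l)) ^ 2 = 691200 * (w ^ 2 * l * lam) * w ^ 2 / M := by
      rw [mul_pow, hysq, mul_pow, Real.sq_sqrt (by linarith)]; ring
    rw [e1, div_le_iff₀ hM]
    -- The square of the left side carries `w ^ 4`, the sample size only `w ^ 2`. The missing factor
    -- is compensated by `η ^ 2`, since the sample size provides `η ^ 4` where `η ^ 2` is required.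
    have hw1 : w ^ 2 * η ^ 2 ≤ 1 := by
      rw [← mul_pow]; exact pow_le_one₀ (by positivity) hwη
    have h1 : 691200 * (w ^ 2 * l * lam) ≤ M * (ρ ^ 2 * q ^ 2 * φ ^ 2 * η ^ 4) := by
      have : 0 ≤ w ^ 2 * l * lam := by positivity
      linarith
    calc 691200 * (w ^ 2 * l * lam) * w ^ 2 ≤ M * (ρ ^ 2 * q ^ 2 * φ ^ 2 * η ^ 4) * w ^ 2 :=
          mul_le_mul_of_nonneg_right h1 (by positivity)
      _ = (ρ * q * (η * φ)) ^ 2 * M * (w ^ 2 * η ^ 2) := by ring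
      _ ≤ (ρ * q * (η * φ)) ^ 2 * M * 1 := mul_le_mul_of_nonneg_left hw1 (by positivity)
      _ = _ := mul_one _
  have hyη2 : y ≤ η ^ 2 / 50 := by
    have : d * φ * η ^ 2 ≤ 2 * η ^ 2 := mul_le_mul_of_nonneg_right hdφ (by positivity)
    linarith
  have hηη : η ^ 2 ≤ η * (1 / 2) := by rw [sq]; exact mul_le_mul_of_nonneg_left hη1 hη.le
  refine ⟨y, hy0, hysq, by linarith, by linarith [sq_nonneg η], ?_, by linarith⟩
  have h1 : 0 < d * φ * η := by positivity
  have h2 : d * φ * η ^ 2 ≤ d * φ * (η * (1 / 2)) :=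
    mul_le_mul_of_nonneg_left hηη (by positivity)
  linarith

/-! ### Explicit sample sizes and the limit -/

section Main

variable {W K : ℕ} (T : TopicModel W K) (hK : 2 ≤ K) (hS : Separable T.β) (hR : Simplicial T.R')
include hK hS hR

theorem TopicModel.failure_le_of_sample_size {N M P : ℕ} (hN : 2 ≤ N) {δ : ℝ} (hδ : 0 < δ)
    (hδ1 : δ < 1)
    (hM₁ : 30000 * Real.log (3 * W / δ) /
      (dC T.β T.a T.R' ^ 2 * phiC T.R' ^ 2 * etaC T.β T.a ^ 4) ≤ M)
    (hM₂ : 1000000 * (W ^ 2 * Real.log (2 * W / qC T.β T.a T.R') * Real.log (3 * W / δ)) /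
      (rhoC T.β T.a T.R' ^ 2 * qC T.β T.a T.R' ^ 2 * phiC T.R' ^ 2 * etaC T.β T.a ^ 4) ≤ M)
    (hP : 300 * Real.log (3 * W / δ) / qC T.β T.a T.R' ^ 2 ≤ P) :
    (T.law N M P).real (failure T.β (dC T.β T.a T.R') N M P) ≤ δ ∧ 1 ≤ P ∧ W ^ 2 ≤ M * N := by
  have hW := T.two_le_words hK hS
  have hW' : (2 : ℝ) ≤ W := by exact_mod_cast hW
  have : Nonempty (Fin W) := ⟨⟨0, by omega⟩⟩
  have hd0 := T.d_pos hK hS hR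
  have hρ0 := T.rho_pos hK hS hR
  have hq0 := T.q_pos hK hS hR
  have hq1 := T.q_le_one hK hS
  have hη0 := T.eta_pos
  have hφ0 := T.phi_pos
  have hWη := T.eta_mul_le
  have hdφ := T.d_mul_phi_le hK hS
  have hρφ := T.rho_mul_phi_le hK hS
  have hfail := fun L y => T.failure_le hK hS hR (N := N) (M := M) (P := P) (L := L) (y := y) hN
  set d := dC T.β T.a T.R'
  set ρ := rhoC T.β T.a T.R'
  set q := qC T.β T.a T.R'
  set η := etaC T.β T.a
  set φ := phiC T.R'
  have hη1 : η ≤ 1 / 2 := by nlinarith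
  set lam := Real.log (3 * W / δ) with hlam
  have h6 : 6 ≤ 3 * W / δ := by rw [le_div_iff₀ hδ]; nlinarith
  have hlam1 : 1 ≤ lam := by
    rw [hlam, Real.le_log_iff_exp_le (by linarith)]
    exact Real.exp_one_lt_three.le.trans (by linarith)
  set l := Real.log (2 * W / q) with hl
  have hl1 : 1 ≤ l := by
    have h4 : 4 ≤ 2 * W / q := by rw [le_div_iff₀ hq0]; nlinarith
    rw [hl, Real.le_log_iff_exp_le (by linarith)]
    exact Real.exp_one_lt_three.le.trans (by linarith)
  have hMpos : (0 : ℝ) < M := lt_of_lt_of_le (by positivity) hM₁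
  have hPpos : (0 : ℝ) < P := lt_of_lt_of_le (by positivity) hP
  have hM0 : 0 < M := by exact_mod_cast hMpos
  have hP0 : 0 < P := by exact_mod_cast hPpos
  refine ⟨?_, hP0, ?_⟩
  · obtain ⟨y, hy0, hysq, h1, h2, h3, h4⟩ := accuracy_bounds hW' hd0 hρ0 hq0 hη0 hφ0 hWη hdφ
      hlam1 hl1 hMpos hM₁ hM₂
    -- With `L = 3 log (3 W / δ)` the factor `exp (-L) = (δ / (3 W))³` outweighs the `2 W² + 6 W`
    -- events of the union bound. This also explains `300 = 100 * 3`.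
    refine (hfail (3 * lam) y hM0 hP0 hy0 hysq h1 h2 h3 h4 ?_).trans ?_
    · rw [div_le_iff₀ (by positivity)] at hP
      linarith
    · have hexp : Real.exp (-(3 * lam)) = (δ / (3 * W)) ^ 3 := by
        have : Real.exp (-lam) = δ / (3 * W) := by
          rw [Real.exp_neg, hlam, Real.exp_log (by positivity), inv_div]
        rw [← this, ← Real.exp_nat_mul]; congr 1; push_cast; ring
      rw [hexp, div_pow, mul_div_assoc', div_le_iff₀ (by positivity)]
      have h1 : 2 * (W : ℝ) ^ 2 + 6 * W ≤ 27 * W ^ 3 := by nlinarith [sq_nonneg (W : ℝ)]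
      have h2 : δ ^ 3 ≤ δ := by nlinarith [mul_pos hδ hδ]
      calc (2 * (W : ℝ) ^ 2 + 6 * W) * δ ^ 3 ≤ (27 * W ^ 3) * δ :=
            mul_le_mul h1 h2 (by positivity) (by positivity)
        _ = _ := by ring
  -- From `ρ φ ≤ W` and `W η ≤ 1` follows `ρ φ η ≤ 1`, so the denominator of the second sample size
  -- is at most one; its logarithms are at least one.
  · have h1 : (W : ℝ) ^ 2 ≤ M := by
      refine le_trans ?_ hM₂
      rw [le_div_iff₀ (by positivity)]
      have hden : ρ ^ 2 * q ^ 2 * φ ^ 2 * η ^ 4 ≤ 1 := by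
        have h2 : ρ * φ * η ≤ 1 := (mul_le_mul_of_nonneg_right hρφ hη0.le).trans hWη
        have h3 : ρ * φ * η * q * η ≤ 1 :=
          mul_le_one₀ (mul_le_one₀ h2 hq0.le hq1) hη0.le (by linarith)
        calc ρ ^ 2 * q ^ 2 * φ ^ 2 * η ^ 4 = (ρ * φ * η * q * η) ^ 2 := by ring
          _ ≤ 1 := pow_le_one₀ (by positivity) h3
      have hll : 1 ≤ l * lam := one_le_mul_of_one_le_of_one_le hl1 hlam1
      have hW2 : (0 : ℝ) < W ^ 2 := by positivity
      calc (W : ℝ) ^ 2 * (ρ ^ 2 * q ^ 2 * φ ^ 2 * η ^ 4) ≤ W ^ 2 * 1 :=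
            mul_le_mul_of_nonneg_left hden hW2.le
        _ ≤ W ^ 2 * (l * lam) := mul_le_mul_of_nonneg_left hll hW2.le
        _ ≤ 1000000 * (W ^ 2 * l * lam) := by
            rw [← mul_assoc]
            have : 0 ≤ (W : ℝ) ^ 2 * l * lam := by positivity
            linarith
    have h2 : W ^ 2 ≤ M := by exact_mod_cast h1
    exact h2.trans (Nat.le_mul_of_pos_right M (by omega))

end Main

/-- For a fixed level `δ < ε` the two sample sizes are constants, which `M` and `P` eventually
exceed. -/
theorem random_projection_guarantee {W K N : ℕ} (hK : 2 ≤ K) (hN : 2 ≤ N) (T : TopicModel W K)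
    (hS : Separable T.β) (hR : Simplicial T.R') :
    Tendsto (fun x : ℕ × ℕ => (T.law N x.1 x.2).real
        (failure T.β (dC T.β T.a T.R') N x.1 x.2)) (atTop ×ˢ atTop) (𝓝 0) := by
  rw [Metric.tendsto_nhds]
  intro ε hε
  set δ := min (ε / 2) (1 / 2) with hδ
  have hδ0 : 0 < δ := by positivity
  have hδ1 : δ < 1 := lt_of_le_of_lt (min_le_right _ _) (by norm_num)
  have hδε : δ < ε := lt_of_le_of_lt (min_le_left _ _) (by linarith)
  have hev := ((tendsto_natCast_atTop_atTop (R := ℝ)).eventually_ge_atTop (max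
    (30000 * Real.log (3 * W / δ) / (dC T.β T.a T.R' ^ 2 * phiC T.R' ^ 2 * etaC T.β T.a ^ 4))
    (1000000 * (W ^ 2 * Real.log (2 * W / qC T.β T.a T.R') * Real.log (3 * W / δ)) /
      (rhoC T.β T.a T.R' ^ 2 * qC T.β T.a T.R' ^ 2 * phiC T.R' ^ 2 * etaC T.β T.a ^ 4)))).prod_mk
    ((tendsto_natCast_atTop_atTop (R := ℝ)).eventually_ge_atTop
      (300 * Real.log (3 * W / δ) / qC T.β T.a T.R' ^ 2))
  filter_upwards [hev] with x hx
  rw [Real.dist_0_eq_abs, abs_of_nonneg measureReal_nonneg]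
  exact (T.failure_le_of_sample_size hK hS hR hN hδ0 hδ1 ((le_max_left _ _).trans hx.1)
    ((le_max_right _ _).trans hx.1) hx.2).1.trans_lt hδε

/-! ### A program logic with time bounds -/

/-- The assignment of a natural number register. -/
def State.setN (s : State) (x v : ℕ) : State :=
  { s with natReg := Function.update s.natReg x v }

/-- The assignment of a real register. -/
def State.setR (s : State) (x : ℕ) (v : ℝ) : State :=
  { s with realReg := Function.update s.realReg x v }

/-- The assignment of a cell of a natural number array. -/
def State.putN (s : State) (x i v : ℕ) : State :=
  { s with natArr := Function.update s.natArr x (Function.update (s.natArr x) i v) }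

/-- The assignment of a cell of a real array. -/
def State.putR (s : State) (x i : ℕ) (v : ℝ) : State :=
  { s with realArr := Function.update s.realArr x (Function.update (s.realArr x) i v) }

section Assignments

variable (s : State) (x y i j v : ℕ) (w : ℝ)

@[simp] theorem natReg_setN : (s.setN x v).natReg y = if y = x then v else s.natReg y := by
  simp [State.setN, Function.update_apply]

@[simp] theorem natArr_setN : (s.setN x v).natArr = s.natArr := rfl
@[simp] theorem realReg_setN : (s.setN x v).realReg = s.realReg := rfl
@[simp] theorem realArr_setN : (s.setN x v).realArr = s.realArr := rfl

@[simp] theorem realReg_setR : (s.setR x w).realReg y = if y = x then w else s.realReg y := by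
  simp [State.setR, Function.update_apply]

@[simp] theorem natReg_setR : (s.setR x w).natReg = s.natReg := rfl
@[simp] theorem realArr_setR : (s.setR x w).realArr = s.realArr := rfl

@[simp] theorem natArr_putN : (s.putN x i v).natArr y j =
    if y = x ∧ j = i then v else s.natArr y j := by
  by_cases h : y = x
  · subst h; simp [State.putN, Function.update_apply]
  · simp [State.putN, h]

@[simp] theorem natReg_putN : (s.putN x i v).natReg = s.natReg := rfl
@[simp] theorem realArr_putN : (s.putN x i v).realArr = s.realArr := rfl

@[simp] theorem realArr_putR : (s.putR x i w).realArr y j =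
    if y = x ∧ j = i then w else s.realArr y j := by
  by_cases h : y = x
  · subst h; simp [State.putR, Function.update_apply]
  · simp [State.putR, h]

@[simp] theorem natReg_putR : (s.putR x i w).natReg = s.natReg := rfl

end Assignments

/-- Started in `s`, the program `p` halts after at most `T` steps in a state that satisfies `Q`. -/
def Spec (p : Program) (s : State) (T : ℕ) (Q : State → Prop) : Prop :=
  ∃ s' t, Runs p s s' t ∧ t ≤ T ∧ Q s'

theorem Spec.mono {p : Program} {s : State} {T T' : ℕ} {Q Q' : State → Prop} (h : Spec p s T Q)
    (hT : T ≤ T') (hQ : ∀ s', Q s' → Q' s') : Spec p s T' Q' := by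
  obtain ⟨s', t, h1, h2, h3⟩ := h
  exact ⟨s', t, h1, h2.trans hT, hQ s' h3⟩

theorem Spec.weaken {p : Program} {s : State} {T T' : ℕ} {Q : State → Prop} (h : Spec p s T Q)
    (hT : T ≤ T') : Spec p s T' Q := h.mono hT fun _ h => h

theorem Spec.skip {s : State} {Q : State → Prop} (h : Q s) : Spec .skip s 1 Q :=
  ⟨s, 1, .skip s, le_rfl, h⟩

theorem Spec.setNat {x : ℕ} {e : NatExp} {s : State} {Q : State → Prop}
    (h : Q (s.setN x (e.eval s))) : Spec (.setNat x e) s (e.cost + 1) Q :=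
  ⟨_, _, .setNat x e s, le_rfl, h⟩

theorem Spec.setReal {x : ℕ} {e : RealExp} {s : State} {Q : State → Prop}
    (h : Q (s.setR x (e.eval s))) : Spec (.setReal x e) s (e.cost + 1) Q :=
  ⟨_, _, .setReal x e s, le_rfl, h⟩

theorem Spec.putNat {x : ℕ} {i e : NatExp} {s : State} {Q : State → Prop}
    (h : Q (s.putN x (i.eval s) (e.eval s))) :
    Spec (.putNat x i e) s (i.cost + e.cost + 1) Q :=
  ⟨_, _, .putNat x i e s, le_rfl, h⟩

theorem Spec.putReal {x : ℕ} {i : NatExp} {e : RealExp} {s : State} {Q : State → Prop}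
    (h : Q (s.putR x (i.eval s) (e.eval s))) :
    Spec (.putReal x i e) s (i.cost + e.cost + 1) Q :=
  ⟨_, _, .putReal x i e s, le_rfl, h⟩

theorem Spec.seq {p q : Program} {s : State} {T₁ T₂ : ℕ} {Q : State → Prop}
    (h : Spec p s T₁ fun s' => Spec q s' T₂ Q) : Spec (.seq p q) s (T₁ + T₂) Q := by
  obtain ⟨s', t, h1, h2, s'', t', h3, h4, h5⟩ := h
  exact ⟨s'', t + t', .seq h1 h3, add_le_add h2 h4, h5⟩

theorem Spec.ite {c : Test} {p q : Program} {s : State} {T₁ T₂ : ℕ} {Q : State → Prop}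
    (hp : c.holds s → Spec p s T₁ Q) (hq : ¬ c.holds s → Spec q s T₂ Q) :
    Spec (.ite c p q) s (c.cost + (T₁ + T₂)) Q := by
  by_cases h : c.holds s
  · obtain ⟨s', t, h1, h2, h3⟩ := hp h
    exact ⟨s', _, .iteTrue h h1, by omega, h3⟩
  · obtain ⟨s', t, h1, h2, h3⟩ := hq h
    exact ⟨s', _, .iteFalse h h1, by omega, h3⟩

/-- The loop that runs `body` for all values of the register `x` below the register `b`. -/
def forDo (x b : ℕ) (body : Program) : Program :=
  .seq (.setNat x (.lit 0)) (.loop (.natLe (.add (.reg x) (.lit 1)) (.reg b))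
    (.seq body (.setNat x (.add (.reg x) (.lit 1)))))

/-- Besides the body, a round costs `5` for the test and `4` for the increment; the remaining `7`
steps are the initial assignment and the last test. The invariant is evaluated after the increment,
so it may speak about the whole state. -/
theorem Spec.forDo {x b : ℕ} {body : Program} {s : State} (n : ℕ) {T : ℕ} (Inv : ℕ → State → Prop)
    (hxb : x ≠ b) (hb : s.natReg b = n) (h0 : Inv 0 (s.setN x 0))
    (hstep : ∀ k < n, ∀ s : State, s.natReg x = k → s.natReg b = n → Inv k s →
      Spec body s T fun s' => s'.natReg x = k ∧ s'.natReg b = n ∧ Inv (k + 1) (s'.setN x (k + 1))) :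
    Spec (forDo x b body) s (n * (T + 9) + 7) (Inv n) := by
  have hloop : ∀ m k, k + m = n → ∀ s : State, s.natReg x = k → s.natReg b = n → Inv k s →
      Spec (.loop (.natLe (.add (.reg x) (.lit 1)) (.reg b))
        (.seq body (.setNat x (.add (.reg x) (.lit 1))))) s (m * (T + 9) + 5) (Inv n) := by
    intro m
    induction m with
    | zero =>
      intro k hk s hx hb hI
      obtain rfl : k = n := by omega
      refine ⟨s, _, .loopFalse ?_, ?_, hI⟩
      · simp only [Test.holds, NatExp.eval, hx, hb]; omega
      · simp [Test.cost, NatExp.cost]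
    | succ m ih =>
      intro k hk s hx hb hI
      obtain ⟨s₁, t₁, hr, ht, hx', hb', hI'⟩ := hstep k (by omega) s hx hb hI
      obtain ⟨s₂, t₂, hr₂, ht₂, hQ⟩ := ih (k + 1) (by omega) (s₁.setN x (k + 1)) (by simp)
        (by simp [hxb.symm, hb']) hI'
      have hinc : Runs (.setNat x (.add (.reg x) (.lit 1))) s₁ (s₁.setN x (k + 1)) 4 := by
        have := Runs.setNat x (.add (.reg x) (.lit 1)) s₁
        simp only [NatExp.eval, hx'] at this
        exact this
      refine ⟨s₂, _, .loopTrue ?_ (.seq hr hinc) hr₂, ?_, hQ⟩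
      · simp only [Test.holds, NatExp.eval, hx, hb]; omega
      · simp only [Test.cost, NatExp.cost, Nat.succ_mul]
        omega
  refine (Spec.seq (Spec.setNat (x := x) (e := .lit 0) ?_)).weaken (T := 1 + 1 + (n * (T + 9) + 5))
    (by omega)
  exact hloop n 0 (by omega) _ (by simp [NatExp.eval]) (by simp [hxb.symm, hb]) h0

/-! ### The memory layout -/

/-- The input is in place, and the registers `5` and `6` hold `N / 2` and a base `B`. -/
structure Base (W K M N P B : ℕ) (d : ℝ) (D : ℕ → ℕ → ℕ) (U : ℕ → ℕ → ℝ) (s : State) : Prop where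
  reg0 : s.natReg 0 = W
  reg1 : s.natReg 1 = K
  reg2 : s.natReg 2 = M
  reg3 : s.natReg 3 = N
  reg4 : s.natReg 4 = P
  reg5 : s.natReg 5 = N / 2
  reg6 : s.natReg 6 = B
  real0 : s.realReg 0 = d
  docs : ∀ m < M, ∀ n < N, s.natArr 0 (m * N + n) = D m n
  dirs : ∀ r < P, ∀ i < W, s.realArr 0 (r * W + i) = U r i

section Base

variable {W K M N P B : ℕ} {d : ℝ} {D : ℕ → ℕ → ℕ} {U : ℕ → ℕ → ℝ} {s : State}

theorem Base.setN (h : Base W K M N P B d D U s) {x v : ℕ} (hx : 7 ≤ x) :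
    Base W K M N P B d D U (s.setN x v) := by
  constructor <;> simp only [natReg_setN, natArr_setN, realReg_setN, realArr_setN]
  · rw [if_neg (by omega), h.reg0]
  · rw [if_neg (by omega), h.reg1]
  · rw [if_neg (by omega), h.reg2]
  · rw [if_neg (by omega), h.reg3]
  · rw [if_neg (by omega), h.reg4]
  · rw [if_neg (by omega), h.reg5]
  · rw [if_neg (by omega), h.reg6]
  · exact h.real0
  · exact h.docs
  · exact h.dirs

theorem Base.setR (h : Base W K M N P B d D U s) {x : ℕ} {v : ℝ} (hx : 1 ≤ x) :
    Base W K M N P B d D U (s.setR x v) :=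
  ⟨h.reg0, h.reg1, h.reg2, h.reg3, h.reg4, h.reg5, h.reg6,
    by simp only [realReg_setR]; rw [if_neg (by omega), h.real0], h.docs, h.dirs⟩

theorem Base.putN (h : Base W K M N P B d D U s) {x i v : ℕ} (hx : 1 ≤ x) :
    Base W K M N P B d D U (s.putN x i v) :=
  ⟨h.reg0, h.reg1, h.reg2, h.reg3, h.reg4, h.reg5, h.reg6, h.real0,
    fun m hm n hn => by
      simp only [natArr_putN]; rw [if_neg (by omega), h.docs m hm n hn], h.dirs⟩

theorem Base.putR (h : Base W K M N P B d D U s) {x i : ℕ} {v : ℝ} (hx : 1 ≤ x) :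
    Base W K M N P B d D U (s.putR x i v) :=
  ⟨h.reg0, h.reg1, h.reg2, h.reg3, h.reg4, h.reg5, h.reg6, h.real0, h.docs,
    fun m hm n hn => by
      simp only [realArr_putR]; rw [if_neg (by omega), h.dirs m hm n hn]⟩

end Base

/-! ### Counting the words -/

/-- The table of the powers of the base in array `2`, and ones in array `6`. -/
def tableProg : Program :=
  .seq (.putNat 2 (.lit 0) (.lit 1))
    (forDo 7 0 (.seq (.putNat 2 (.add (.reg 7) (.lit 1)) (.mul (.get 2 (.reg 7)) (.reg 6)))
      (.putNat 6 (.reg 7) (.lit 1))))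

section Stages

variable {W K M N P B : ℕ} {d : ℝ} {D : ℕ → ℕ → ℕ} {U : ℕ → ℕ → ℝ}

/-- The counters in array `6` start at one rather than zero, which keeps the value zero free to mark
words already processed by the selection. -/
theorem spec_tableProg {s : State} (hs : Base W K M N P B d D U s)
    (h1 : ∀ i, s.natArr 1 i = 0) (h3 : ∀ i, s.natArr 3 i = 0) (h4 : ∀ i, s.natArr 4 i = 0)
    (h5 : ∀ i, s.natArr 5 i = 0) :
    Spec tableProg s (W * 30 + 20) fun s => Base W K M N P B d D U s ∧
      ((∀ i, s.natArr 1 i = 0) ∧ (∀ i, s.natArr 3 i = 0) ∧ (∀ i, s.natArr 4 i = 0) ∧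
        ∀ i, s.natArr 5 i = 0) ∧
      (∀ i < W, s.natArr 2 i = B ^ i) ∧ ∀ i < W, s.natArr 6 i = 1 := by
  refine Spec.mono (Spec.seq (Spec.putNat (Spec.forDo (T := 12) W (fun k s =>
    Base W K M N P B d D U s ∧
      ((∀ i, s.natArr 1 i = 0) ∧ (∀ i, s.natArr 3 i = 0) ∧ (∀ i, s.natArr 4 i = 0) ∧
        ∀ i, s.natArr 5 i = 0) ∧
      (∀ i ≤ k, s.natArr 2 i = B ^ i) ∧ ∀ i < k, s.natArr 6 i = 1) (by norm_num) ?_ ?_ ?_)))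
    ?_ ?_
  · simp [hs.reg0]
  · refine ⟨(hs.putN (by norm_num)).setN (by norm_num), ?_, ?_, ?_⟩
    · simp [h1, h3, h4, h5]
    · intro i hi
      obtain rfl : i = 0 := by omega
      simp [NatExp.eval]
    · intro i hi; omega
  · rintro k hk s hx hb ⟨hB, h0, hp, h6⟩
    refine Spec.weaken (Spec.seq (Spec.putNat (Spec.putNat ?_))) (by simp [NatExp.cost])
    refine ⟨by simpa using hx, by simpa using hb,
      ((hB.putN (by norm_num)).putN (by norm_num)).setN (by norm_num), ?_, ?_, ?_⟩
    · simpa [NatExp.eval] using h0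
    · intro i hi
      simp only [NatExp.eval, hx, hB.reg6, natArr_setN, natArr_putN, natReg_putN]
      by_cases hik : i = k + 1
      · subst hik; simp [hp k le_rfl, pow_succ]
      · simp [hik, hp i (by omega)]
    · intro i hi
      simp only [NatExp.eval, hx, natArr_setN, natArr_putN, natReg_putN]
      by_cases hik : i = k
      · simp [hik]
      · simp [hik, h6 i (by omega)]
  · simp only [NatExp.cost]; omega
  · rintro s ⟨hB, h0, hp, h6⟩
    exact ⟨hB, h0, fun i hi => hp i hi.le, h6⟩

end Stages

/-- The number of occurrences of the word `i` among the first `n` words of document `m` that lie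
in its first half; the words are given by `D`, the half has length `H`. -/
def cnt₁ (D : ℕ → ℕ → ℕ) (H n m i : ℕ) : ℕ :=
  ∑ n' ∈ Finset.range n, if n' < H ∧ D m n' = i then 1 else 0

/-- The number of occurrences of the word `i` among the first `n` words of document `m` that lie
in its second half. -/
def cnt₂ (D : ℕ → ℕ → ℕ) (H n m i : ℕ) : ℕ :=
  ∑ n' ∈ Finset.range n, if H ≤ n' ∧ D m n' = i then 1 else 0

theorem cnt₁_succ (D : ℕ → ℕ → ℕ) (H n m i : ℕ) :
    cnt₁ D H (n + 1) m i = cnt₁ D H n m i + if n < H ∧ D m n = i then 1 else 0 :=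
  Finset.sum_range_succ _ _

theorem cnt₂_succ (D : ℕ → ℕ → ℕ) (H n m i : ℕ) :
    cnt₂ D H (n + 1) m i = cnt₂ D H n m i + if H ≤ n ∧ D m n = i then 1 else 0 :=
  Finset.sum_range_succ _ _

/-- The word counts of the first half of a document, packed into one number in base `B`. -/
def pack (D : ℕ → ℕ → ℕ) (B H n m : ℕ) : ℕ :=
  ∑ n' ∈ Finset.range n, if n' < H then B ^ D m n' else 0

/-- The word counts of the halves in the arrays `3` and `4`, and in array `5` the packed rows of the
product of the count matrices. -/
def countProg : Program :=
  forDo 7 2 (.seq (.setNat 10 (.lit 0)) (forDo 8 3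
    (.seq (.setNat 11 (.get 0 (.add (.mul (.reg 7) (.reg 3)) (.reg 8))))
      (.ite (.natLe (.add (.reg 8) (.lit 1)) (.reg 5))
        (.seq (.setNat 10 (.add (.reg 10) (.get 2 (.reg 11))))
          (.putNat 3 (.reg 11) (.add (.get 3 (.reg 11)) (.lit 1))))
        (.seq (.putNat 5 (.reg 11) (.add (.get 5 (.reg 11)) (.reg 10)))
          (.putNat 4 (.reg 11) (.add (.get 4 (.reg 11)) (.lit 1))))))))

section Stages

variable {W K M N P B : ℕ} {d : ℝ} {D : ℕ → ℕ → ℕ} {U : ℕ → ℕ → ℝ}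

/-- Within a document, register `10` collects the packed counts of the first half. Every word of the
second half adds this number to its own row, so the product of the count matrices is accumulated at
constant cost per word. -/
theorem spec_countProg (hD : ∀ m < M, ∀ n < N, D m n < W) {s : State}
    (hs : Base W K M N P B d D U s)
    (h1 : ∀ i, s.natArr 1 i = 0) (h3 : ∀ i, s.natArr 3 i = 0) (h4 : ∀ i, s.natArr 4 i = 0)
    (h5 : ∀ i, s.natArr 5 i = 0) (h2 : ∀ i < W, s.natArr 2 i = B ^ i)
    (h6 : ∀ i < W, s.natArr 6 i = 1) :
    Spec countProg s (M * (N * 50 + 20) + 20) fun s => Base W K M N P B d D U s ∧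
      (∀ i, s.natArr 1 i = 0) ∧ (∀ i < W, s.natArr 2 i = B ^ i) ∧ (∀ i < W, s.natArr 6 i = 1) ∧
      (∀ i, s.natArr 3 i = ∑ m ∈ Finset.range M, cnt₁ D (N / 2) N m i) ∧
      (∀ i, s.natArr 4 i = ∑ m ∈ Finset.range M, cnt₂ D (N / 2) N m i) ∧
      (∀ i, s.natArr 5 i =
        ∑ m ∈ Finset.range M, cnt₂ D (N / 2) N m i * pack D B (N / 2) N m) := by
  refine Spec.mono (Spec.forDo (T := N * 50 + 11) M (fun k s => Base W K M N P B d D U s ∧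
      (∀ i, s.natArr 1 i = 0) ∧ (∀ i < W, s.natArr 2 i = B ^ i) ∧ (∀ i < W, s.natArr 6 i = 1) ∧
      (∀ i, s.natArr 3 i = ∑ m ∈ Finset.range k, cnt₁ D (N / 2) N m i) ∧
      (∀ i, s.natArr 4 i = ∑ m ∈ Finset.range k, cnt₂ D (N / 2) N m i) ∧
      (∀ i, s.natArr 5 i =
        ∑ m ∈ Finset.range k, cnt₂ D (N / 2) N m i * pack D B (N / 2) N m))
    (by norm_num) hs.reg2 ?_ ?_) ?_ (fun _ h => h)
  · exact ⟨hs.setN (by norm_num), by simpa using h1, by simpa using h2, by simpa using h6,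
      by simpa using h3, by simpa using h4, by simpa using h5⟩
  · rintro m hm s hx hb ⟨hB, h1, h2, h6, h3, h4, h5⟩
    refine Spec.mono (Spec.seq (Spec.setNat (Spec.forDo (T := 41) N (fun k s =>
      (Base W K M N P B d D U s ∧ s.natReg 7 = m ∧ s.natReg 10 = pack D B (N / 2) k m) ∧
      (∀ i, s.natArr 1 i = 0) ∧ (∀ i < W, s.natArr 2 i = B ^ i) ∧ (∀ i < W, s.natArr 6 i = 1) ∧
      (∀ i, s.natArr 3 i = ∑ m ∈ Finset.range m, cnt₁ D (N / 2) N m i + cnt₁ D (N / 2) k m i) ∧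
      (∀ i, s.natArr 4 i = ∑ m ∈ Finset.range m, cnt₂ D (N / 2) N m i + cnt₂ D (N / 2) k m i) ∧
      (∀ i, s.natArr 5 i =
        ∑ m ∈ Finset.range m, cnt₂ D (N / 2) N m i * pack D B (N / 2) N m +
          cnt₂ D (N / 2) k m i * pack D B (N / 2) k m)) (by norm_num) ?_ ?_ ?_))) ?_ ?_
    · simp [hB.reg3]
    · refine ⟨⟨(hB.setN (by norm_num)).setN (by norm_num), by simpa using hx,
        by simp [NatExp.eval, pack]⟩, by simpa using h1, by simpa using h2, by simpa using h6,
        by simpa [cnt₁] using h3, by simpa [cnt₂] using h4, by simpa [pack] using h5⟩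
    · rintro n hn s hx hb ⟨⟨hB, h7, h10⟩, h1, h2, h6, h3, h4, h5⟩
      have hw : s.natArr 0 (m * N + n) = D m n := hB.docs m hm n hn
      have hpw := h2 _ (hD m hm n hn)
      refine Spec.weaken (Spec.seq (Spec.setNat (Spec.ite (fun hc => Spec.seq (Spec.setNat
        (Spec.putNat ?_))) (fun hc => Spec.seq (Spec.putNat (Spec.putNat ?_))))))
        (by simp [NatExp.cost, Test.cost])
      · simp only [Test.holds, NatExp.eval, natReg_setN, hx, hB.reg5] at hc
        have hc' : n < N / 2 := by simpa [hx, hB.reg5] using hc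
        have hc'' : ¬ N / 2 ≤ n := by omega
        -- While the packed number still grows, no word of the second half has been counted, so the
        -- product in the invariant stays zero.
        have hz : ∀ i, cnt₂ D (N / 2) n m i = 0 := fun i =>
          Finset.sum_eq_zero fun n' hn' => if_neg fun h => by
            have := Finset.mem_range.1 hn'; omega
        refine ⟨by simpa using hx, by simpa using hb,
          ⟨((((hB.setN (by norm_num)).setN (by norm_num)).putN (by norm_num)).setN (by norm_num)),
          by simpa using h7, ?_⟩, by simpa using h1, by simpa using h2, by simpa using h6, ?_, ?_, ?_⟩
        · simp [NatExp.eval, h7, hB.reg3, hx, hw, hpw, h10, pack, Finset.sum_range_succ, hc']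
        · intro i
          simp only [NatExp.eval, natReg_setN, natArr_setN, natArr_putN]
          simp only [h7, hB.reg3, hx, hw, cnt₁, Finset.sum_range_succ, hc', true_and]
          by_cases hi : i = D m n
          · subst hi; simp [h3, cnt₁]; ring
          · simp [hi, Ne.symm hi, h3, cnt₁]
        · intro i
          simp [h4, cnt₂_succ, hc'']
        · intro i
          have hz' : cnt₂ D (N / 2) (n + 1) m i = 0 := by
            have := hz i
            simp only [cnt₂, Finset.sum_range_succ] at this ⊢
            rw [this, if_neg (fun h => hc'' h.1)]
          simp [h5, hz, hz']
      · have hc' : N / 2 ≤ n := by simpa [Test.holds, NatExp.eval, hx, hB.reg5] using hc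
        have hc'' : ¬ n < N / 2 := by omega
        refine ⟨by simpa using hx, by simpa using hb,
          ⟨((((hB.setN (by norm_num)).putN (by norm_num)).putN (by norm_num)).setN (by norm_num)),
          by simpa using h7, ?_⟩, by simpa using h1, by simpa using h2, by simpa using h6, ?_, ?_, ?_⟩
        · simp [h10, pack, Finset.sum_range_succ, hc'']
        · intro i
          simp [h3, cnt₁_succ, hc'']
        · intro i
          simp only [NatExp.eval, natReg_setN, natArr_setN, natArr_putN, natReg_putN]
          simp only [h7, hB.reg3, hx, hw, cnt₂, Finset.sum_range_succ, hc', true_and]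
          by_cases hi : i = D m n
          · subst hi; simp [h4, cnt₂]; ring
          · simp [hi, Ne.symm hi, h4, cnt₂]
        · intro i
          -- In the second half the packed number is already complete; only the other factor of the
          -- product grows.
          have hp : pack D B (N / 2) (n + 1) m = pack D B (N / 2) n m := by
            simp [pack, Finset.sum_range_succ, hc'']
          rw [hp]
          simp only [NatExp.eval, natReg_setN, natArr_setN, natArr_putN, natReg_putN]
          simp only [h7, hB.reg3, hx, hw, cnt₂, Finset.sum_range_succ, hc', true_and]
          by_cases hi : i = D m n
          · subst hi; simp [h5, h10, cnt₂]; ring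
          · simp [hi, Ne.symm hi, h5, cnt₂]
    · simp only [NatExp.cost]; omega
    · rintro s ⟨⟨hB, h7, h10⟩, h1, h2, h6, h3, h4, h5⟩
      refine ⟨h7, hB.reg2, hB.setN (by norm_num), by simpa using h1, by simpa using h2,
        by simpa using h6, ?_, ?_, ?_⟩
      · simpa [Finset.sum_range_succ] using h3
      · simpa [Finset.sum_range_succ] using h4
      · simpa [Finset.sum_range_succ] using h5
  · nlinarith

end Stages

/-! ### Digits -/

theorem sum_digits_lt {B : ℕ} {f : ℕ → ℕ} {n : ℕ} (hf : ∀ j < n, f j < B) :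
    ∑ j ∈ Finset.range n, f j * B ^ j < B ^ n := by
  induction n with
  | zero => simp
  | succ n ih =>
    rw [Finset.sum_range_succ, pow_succ]
    have h1 := ih fun j hj => hf j (by omega)
    have h2 := Nat.mul_le_mul_right (B ^ n) (hf n (by omega))
    rw [Nat.succ_mul] at h2
    rw [mul_comm (B ^ n)]
    omega

/-- The digits below `i` sum to less than `B ^ i` and disappear in the division; those above `i`
contribute a multiple of `B`. -/
theorem digit_sum_digits {B : ℕ} {f : ℕ → ℕ} {n i : ℕ} (hf : ∀ j < n, f j < B) (hi : i < n) :
    (∑ j ∈ Finset.range n, f j * B ^ j) / B ^ i % B = f i := by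
  obtain ⟨r, rfl⟩ : ∃ r, n = i + (r + 1) := ⟨n - i - 1, by omega⟩
  have hB : 0 < B := (Nat.zero_le _).trans_lt (hf i hi)
  have h : ∑ j ∈ Finset.range (i + (r + 1)), f j * B ^ j =
      ∑ j ∈ Finset.range i, f j * B ^ j +
        B ^ i * (f i + B * ∑ j ∈ Finset.range r, f (i + (j + 1)) * B ^ j) := by
    rw [Finset.sum_range_add, Finset.sum_range_succ' _ r, mul_add, Finset.mul_sum, Finset.mul_sum]
    rw [add_comm (∑ j ∈ Finset.range r, f (i + (j + 1)) * B ^ (i + (j + 1)))]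
    congr 1
    congr 1
    · rw [add_zero, mul_comm]
    · exact Finset.sum_congr rfl fun j _ => by ring
  rw [h, Nat.add_mul_div_left _ _ (pow_pos hB i),
    Nat.div_eq_of_lt (sum_digits_lt fun j hj => hf j (by omega)), zero_add,
    Nat.add_mul_mod_self_left, Nat.mod_eq_of_lt (hf i hi)]

theorem cnt₁_le (D : ℕ → ℕ → ℕ) (H n m i : ℕ) : cnt₁ D H n m i ≤ n := by
  calc cnt₁ D H n m i ≤ ∑ _n' ∈ Finset.range n, 1 :=
        Finset.sum_le_sum fun n' _ => by split_ifs <;> norm_num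
    _ = n := by simp

theorem cnt₂_le (D : ℕ → ℕ → ℕ) (H n m i : ℕ) : cnt₂ D H n m i ≤ n := by
  calc cnt₂ D H n m i ≤ ∑ _n' ∈ Finset.range n, 1 :=
        Finset.sum_le_sum fun n' _ => by split_ifs <;> norm_num
    _ = n := by simp

/-- Grouping the positions by the word they carry shows that the digits of the packed number are the
word counts. -/
theorem pack_eq {D : ℕ → ℕ → ℕ} {B H n m W : ℕ} (hD : ∀ n' < n, D m n' < W) :
    pack D B H n m = ∑ j ∈ Finset.range W, cnt₁ D H n m j * B ^ j := by
  simp only [cnt₁, Finset.sum_mul]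
  rw [Finset.sum_comm]
  refine Finset.sum_congr rfl fun n' hn' => ?_
  rw [Finset.sum_eq_single (D m n')]
  · by_cases h : n' < H <;> simp [h]
  · intro j _ hj
    rw [if_neg (fun h => hj h.2.symm), zero_mul]
  · intro h
    exact absurd (Finset.mem_range.2 (hD n' (Finset.mem_range.1 hn'))) h

/-- The product of the count matrices is read off the packed rows. -/
theorem digit_packed_row {D : ℕ → ℕ → ℕ} {W M N H i j : ℕ}
    (hD : ∀ m < M, ∀ n < N, D m n < W) (hj : j < W) :
    (∑ m ∈ Finset.range M, cnt₂ D H N m i * pack D (M * N * N + 1) H N m) /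
      (M * N * N + 1) ^ j % (M * N * N + 1) =
      ∑ m ∈ Finset.range M, cnt₂ D H N m i * cnt₁ D H N m j := by
  have h : ∑ m ∈ Finset.range M, cnt₂ D H N m i * pack D (M * N * N + 1) H N m =
      ∑ j ∈ Finset.range W, (∑ m ∈ Finset.range M, cnt₂ D H N m i * cnt₁ D H N m j) *
        (M * N * N + 1) ^ j := by
    simp only [Finset.sum_mul]
    rw [Finset.sum_comm]
    refine Finset.sum_congr rfl fun m hm => ?_
    rw [pack_eq (hD m (Finset.mem_range.1 hm)), Finset.mul_sum]
    exact Finset.sum_congr rfl fun j _ => by ring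
  rw [h]
  refine digit_sum_digits (fun j _ => ?_) hj
  -- No carries occur: each entry of the product is at most `M N²`, which is less than the base.
  have : ∑ m ∈ Finset.range M, cnt₂ D H N m i * cnt₁ D H N m j ≤
      ∑ _m ∈ Finset.range M, N * N :=
    Finset.sum_le_sum fun m _ => Nat.mul_le_mul (cnt₂_le _ _ _ _ _) (cnt₁_le _ _ _ _ _)
  rw [Finset.sum_const, Finset.card_range, smul_eq_mul, ← mul_assoc] at this
  omega

/-! ### The co-occurrence matrix -/

/-- The cell of the entry `(i, j)` of a matrix of size `W`. -/
def cell (i j : NatExp) : NatExp := .add (.mul i (.reg 0)) j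

@[simp] theorem eval_cell (s : State) (i j : NatExp) :
    (cell i j).eval s = i.eval s * s.natReg 0 + j.eval s := rfl

@[simp] theorem cost_cell (i j : NatExp) : (cell i j).cost = i.cost + j.cost + 3 := by
  simp only [cell, NatExp.cost]; omega

/-- The co-occurrence matrix in the real array `1`. -/
def coocProg : Program :=
  forDo 7 0 (forDo 8 0
    (.seq (.setNat 10 (.div (.get 5 (.reg 7)) (.get 2 (.reg 8))))
      (.putReal 1 (cell (.reg 7) (.reg 8))
        (.div (.mul (.ofNat (.reg 2))
            (.ofNat (.sub (.reg 10) (.mul (.div (.reg 10) (.reg 6)) (.reg 6)))))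
          (.mul (.ofNat (.get 4 (.reg 7))) (.ofNat (.get 3 (.reg 8))))))))

section Stages

variable {W K M N P B : ℕ} {d : ℝ} {D : ℕ → ℕ → ℕ} {U : ℕ → ℕ → ℝ}

theorem cell_inj {W i j i' j' : ℕ} (hj : j < W) (hj' : j' < W) (h : i * W + j = i' * W + j') :
    i = i' ∧ j = j' := by
  have hW : 0 < W := by omega
  have h1 : i = i' := by
    have e := congrArg (· / W) h
    simpa only [mul_comm _ W, Nat.mul_add_div hW, Nat.div_eq_of_lt hj, Nat.div_eq_of_lt hj',
      add_zero] using e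
  subst h1
  exact ⟨rfl, by omega⟩

theorem spec_coocProg {s : State} (hs : Base W K M N P B d D U s) {pw S₁ S₂ Q : ℕ → ℕ}
    {Cm : ℕ → ℕ → ℝ} (h1 : ∀ i, s.natArr 1 i = 0) (h2 : ∀ i < W, s.natArr 2 i = pw i)
    (h6 : ∀ i < W, s.natArr 6 i = 1) (h3 : ∀ i, s.natArr 3 i = S₁ i)
    (h4 : ∀ i, s.natArr 4 i = S₂ i) (h5 : ∀ i, s.natArr 5 i = Q i)
    (hC : ∀ i < W, ∀ j < W, Cm i j = (M * (Q i / pw j % B : ℕ) : ℝ) / (S₂ i * S₁ j)) :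
    Spec coocProg s (W * (W * 60 + 20) + 20) fun s => Base W K M N P B d D U s ∧
      (∀ i, s.natArr 1 i = 0) ∧ (∀ i < W, s.natArr 6 i = 1) ∧
      ∀ i < W, ∀ j < W, s.realArr 1 (i * W + j) = Cm i j := by
  refine Spec.mono (Spec.forDo (T := W * 60 + 7) W (fun k s => Base W K M N P B d D U s ∧
      ((∀ i, s.natArr 1 i = 0) ∧ (∀ i < W, s.natArr 6 i = 1) ∧ (∀ i < W, s.natArr 2 i = pw i) ∧
      (∀ i, s.natArr 3 i = S₁ i) ∧ (∀ i, s.natArr 4 i = S₂ i) ∧ ∀ i, s.natArr 5 i = Q i) ∧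
      ∀ i < k, ∀ j < W, s.realArr 1 (i * W + j) = Cm i j)
    (by norm_num) hs.reg0 ?_ ?_) ?_ (fun s h => ⟨h.1, h.2.1.1, h.2.1.2.1, h.2.2⟩)
  · refine ⟨hs.setN (by norm_num), by simpa using ⟨h1, h6, h2, h3, h4, h5⟩, by simp⟩
  · rintro i hi s hx hb ⟨hB, hA, hc⟩
    refine Spec.mono (Spec.forDo (T := 45) W (fun k s =>
      (Base W K M N P B d D U s ∧ s.natReg 7 = i) ∧
      ((∀ i, s.natArr 1 i = 0) ∧ (∀ i < W, s.natArr 6 i = 1) ∧ (∀ i < W, s.natArr 2 i = pw i) ∧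
      (∀ i, s.natArr 3 i = S₁ i) ∧ (∀ i, s.natArr 4 i = S₂ i) ∧ ∀ i, s.natArr 5 i = Q i) ∧
      (∀ i' < i, ∀ j < W, s.realArr 1 (i' * W + j) = Cm i' j) ∧
      ∀ j < k, s.realArr 1 (i * W + j) = Cm i j)
      (by norm_num) hB.reg0 ?_ ?_) ?_ ?_
    · exact ⟨⟨hB.setN (by norm_num), by simpa using hx⟩, by simpa using hA, by simpa using hc,
        by simp⟩
    · rintro j hj s hx hb ⟨⟨hB, h7⟩, hA, hc, hc'⟩
      obtain ⟨h1, h6, h2, h3, h4, h5⟩ := hA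
      refine Spec.weaken (Spec.seq (Spec.setNat (Spec.putReal ?_)))
        (by simp [NatExp.cost, RealExp.cost])
      refine ⟨by simpa using hx, by simpa using hb,
        ⟨((hB.setN (by norm_num)).putR (by norm_num)).setN (by norm_num), by simpa using h7⟩,
        by simpa using ⟨h1, h6, h2, h3, h4, h5⟩, ?_, ?_⟩
      · intro i' hi' j' hj'
        have hne : i' * W + j' ≠ i * W + j := fun h => by
          have := (cell_inj hj' hj h).1; omega
        simp [NatExp.eval, h7, hx, hB.reg0, hne, hc i' hi' j' hj']
      · intro j' hj'
        by_cases hjj : j' = j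
        · subst hjj
          -- The remainder is computed from a quotient and a subtraction, since the machine has no
          -- such operation.
          have hmod : Q i / pw j' - Q i / pw j' / B * B = Q i / pw j' % B := by
            have := Nat.mod_add_div (Q i / pw j') B
            rw [mul_comm] at this
            omega
          simp [NatExp.eval, RealExp.eval, h7, hx, hB.reg0, hB.reg2, hB.reg6, h5, h3, h4,
            h2 j' hj, hC i hi j' hj, ← hmod]
        · simp [NatExp.eval, h7, hx, hB.reg0, hjj, hc' j' (by omega)]
    · nlinarith
    · rintro s ⟨⟨hB, h7⟩, hA, hc, hc'⟩
      refine ⟨h7, hB.reg0, hB.setN (by norm_num), by simpa using hA, ?_⟩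
      intro i' hi' j hj
      simp only [realArr_setN]
      by_cases h : i' = i
      · subst h; exact hc' j hj
      · exact hc i' (by omega) j hj
  · nlinarith

end Stages

/-! ### The frequencies of the words -/

/-- The expression `C_ii - 2 C_ij + C_jj`. -/
def quadExp (i j : NatExp) : RealExp :=
  .add (.sub (.get 1 (cell i i)) (.mul (.ofNat (.lit 2)) (.get 1 (cell i j)))) (.get 1 (cell j j))

/-- The test whether `j` lies in `Nbd(i)`. -/
def nbdTest (i j : NatExp) : Test := .realLe (.div (.reg 0) (.ofNat (.lit 2))) (quadExp i j)

/-- The product of the co-occurrence matrix and the direction in register `7`. -/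
def projectProg : Program :=
  forDo 8 0 (.seq (.setReal 1 (.ofNat (.lit 0)))
    (.seq (forDo 9 0 (.setReal 1 (.add (.reg 1) (.mul (.get 1 (cell (.reg 8) (.reg 9)))
        (.get 0 (cell (.reg 7) (.reg 9)))))))
      (.putReal 2 (.reg 8) (.reg 1))))

/-- The increment of the counters of the words that are maximal in their neighbourhoods. -/
def voteProg : Program :=
  forDo 8 0 (.seq (.setNat 10 (.lit 1))
    (.seq (forDo 9 0 (.ite (nbdTest (.reg 8) (.reg 9))
        (.ite (.realLe (.get 2 (.reg 9)) (.get 2 (.reg 8))) .skip (.setNat 10 (.lit 0))) .skip))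
      (.putNat 6 (.reg 8) (.add (.get 6 (.reg 8)) (.reg 10)))))

/-- The counters of all words, in array `6`. -/
def phatProg : Program := forDo 7 4 (.seq projectProg voteProg)

/-- The word `j` lies in the neighbourhood of `i`. -/
def IsNbd (Cm : ℕ → ℕ → ℝ) (d : ℝ) (i j : ℕ) : Prop :=
  d / 2 ≤ Cm i i - 2 * Cm i j + Cm j j

/-- The product of the row `i` of `Cm` and the direction `r`. -/
def proj (W : ℕ) (Cm U : ℕ → ℕ → ℝ) (r i : ℕ) : ℝ := ∑ j ∈ Finset.range W, Cm i j * U r j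

/-- The word `i` is maximal in the direction `r` among the words of its neighbourhood. -/
def Maximal (W : ℕ) (Cm U : ℕ → ℕ → ℝ) (d : ℝ) (r i : ℕ) : Prop :=
  ∀ j < W, IsNbd Cm d i j → proj W Cm U r j ≤ proj W Cm U r i

open Classical in
/-- The number of directions among the first `n` in which the word `i` is maximal. -/
def votes (W : ℕ) (Cm U : ℕ → ℕ → ℝ) (d : ℝ) (n i : ℕ) : ℕ :=
  ∑ r ∈ Finset.range n, if Maximal W Cm U d r i then 1 else 0

section Stages

variable {W K M N P B : ℕ} {d : ℝ} {D : ℕ → ℕ → ℕ} {U Cm : ℕ → ℕ → ℝ}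

/-- The input is in place and the real array `1` holds the matrix `Cm`. -/
structure Base' (W K M N P B : ℕ) (d : ℝ) (D : ℕ → ℕ → ℕ) (U Cm : ℕ → ℕ → ℝ) (s : State) :
    Prop where
  base : Base W K M N P B d D U s
  mat : ∀ i < W, ∀ j < W, s.realArr 1 (i * W + j) = Cm i j

theorem Base'.setN {s : State} (h : Base' W K M N P B d D U Cm s) {x v : ℕ} (hx : 7 ≤ x) :
    Base' W K M N P B d D U Cm (s.setN x v) := ⟨h.base.setN hx, h.mat⟩

theorem Base'.setR {s : State} (h : Base' W K M N P B d D U Cm s) {x : ℕ} {v : ℝ} (hx : 1 ≤ x) :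
    Base' W K M N P B d D U Cm (s.setR x v) := ⟨h.base.setR hx, h.mat⟩

theorem Base'.putN {s : State} (h : Base' W K M N P B d D U Cm s) {x i v : ℕ} (hx : 1 ≤ x) :
    Base' W K M N P B d D U Cm (s.putN x i v) := ⟨h.base.putN hx, h.mat⟩

theorem Base'.putR {s : State} (h : Base' W K M N P B d D U Cm s) {x i : ℕ} {v : ℝ} (hx : 2 ≤ x) :
    Base' W K M N P B d D U Cm (s.putR x i v) :=
  ⟨h.base.putR (by omega), fun i hi j hj => by
    simp only [realArr_putR]; rw [if_neg (by omega), h.mat i hi j hj]⟩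

theorem nbdTest_holds {s : State} (h : Base' W K M N P B d D U Cm s) {i j : NatExp} {a b : ℕ}
    (hi : i.eval s = a) (hj : j.eval s = b) (ha : a < W) (hb : b < W) :
    (nbdTest i j).holds s ↔ IsNbd Cm d a b := by
  simp only [nbdTest, quadExp, Test.holds, RealExp.eval, NatExp.eval, eval_cell, hi, hj,
    h.base.reg0, h.base.real0, h.mat a ha a ha, h.mat a ha b hb, h.mat b hb b hb, IsNbd]
  norm_num

theorem spec_projectProg {r : ℕ} (hr : r < P) {s : State} (hs : Base' W K M N P B d D U Cm s)
    (h7 : s.natReg 7 = r) {A : ℕ → ℕ → ℕ} (hA : s.natArr = A) :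
    Spec projectProg s (W * (W * 60 + 40) + 20) fun s => Base' W K M N P B d D U Cm s ∧
      s.natReg 7 = r ∧ s.natArr = A ∧ ∀ i < W, s.realArr 2 i = proj W Cm U r i := by
  refine Spec.mono (Spec.forDo (T := W * 60 + 20) W (fun k s => Base' W K M N P B d D U Cm s ∧
    s.natReg 7 = r ∧ s.natArr = A ∧ ∀ i < k, s.realArr 2 i = proj W Cm U r i)
    (by norm_num) hs.base.reg0 ⟨hs.setN (by norm_num), by simpa using h7, hA, by simp⟩ ?_)
    (by nlinarith) (fun _ h => h)
  rintro i hi s hx hb ⟨hB, h7, hA, hy⟩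
  refine Spec.weaken (Spec.seq (Spec.setReal (Spec.seq (Spec.mono (Spec.forDo (T := 30) W
    (fun k s => (Base' W K M N P B d D U Cm s ∧ s.natReg 8 = i) ∧
      (s.natReg 7 = r ∧ s.natArr = A ∧ ∀ i' < i, s.realArr 2 i' = proj W Cm U r i') ∧
      s.realReg 1 = ∑ j ∈ Finset.range k, Cm i j * U r j) (by norm_num)
      (by simpa using hB.base.reg0) ?_ ?_) le_rfl ?_)))) (T := 2 + 1 + (W * (30 + 9) + 7 + 3)) ?_
  · exact ⟨⟨(hB.setR (by norm_num)).setN (by norm_num), by simpa using hx⟩,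
      ⟨by simpa using h7, hA, by simpa using hy⟩, by simp [RealExp.eval, NatExp.eval]⟩
  · rintro j hj s hx hb ⟨⟨hB, h8⟩, ⟨h7, hA, hy⟩, hsum⟩
    refine Spec.weaken (Spec.setReal ?_) (by simp [NatExp.cost, RealExp.cost])
    refine ⟨by simpa using hx, by simpa using hb, ⟨(hB.setR (by norm_num)).setN (by norm_num),
      by simpa using h8⟩, ⟨by simpa using h7, hA, by simpa using hy⟩, ?_⟩
    simp [RealExp.eval, NatExp.eval, h8, h7, hx, hB.base.reg0, hB.mat i hi j hj,
      hB.base.dirs r hr j hj, hsum, Finset.sum_range_succ]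
  · rintro s ⟨⟨hB, h8⟩, ⟨h7, hA, hy⟩, hsum⟩
    refine Spec.putReal ⟨by simpa using h8, by simpa using hB.base.reg0,
      (hB.putR (by norm_num)).setN (by norm_num), by simpa using h7, hA, ?_⟩
    intro i' hi'
    by_cases h : i' = i
    · simp [h, NatExp.eval, RealExp.eval, h8, hsum, proj]
    · simp [h, NatExp.eval, h8, hy i' (by omega)]
  · omega

open Classical in
theorem spec_voteProg {r : ℕ} {s : State} (hs : Base' W K M N P B d D U Cm s)
    (h7 : s.natReg 7 = r) (hy : ∀ i < W, s.realArr 2 i = proj W Cm U r i)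
    (h1 : ∀ i, s.natArr 1 i = 0) {v : ℕ → ℕ} (h6 : ∀ i < W, s.natArr 6 i = v i) :
    Spec voteProg s (W * (W * 80 + 40) + 20) fun s => Base' W K M N P B d D U Cm s ∧
      s.natReg 7 = r ∧ (∀ i, s.natArr 1 i = 0) ∧
      ∀ i < W, s.natArr 6 i = v i + if Maximal W Cm U d r i then 1 else 0 := by
  refine Spec.mono (Spec.forDo (T := W * 80 + 30) W (fun k s => Base' W K M N P B d D U Cm s ∧
    s.natReg 7 = r ∧ (∀ i, s.natArr 1 i = 0) ∧ (∀ i < W, s.realArr 2 i = proj W Cm U r i) ∧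
    ∀ i < W, s.natArr 6 i = v i + if i < k ∧ Maximal W Cm U d r i then 1 else 0)
    (by norm_num) hs.base.reg0 ⟨hs.setN (by norm_num), by simpa using h7, by simpa using h1,
      by simpa using hy, by simpa using h6⟩ ?_)
    (by nlinarith) (fun s h => ⟨h.1, h.2.1, h.2.2.1, fun i hi => by simpa [hi] using h.2.2.2.2 i hi⟩)
  rintro i hi s hx hb ⟨hB, h7, h1, hy, h6⟩
  refine Spec.weaken (Spec.seq (Spec.setNat (Spec.seq (Spec.mono (Spec.forDo (T := 50) W
    (fun k s => (Base' W K M N P B d D U Cm s ∧ s.natReg 8 = i) ∧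
      (s.natReg 7 = r ∧ (∀ i, s.natArr 1 i = 0) ∧ (∀ i < W, s.realArr 2 i = proj W Cm U r i) ∧
      ∀ j < W, s.natArr 6 j = v j + if j < i ∧ Maximal W Cm U d r j then 1 else 0) ∧
      s.natReg 10 = if ∀ j < k, IsNbd Cm d i j → proj W Cm U r j ≤ proj W Cm U r i
        then 1 else 0) (by norm_num)
      (by simpa using hB.base.reg0) ?_ ?_) le_rfl ?_))))
      (T := 1 + 1 + (W * (50 + 9) + 7 + 6)) ?_
  · exact ⟨⟨(hB.setN (by norm_num)).setN (by norm_num), by simpa using hx⟩,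
      ⟨by simpa using h7, by simpa using h1, by simpa using hy, by simpa using h6⟩,
      by simp [NatExp.eval]⟩
  · rintro j hj s hx hb ⟨⟨hB, h8⟩, ⟨h7, h1, hy, h6⟩, h10⟩
    refine Spec.weaken (Spec.ite (fun hc => Spec.ite (fun hc' => Spec.skip ?_)
      (fun hc' => Spec.setNat ?_)) (fun hc => Spec.skip ?_))
      (by simp [nbdTest, quadExp, NatExp.cost, RealExp.cost, Test.cost])
    all_goals
      rw [nbdTest_holds hB (a := i) (b := j) (by simpa [NatExp.eval] using h8)
        (by simpa [NatExp.eval] using hx) hi hj] at hc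
    · simp only [Test.holds, RealExp.eval, NatExp.eval, hx, h8, hy i hi, hy j hj] at hc'
      refine ⟨hx, hb, ⟨hB.setN (by norm_num), by simpa using h8⟩, ⟨by simpa using h7,
        by simpa using h1, by simpa using hy, by simpa using h6⟩, ?_⟩
      simp only [natReg_setN, h10, Nat.forall_lt_succ_right]
      simp [hc']
    · simp only [Test.holds, RealExp.eval, NatExp.eval, hx, h8, hy i hi, hy j hj] at hc'
      refine ⟨by simpa using hx, by simpa using hb, ⟨(hB.setN (by norm_num)).setN (by norm_num),
        by simpa using h8⟩, ⟨by simpa using h7,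
        by simpa using h1, by simpa using hy, by simpa using h6⟩, ?_⟩
      rw [if_neg (fun h => hc' (h j (by omega) hc))]
      simp [NatExp.eval]
    · refine ⟨hx, hb, ⟨hB.setN (by norm_num), by simpa using h8⟩, ⟨by simpa using h7,
        by simpa using h1, by simpa using hy, by simpa using h6⟩, ?_⟩
      simp only [natReg_setN, h10, Nat.forall_lt_succ_right]
      simp [hc]
  · rintro s ⟨⟨hB, h8⟩, ⟨h7, h1, hy, h6⟩, h10⟩
    refine Spec.putNat ⟨by simpa using h8, by simpa using hB.base.reg0,
      (hB.putN (by norm_num)).setN (by norm_num), by simpa using h7, by simpa using h1,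
      by simpa using hy, ?_⟩
    intro j hj
    by_cases h : j = i
    · subst h
      simp only [NatExp.eval, natArr_setN, natArr_putN, h8, true_and, if_true, h6 j hj, h10,
        lt_irrefl, false_and, if_false, add_zero, Nat.lt_succ_self, Maximal]
    · have : j < i + 1 ↔ j < i := by omega
      simp [h, NatExp.eval, h8, h6 j hj, this]
  · omega

/-- A direction costs `O(W²)` steps for the projections and for the comparisons of all pairs. The
resulting `P W²` is at most `M N P` for the corpora in question. -/
theorem spec_phatProg {s : State} (hs : Base' W K M N P B d D U Cm s)
    (h1 : ∀ i, s.natArr 1 i = 0) (h6 : ∀ i < W, s.natArr 6 i = 1) :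
    Spec phatProg s (P * (W * (W * 140 + 80) + 60) + 20) fun s =>
      Base' W K M N P B d D U Cm s ∧ (∀ i, s.natArr 1 i = 0) ∧
      ∀ i < W, s.natArr 6 i = 1 + votes W Cm U d P i := by
  refine Spec.mono (Spec.forDo (T := W * (W * 140 + 80) + 40) P (fun k s =>
    Base' W K M N P B d D U Cm s ∧ (∀ i, s.natArr 1 i = 0) ∧
      ∀ i < W, s.natArr 6 i = 1 + votes W Cm U d k i)
    (by norm_num) hs.base.reg4 ⟨hs.setN (by norm_num), by simpa using h1,
      by simpa [votes] using h6⟩ ?_) (by nlinarith) (fun _ h => h)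
  rintro r hr s hx hb ⟨hB, h1, h6⟩
  refine Spec.weaken (Spec.seq (Spec.mono (spec_projectProg hr hB hx rfl) le_rfl ?_))
    (T := W * (W * 60 + 40) + 20 + (W * (W * 80 + 40) + 20)) (by nlinarith)
  rintro s' ⟨hB', h7', hA', hy'⟩
  refine Spec.mono (spec_voteProg hB' h7' hy' (by rw [hA']; exact h1)
    (v := fun i => 1 + votes W Cm U d r i) (by rw [hA']; exact h6)) le_rfl ?_
  rintro s'' ⟨hB'', h7'', h1'', h6''⟩
  refine ⟨h7'', hB''.base.reg4, hB''.setN (by norm_num), by simpa using h1'', fun i hi => ?_⟩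
  simp only [natArr_setN, h6'' i hi, votes, Finset.sum_range_succ, add_assoc]

end Stages

/-! ### Sorting and selection -/

/-- A word of largest priority, in register `10`; the priorities are in array `6`. -/
def argmaxProg : Program :=
  .seq (.setNat 10 (.lit 0))
    (forDo 8 0 (.ite (.natLe (.get 6 (.reg 10)) (.get 6 (.reg 8))) (.setNat 10 (.reg 8)) .skip))

/-- Register `11` tells whether the word in register `10` lies in the neighbourhoods of all selected
words. -/
def checkProg : Program :=
  .seq (.setNat 11 (.lit 1))
    (forDo 8 0 (.ite (.natLe (.lit 1) (.get 1 (.reg 8)))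
      (.ite (nbdTest (.reg 8) (.reg 10)) .skip (.setNat 11 (.lit 0))) .skip))

/-- The selection of the word in register `10`; register `12` counts the selected words. -/
def insertProg : Program :=
  .ite (.natLe (.add (.reg 12) (.lit 1)) (.reg 1))
    (.ite (.natLe (.lit 1) (.reg 11))
      (.seq (.putNat 1 (.reg 10) (.lit 1)) (.setNat 12 (.add (.reg 12) (.lit 1)))) .skip) .skip

/-- The selection of the words in decreasing order of their priorities. -/
def selectProg : Program :=
  .seq (.setNat 12 (.lit 0)) (forDo 7 0 (.seq argmaxProg
    (.seq (.putNat 6 (.reg 10) (.lit 0)) (.seq checkProg insertProg))))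

section Stages

variable {W K M N P B : ℕ} {d : ℝ} {D : ℕ → ℕ → ℕ} {U Cm : ℕ → ℕ → ℝ}

theorem spec_argmaxProg (hW : 0 < W) {s : State} (hs : Base' W K M N P B d D U Cm s)
    {A : ℕ → ℕ → ℕ} (hA : s.natArr = A) {k c : ℕ} (h7 : s.natReg 7 = k) (h12 : s.natReg 12 = c) :
    Spec argmaxProg s (W * 30 + 20) fun s => Base' W K M N P B d D U Cm s ∧ s.natArr = A ∧
      s.natReg 7 = k ∧ s.natReg 12 = c ∧ s.natReg 10 < W ∧
      ∀ j < W, A 6 j ≤ A 6 (s.natReg 10) := by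
  refine Spec.weaken (Spec.seq (Spec.setNat (Spec.forDo (T := 15) W (fun n s =>
    Base' W K M N P B d D U Cm s ∧ s.natArr = A ∧ s.natReg 7 = k ∧ s.natReg 12 = c ∧
      s.natReg 10 < W ∧ ∀ j < n, A 6 j ≤ A 6 (s.natReg 10)) (by norm_num)
      (by simpa using hs.base.reg0) ?_ ?_))) (T := 1 + 1 + (W * (15 + 9) + 7)) (by omega)
  · exact ⟨(hs.setN (by norm_num)).setN (by norm_num), hA, by simpa using h7, by simpa using h12,
      by simpa [NatExp.eval] using hW, by simp⟩
  · rintro j hj s hx hb ⟨hB, hA, h7, h12, h10, hmax⟩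
    refine Spec.weaken (Spec.ite (fun hc => Spec.setNat ?_) (fun hc => Spec.skip ?_))
      (by simp [NatExp.cost, Test.cost])
    all_goals simp only [Test.holds, NatExp.eval, hA, hx] at hc
    · refine ⟨by simpa using hx, by simpa using hb, (hB.setN (by norm_num)).setN (by norm_num),
        hA, by simpa using h7, by simpa using h12, by simpa [NatExp.eval, hx] using hj, ?_⟩
      intro i hi
      simp only [natReg_setN, NatExp.eval, hx]
      rcases Nat.lt_succ_iff_lt_or_eq.1 hi with hi | rfl
      · simpa using (hmax i hi).trans hc
      · simp
    · refine ⟨hx, hb, hB.setN (by norm_num), hA, by simpa using h7, by simpa using h12,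
        by simpa using h10, ?_⟩
      intro i hi
      simp only [natReg_setN]
      rcases Nat.lt_succ_iff_lt_or_eq.1 hi with hi | rfl
      · simpa using hmax i hi
      · simpa using (not_le.1 hc).le

open Classical in
theorem spec_checkProg {s : State} (hs : Base' W K M N P B d D U Cm s)
    {A : ℕ → ℕ → ℕ} (hA : s.natArr = A) {k c b : ℕ} (h7 : s.natReg 7 = k) (h12 : s.natReg 12 = c)
    (h10 : s.natReg 10 = b) (hbW : b < W) :
    Spec checkProg s (W * 80 + 20) fun s => Base' W K M N P B d D U Cm s ∧ s.natArr = A ∧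
      s.natReg 7 = k ∧ s.natReg 12 = c ∧ s.natReg 10 = b ∧
      s.natReg 11 = if ∀ l < W, 1 ≤ A 1 l → IsNbd Cm d l b then 1 else 0 := by
  refine Spec.weaken (Spec.seq (Spec.setNat (Spec.forDo (T := 50) W (fun n s =>
    Base' W K M N P B d D U Cm s ∧ s.natArr = A ∧ s.natReg 7 = k ∧ s.natReg 12 = c ∧
      s.natReg 10 = b ∧ s.natReg 11 = if ∀ l < n, 1 ≤ A 1 l → IsNbd Cm d l b then 1 else 0)
      (by norm_num) (by simpa using hs.base.reg0) ?_ ?_))) (T := 1 + 1 + (W * (50 + 9) + 7))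
      (by omega)
  · exact ⟨(hs.setN (by norm_num)).setN (by norm_num), hA, by simpa using h7, by simpa using h12,
      by simpa using h10, by simp [NatExp.eval]⟩
  · rintro l hl s hx hb ⟨hB, hA, h7, h12, h10, h11⟩
    refine Spec.weaken (Spec.ite (fun hc => Spec.ite (fun hc' => Spec.skip ?_)
      (fun hc' => Spec.setNat ?_)) (fun hc => Spec.skip ?_))
      (by simp [nbdTest, quadExp, NatExp.cost, RealExp.cost, Test.cost])
    all_goals simp only [Test.holds, NatExp.eval, hA, hx] at hc
    · rw [nbdTest_holds hB (a := l) (b := b) (by simpa [NatExp.eval] using hx)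
        (by simpa [NatExp.eval] using h10) hl hbW] at hc'
      refine ⟨hx, hb, hB.setN (by norm_num), hA, by simpa using h7, by simpa using h12,
        by simpa using h10, ?_⟩
      simp only [natReg_setN, h11, Nat.forall_lt_succ_right]
      simp [hc']
    · rw [nbdTest_holds hB (a := l) (b := b) (by simpa [NatExp.eval] using hx)
        (by simpa [NatExp.eval] using h10) hl hbW] at hc'
      refine ⟨by simpa using hx, by simpa using hb, (hB.setN (by norm_num)).setN (by norm_num),
        hA, by simpa using h7, by simpa using h12, by simpa using h10, ?_⟩
      rw [if_neg (fun h => hc' (h l (by omega) hc))]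
      simp [NatExp.eval]
    · refine ⟨hx, hb, hB.setN (by norm_num), hA, by simpa using h7, by simpa using h12,
        by simpa using h10, ?_⟩
      simp only [natReg_setN, h11, Nat.forall_lt_succ_right]
      simp [hc]

/-- A selection sort: `L` is the list of words processed so far, whose priorities have been set to
zero. The loop visits all words even after `K` have been selected; the cap then merely blocks
further insertions, so the cost is `O(W²)` whatever `K` is. -/
theorem spec_selectProg {C : Matrix (Fin W) (Fin W) ℝ} (hC : ∀ i j : Fin W, Cm i j = C i j)
    {s : State} (hs : Base' W K M N P B d D U Cm s) (h1 : ∀ i, s.natArr 1 i = 0)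
    {v : ℕ → ℕ} (h6 : ∀ i < W, s.natArr 6 i = 1 + v i) :
    Spec selectProg s (W * (W * 110 + 110) + 20) fun s =>
      ∃ L : List (Fin W), L.length = W ∧ L.Nodup ∧ HoldsOutput s (select C d K L) ∧
        L.Pairwise fun a b : Fin W => v b ≤ v a := by
  classical
  refine Spec.mono (Spec.seq (Spec.setNat (Spec.forDo (T := W * 110 + 90) W (fun k s =>
    Base' W K M N P B d D U Cm s ∧ ∃ L : List (Fin W), L.length = k ∧ L.Nodup ∧
      (∀ i : Fin W, s.natArr 6 i = if i ∈ L then 0 else 1 + v i) ∧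
      HoldsOutput s (select C d K L) ∧ s.natReg 12 = (select C d K L).card ∧
      (L.Pairwise fun a b : Fin W => v b ≤ v a) ∧ ∀ a ∈ L, ∀ b ∉ L, v b ≤ v a) (by norm_num)
      (by simpa using hs.base.reg0) ?_ ?_))) (T := 1 + 1 + (W * (W * 110 + 90 + 9) + 7)) ?_ ?_
  · refine ⟨(hs.setN (by norm_num)).setN (by norm_num), [], rfl, List.nodup_nil, ?_, ?_, ?_,
      List.Pairwise.nil, by simp⟩
    · intro i; simpa using h6 i i.2
    · intro i; simpa [select] using h1 i
    · simp [select, NatExp.eval]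
  · rintro k hk s hx hb ⟨hB, L, hlen, hnd, h6, hout, h12, hsort, hrest⟩
    have hW : 0 < W := by omega
    refine Spec.weaken (Spec.seq (Spec.mono (spec_argmaxProg hW hB rfl hx h12) le_rfl ?_))
      (T := (W * 30 + 20) + ((1 + 1 + 1) + ((W * 80 + 20) + 30))) (by omega)
    rintro s₁ ⟨hB₁, hA₁, h7₁, h12₁, hbW, hmax⟩
    obtain ⟨b, hbe⟩ : ∃ b : Fin W, s₁.natReg 10 = b := ⟨⟨_, hbW⟩, rfl⟩
    rw [hbe] at hmax
    refine Spec.seq (Spec.putNat (Spec.seq (Spec.mono (spec_checkProg (b := b)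
      (hB₁.putN (by norm_num)) rfl (by simpa using h7₁) (by simpa using h12₁)
      (by simpa using hbe) b.2) le_rfl ?_)))
    rintro s₂ ⟨hB₂, hA₂, h7₂, h12₂, h10₂, h11₂⟩
    -- Since `L` is shorter than `W`, an unprocessed word remains; its priority is at least one, so
    -- a word of priority zero cannot be the maximum.
    have hbL : b ∉ L := by
      intro hbL
      have hex : ∃ a, a ∉ L := by
        by_contra hcon
        push Not at hcon
        have h := List.toFinset_card_of_nodup hnd
        have : L.toFinset = Finset.univ := by ext a; simp [hcon a]
        rw [this, Finset.card_univ, Fintype.card_fin] at h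
        omega
      obtain ⟨a, ha⟩ := hex
      have := hmax a a.2
      rw [h6, h6, if_neg ha, if_pos hbL] at this
      omega
    have hvmax : ∀ a ∉ L, v a ≤ v b := by
      intro a ha
      have := hmax a a.2
      rw [h6, h6, if_neg ha, if_neg hbL] at this
      omega
    have harr1 : ∀ i : Fin W, s₂.natArr 1 i = if i ∈ select C d K L then 1 else 0 := by
      intro i
      rw [hA₂]
      simpa [NatExp.eval, hA₁] using hout i
    have harr6 : ∀ i : Fin W, s₂.natArr 6 i = if i ∈ L ++ [b] then 0 else 1 + v i := by
      intro i
      rw [hA₂]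
      simp only [NatExp.eval, natArr_putN, hA₁, h6, hbe, true_and, List.mem_append,
        List.mem_singleton]
      by_cases hi : i = b
      · simp [hi]
      · simp [hi, Fin.val_inj]
    have hnbd : (∀ l < W, 1 ≤ (s₁.putN 6 (NatExp.eval s₁ (.reg 10)) (NatExp.eval s₁ (.lit 0))).natArr 1 l →
        IsNbd Cm d l b) ↔ ∀ l ∈ select C d K L, b ∈ Nbd C d l := by
      rw [← hA₂]
      have e : ∀ l : Fin W, IsNbd Cm d l b ↔ b ∈ Nbd C d l := fun l => by
        simp only [IsNbd, hC, Nbd, Set.mem_ofPred_eq]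
      constructor
      · intro h l hl
        exact (e l).1 (h l l.2 (by rw [harr1, if_pos hl]))
      · intro h l hl h1
        refine (e ⟨l, hl⟩).2 (h ⟨l, hl⟩ ?_)
        by_contra hcon
        have := harr1 ⟨l, hl⟩
        rw [if_neg hcon] at this
        simp only at this
        omega
    rw [if_congr hnbd rfl rfl] at h11₂
    have hsel : select C d K (L ++ [b]) = selectStep C d K (select C d K L) b := by
      rw [select_eq, List.foldl_append]; rfl
    -- Needed so that an insertion raises the number of selected words, which register `12` tracks,
    -- by exactly one.
    have hbsel : b ∉ select C d K L := by
      intro h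
      have hsub : ∀ l : List (Fin W), ∀ i ∈ select C d K l, i ∈ l := by
        intro l
        induction l using List.reverseRecOn with
        | nil => simp [select]
        | append_singleton l j ih =>
          intro i hi
          rw [select_eq, List.foldl_append, ← select_eq] at hi
          simp only [List.foldl_cons, List.foldl_nil, selectStep] at hi
          split_ifs at hi
          · rcases Finset.mem_insert.1 hi with rfl | hi
            · simp
            · simp [ih i hi]
          · simp [ih i hi]
      exact hbL (hsub L b h)
    have hfinish : ∀ s' : State, s'.natReg 7 = k → Base' W K M N P B d D U Cm s' →
        (∀ i : Fin W, s'.natArr 6 i = if i ∈ L ++ [b] then 0 else 1 + v i) →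
        HoldsOutput s' (select C d K (L ++ [b])) →
        s'.natReg 12 = (select C d K (L ++ [b])).card →
        s'.natReg 7 = k ∧ s'.natReg 0 = W ∧ Base' W K M N P B d D U Cm (s'.setN 7 (k + 1)) ∧
          ∃ L : List (Fin W), L.length = k + 1 ∧ L.Nodup ∧
          (∀ i : Fin W, (s'.setN 7 (k + 1)).natArr 6 i = if i ∈ L then 0 else 1 + v i) ∧
          HoldsOutput (s'.setN 7 (k + 1)) (select C d K L) ∧
          (s'.setN 7 (k + 1)).natReg 12 = (select C d K L).card ∧
          (L.Pairwise fun a b : Fin W => v b ≤ v a) ∧ ∀ a ∈ L, ∀ b ∉ L, v b ≤ v a := by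
      intro s' h7 hB' h6' hout' h12'
      refine ⟨h7, hB'.base.reg0, hB'.setN (by norm_num), L ++ [b], by simp [hlen], ?_, h6', hout',
        by simpa using h12', ?_, ?_⟩
      · rw [List.nodup_append]
        exact ⟨hnd, List.nodup_singleton b, fun a ha c hc => by
          rw [List.mem_singleton.1 hc]; exact fun h => hbL (h ▸ ha)⟩
      · rw [List.pairwise_append]
        exact ⟨hsort, List.pairwise_singleton _ _, fun a ha c hc => by
          rw [List.mem_singleton.1 hc]; exact hrest a ha b hbL⟩
      · intro a ha c hc
        simp only [List.mem_append, List.mem_singleton, not_or] at ha hc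
        rcases ha with ha | rfl
        · exact hrest a ha c hc.1
        · exact hvmax c hc.1
    refine Spec.weaken (Spec.ite (fun hc => Spec.ite (fun hc' => Spec.seq (Spec.putNat
      (Spec.setNat ?_))) (fun hc' => Spec.skip ?_)) (fun hc => Spec.skip ?_))
      (by simp [NatExp.cost, Test.cost])
    all_goals simp only [Test.holds, NatExp.eval, h12₂, hB₂.base.reg1] at hc
    · simp only [Test.holds, NatExp.eval, h11₂] at hc'
      have hcond : ∀ l ∈ select C d K L, b ∈ Nbd C d l := by
        by_contra hcon
        rw [if_neg hcon] at hc'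
        omega
      have hins : select C d K (L ++ [b]) = insert b (select C d K L) := by
        rw [hsel]; exact if_pos ⟨hc, hcond⟩
      refine hfinish _ (by simpa using h7₂) ((hB₂.putN (by norm_num)).setN (by norm_num))
        (by simpa using harr6) ?_ ?_
      · intro i
        rw [hins]
        simp only [NatExp.eval, natArr_setN, natArr_putN, h10₂, harr1, true_and, Fin.val_inj,
          Finset.mem_insert]
        by_cases hi : i = b <;> simp [hi]
      · rw [hins, Finset.card_insert_of_notMem hbsel]
        simp [NatExp.eval, h12₂]
    · simp only [Test.holds, NatExp.eval, h11₂] at hc'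
      have hins : select C d K (L ++ [b]) = select C d K L := by
        rw [hsel]
        refine if_neg fun h => hc' ?_
        rw [if_pos h.2]
      refine hfinish _ h7₂ hB₂ harr6 ?_ ?_
      · rw [hins]; exact harr1
      · rw [hins]; exact h12₂
    · have hins : select C d K (L ++ [b]) = select C d K L := by
        rw [hsel]
        exact if_neg fun h => hc h.1
      refine hfinish _ h7₂ hB₂ harr6 ?_ ?_
      · rw [hins]; exact harr1
      · rw [hins]; exact h12₂
  · nlinarith
  · rintro s ⟨-, L, h1, h2, -, h3, -, h4, -⟩
    exact ⟨L, h1, h2, h3, h4⟩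

end Stages

/-! ### The whole program -/

/-- The random projection algorithm as a program. -/
def algorithm : Program :=
  .seq (.setNat 5 (.div (.reg 3) (.lit 2)))
    (.seq (.setNat 6 (.add (.mul (.mul (.reg 2) (.reg 3)) (.reg 3)) (.lit 1)))
      (.seq tableProg (.seq countProg (.seq coocProg (.seq phatProg selectProg)))))

section Correctness

variable {W M N P : ℕ}

/-- The words of the documents as natural numbers. -/
def docVal (docs : Fin M → Fin N → Fin W) (m n : ℕ) : ℕ :=
  if h : m < M ∧ n < N then docs ⟨m, h.1⟩ ⟨n, h.2⟩ else 0

/-- The coordinates of the directions. -/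
def dirVal (u : Fin P → Fin W → ℝ) (r i : ℕ) : ℝ :=
  if h : r < P ∧ i < W then u ⟨r, h.1⟩ ⟨i, h.2⟩ else 0

/-- The entries of a matrix. -/
def matVal (C : Matrix (Fin W) (Fin W) ℝ) (i j : ℕ) : ℝ :=
  if h : i < W ∧ j < W then C ⟨i, h.1⟩ ⟨j, h.2⟩ else 0

@[simp] theorem docVal_fin (docs : Fin M → Fin N → Fin W) (m : Fin M) (n : Fin N) :
    docVal docs m n = docs m n := by simp [docVal]

@[simp] theorem dirVal_fin (u : Fin P → Fin W → ℝ) (r : Fin P) (i : Fin W) :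
    dirVal u r i = u r i := by simp [dirVal]

@[simp] theorem matVal_fin (C : Matrix (Fin W) (Fin W) ℝ) (i j : Fin W) :
    matVal C i j = C i j := by simp [matVal]

theorem finProd_symm {m n : ℕ} {i j : ℕ} (hi : i < m) (hj : j < n) (h : i * n + j < m * n) :
    finProdFinEquiv.symm (⟨i * n + j, h⟩ : Fin (m * n)) = (⟨i, hi⟩, ⟨j, hj⟩) := by
  rw [Equiv.symm_apply_eq]
  ext
  simp only [finProdFinEquiv_apply_val]
  ring

theorem cell_lt {m n i j : ℕ} (hi : i < m) (hj : j < n) : i * n + j < m * n := by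
  have := Nat.mul_le_mul_right n (Nat.succ_le_of_lt hi)
  rw [Nat.succ_mul] at this
  omega

theorem base_initial (d : ℝ) (K : ℕ) (docs : Fin M → Fin N → Fin W) (u : Fin P → Fin W → ℝ)
    (B : ℕ) :
    Base W K M N P B d (docVal docs) (dirVal u)
      (((initial d K docs u).setN 5 (N / 2)).setN 6 B) := by
  refine ⟨by simp [initial], by simp [initial], by simp [initial], by simp [initial],
    by simp [initial], by simp, by simp, by simp [initial], fun m hm n hn => ?_,
    fun r hr i hi => ?_⟩
  · simp only [natArr_setN, initial, true_and]
    rw [dif_pos (cell_lt hm hn), finProd_symm hm hn, docVal, dif_pos ⟨hm, hn⟩]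
  · simp only [realArr_setN, initial, true_and]
    rw [dif_pos (cell_lt hr hi), finProd_symm hr hi, dirVal, dif_pos ⟨hr, hi⟩]

theorem count₁_eq_cnt (docs : Fin M → Fin N → Fin W) (i : Fin W) (m : Fin M) :
    count₁ docs i m = cnt₁ (docVal docs) (N / 2) N m i := by
  simp only [count₁, cnt₁, Finset.sum_range, docVal_fin, Fin.val_inj]
  rw [Finset.card_filter]

theorem count₂_eq_cnt (docs : Fin M → Fin N → Fin W) (i : Fin W) (m : Fin M) :
    count₂ docs i m = cnt₂ (docVal docs) (N / 2) N m i := by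
  simp only [count₂, cnt₂, Finset.sum_range, docVal_fin, Fin.val_inj]
  rw [Finset.card_filter]

/-- Words absent from one of the halves need no separate case: division by zero gives zero in the
row scaling and in the machine alike. -/
theorem cooc_eq_cnt (docs : Fin M → Fin N → Fin W) (i j : Fin W) :
    cooc docs i j = (M * (∑ m ∈ Finset.range M, cnt₂ (docVal docs) (N / 2) N m i *
        cnt₁ (docVal docs) (N / 2) N m j : ℕ) : ℝ) /
      ((∑ m ∈ Finset.range M, cnt₂ (docVal docs) (N / 2) N m i : ℕ) *
        (∑ m ∈ Finset.range M, cnt₁ (docVal docs) (N / 2) N m j : ℕ)) := by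
  simp only [cooc, Matrix.smul_apply, Matrix.mul_apply, Matrix.transpose_apply, rowNormalize,
    count₁_eq_cnt, count₂_eq_cnt, smul_eq_mul, Finset.sum_range]
  simp_rw [div_mul_div_comm]
  rw [← Finset.sum_div, mul_div_assoc']
  push_cast
  rfl

theorem proj_eq (C : Matrix (Fin W) (Fin W) ℝ) (u : Fin P → Fin W → ℝ) (r : Fin P) (i : Fin W) :
    proj W (matVal C) (dirVal u) r i = C i ⬝ᵥ u r := by
  simp only [proj, Finset.sum_range, matVal_fin, dirVal_fin, dotProduct]

theorem phat_eq_votes (C : Matrix (Fin W) (Fin W) ℝ) (d : ℝ) (u : Fin P → Fin W → ℝ) (i : Fin W) :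
    phat C d u i = votes W (matVal C) (dirVal u) d P i / P := by
  classical
  rw [phat, votes, Finset.sum_range, Finset.card_filter]
  congr 2
  refine Finset.sum_congr rfl fun r _ => ?_
  refine if_congr ?_ rfl rfl
  have e : ∀ j : Fin W, IsNbd (matVal C) d i j ↔ j ∈ Nbd C d i := fun j => by
    simp only [IsNbd, matVal_fin, Nbd, Set.mem_ofPred_eq]
  constructor
  · intro h j hj hij
    have := h ⟨j, hj⟩ ((e ⟨j, hj⟩).1 hij)
    rw [← proj_eq, ← proj_eq] at this
    exact this
  · intro h j hij
    have := h j j.2 ((e j).2 hij)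
    rw [proj_eq, proj_eq] at this
    exact this

theorem exists_perm_ofFn {L : List (Fin W)} (hlen : L.length = W) (hnd : L.Nodup) :
    ∃ σ : Equiv.Perm (Fin W), List.ofFn σ = L := by
  have hinj : Function.Injective fun i : Fin W => L[(i : ℕ)]'(by omega) := by
    intro i j h
    exact Fin.ext ((hnd.getElem_inj_iff).1 h)
  refine ⟨Equiv.ofBijective _ (Finite.injective_iff_bijective.1 hinj), ?_⟩
  refine List.ext_getElem (by simp [hlen]) fun n h1 h2 => ?_
  simp

theorem algorithm_correct (d : ℝ) (K : ℕ) (docs : Fin M → Fin N → Fin W) (u : Fin P → Fin W → ℝ)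
    (hW : 1 ≤ W) (hP : 1 ≤ P) (hMN : W ^ 2 ≤ M * N) :
    ∃ (s : State) (t : ℕ) (I : Finset (Fin W)),
      Runs algorithm (initial d K docs u) s t ∧ HoldsOutput s I ∧ IsOutput d K docs u I ∧
      t ≤ 2000 * (M * N * P + W * P + K ^ 2) := by
  have hspec : Spec algorithm (initial d K docs u) (2000 * (M * N * P)) fun s =>
      ∃ L : List (Fin W), L.length = W ∧ L.Nodup ∧ HoldsOutput s (select (cooc docs) d K L) ∧
        L.Pairwise fun a b : Fin W => votes W (matVal (cooc docs)) (dirVal u) d P b ≤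
          votes W (matVal (cooc docs)) (dirVal u) d P a := by
    have hD : ∀ m < M, ∀ n < N, docVal docs m n < W := fun m hm n hn => by
      rw [docVal, dif_pos ⟨hm, hn⟩]; exact Fin.is_lt _
    refine Spec.weaken (T := (3 + 1) + ((7 + 1) + ((W * 30 + 20) + ((M * (N * 50 + 20) + 20) +
      ((W * (W * 60 + 20) + 20) + ((P * (W * (W * 140 + 80) + 60) + 20) +
        (W * (W * 110 + 110) + 20))))))) ?_ ?_
    · refine Spec.seq (Spec.setNat (Spec.seq (Spec.setNat ?_)))
      have hbase := base_initial d K docs u (M * N * N + 1)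
      have e5 : NatExp.eval (initial d K docs u) (.div (.reg 3) (.lit 2)) = N / 2 := by
        simp [NatExp.eval, initial]
      have e6 : NatExp.eval ((initial d K docs u).setN 5 (N / 2))
          (.add (.mul (.mul (.reg 2) (.reg 3)) (.reg 3)) (.lit 1)) = M * N * N + 1 := by
        simp [NatExp.eval, initial]
      rw [e5, e6]
      refine Spec.seq (Spec.mono (spec_tableProg hbase (fun i => by simp [initial])
        (fun i => by simp [initial]) (fun i => by simp [initial]) (fun i => by simp [initial]))
        le_rfl ?_)
      rintro s ⟨hB, ⟨h1, h3, h4, h5⟩, h2, h6⟩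
      refine Spec.seq (Spec.mono (spec_countProg hD hB h1 h3 h4 h5 h2 h6) le_rfl ?_)
      rintro s ⟨hB, h1, h2, h6, h3, h4, h5⟩
      refine Spec.seq (Spec.mono (spec_coocProg (Cm := matVal (cooc docs)) hB h1 h2 h6 h3 h4 h5
        fun i hi j hj => ?_) le_rfl ?_)
      · rw [digit_packed_row hD hj]
        have := cooc_eq_cnt docs ⟨i, hi⟩ ⟨j, hj⟩
        rw [← matVal_fin (cooc docs)] at this
        exact this
      rintro s ⟨hB, h1, h6, hC⟩
      refine Spec.seq (Spec.mono (spec_phatProg ⟨hB, hC⟩ h1 h6) le_rfl ?_)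
      rintro s ⟨hB, h1, h6⟩
      exact spec_selectProg (fun i j => matVal_fin _ i j) hB h1 h6
    -- As `1 ≤ W² ≤ M N` and `1 ≤ P`, each monomial in the sum of the stage costs is at most `M N
    -- P`; their coefficients add up to less than `2000`.
    · have hM : 1 ≤ M := Nat.one_le_iff_ne_zero.2 fun h => by
        subst h; rw [zero_mul] at hMN; have := pow_pos (show 0 < W by omega) 2; omega
      have hN : 1 ≤ N := Nat.one_le_iff_ne_zero.2 fun h => by
        subst h; rw [mul_zero] at hMN; have := pow_pos (show 0 < W by omega) 2; omega
      set X := M * N * P with hX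
      have a1 : M * N ≤ X := Nat.le_mul_of_pos_right _ hP
      have a2 : M ≤ X := (Nat.le_mul_of_pos_right _ hN).trans a1
      have a3 : W * W * P ≤ X := Nat.mul_le_mul_right P (by rw [← sq]; exact hMN)
      have a4 : W * W ≤ X := (Nat.le_mul_of_pos_right _ hP).trans a3
      have a5 : W ≤ X := (Nat.le_mul_of_pos_right _ hW).trans a4
      have a6 : W * P ≤ X := le_trans (Nat.mul_le_mul_right P (Nat.le_mul_of_pos_right _ hW)) a3
      have a7 : P ≤ X := (Nat.le_mul_of_pos_left _ hW).trans a6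
      have a8 : 1 ≤ X := hP.trans a7
      nlinarith
  obtain ⟨s, t, hrun, ht, L, hlen, hnd, hout, hsort⟩ := hspec
  refine ⟨s, t, _, hrun, hout, ?_, ht.trans (Nat.mul_le_mul_left _ (by omega))⟩
  obtain ⟨σ, hσ⟩ := exists_perm_ofFn hlen hnd
  refine ⟨σ, fun i j hij => ?_, by rw [hσ]⟩
  simp only [Function.comp_apply, phat_eq_votes]
  rcases hij.lt_or_eq with hlt | rfl
  · rw [← hσ, List.pairwise_ofFn] at hsort
    have := hsort hlt
    gcongr
  · exact le_rfl

end Correctness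

end TopicRP

end

/-! ### The statistical guarantee and the program combined -/

theorem lemma3 :
    (∃ c₁ c₂ c₃ : ℝ, 0 < c₁ ∧ 0 < c₂ ∧ 0 < c₃ ∧
      ∀ (W K N : ℕ) (_ : 2 ≤ K) (_ : 2 ≤ N) (T : TopicRP.TopicModel W K)
        (d φ η ρ q : ℝ)
        (_ : d = TopicRP.dC T.β T.a T.R') (_ : φ = TopicRP.phiC T.R')
        (_ : η = TopicRP.etaC T.β T.a) (_ : ρ = TopicRP.rhoC T.β T.a T.R')
        (_ : q = TopicRP.qC T.β T.a T.R'),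
        TopicRP.Separable T.β → TopicRP.Simplicial T.R' →
          (0 < d ∧ 0 < φ ∧ 0 < η ∧ 0 < ρ ∧ 0 < q) ∧
          Tendsto (fun x : ℕ × ℕ => (T.law N x.1 x.2).real (TopicRP.failure T.β d N x.1 x.2))
            (atTop ×ˢ atTop) (𝓝 0) ∧
          ∀ δ : ℝ, 0 < δ → ∀ M P : ℕ,
            max (c₁ * Real.log (3 * W / δ) / (d ^ 2 * φ ^ 2 * η ^ 4))
              (c₂ * (W ^ 2 * Real.log (2 * W / q) * Real.log (3 * W / δ)) /
                (ρ ^ 2 * q ^ 2 * φ ^ 2 * η ^ 4)) ≤ (M : ℝ) →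
            c₃ * Real.log (3 * W / δ) / q ^ 2 ≤ (P : ℝ) →
            (T.law N M P).real (TopicRP.failure T.β d N M P) ≤ δ ∧
              (δ < 1 → 1 ≤ P ∧ W ^ 2 ≤ M * N)) ∧
    ∃ (prog : TopicRP.Program) (c : ℕ),
      ∀ (W K M N P : ℕ) (d : ℝ) (docs : Fin M → Fin N → Fin W) (u : Fin P → Fin W → ℝ),
        1 ≤ W → 1 ≤ P → W ^ 2 ≤ M * N →
          ∃ (s : TopicRP.State) (t : ℕ) (I : Finset (Fin W)),
            TopicRP.Runs prog (TopicRP.initial d K docs u) s t ∧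
            TopicRP.HoldsOutput s I ∧ TopicRP.IsOutput d K docs u I ∧
            t ≤ c * (M * N * P + W * P + K ^ 2) := by
  refine ⟨⟨30000, 1000000, 300, by norm_num, by norm_num, by norm_num, ?_⟩,
    TopicRP.algorithm, 2000, fun W K M N P d docs u hW hP hMN =>
      TopicRP.algorithm_correct d K docs u hW hP hMN⟩
  rintro W K N hK hN T d φ η ρ q rfl rfl rfl rfl rfl hS hR
  have hW := T.two_le_words hK hS
  have : Nonempty (Fin W) := ⟨⟨0, by omega⟩⟩
  refine ⟨⟨T.d_pos hK hS hR, T.phi_pos, T.eta_pos, T.rho_pos hK hS hR, T.q_pos hK hS hR⟩,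
    TopicRP.random_projection_guarantee hK hN T hS hR, fun δ hδ M P hM hP => ?_⟩
  -- For `δ ≥ 1` the bound on a probability is trivial and nothing is claimed about `P` and `M`.
  by_cases hδ1 : δ < 1
  · have h := T.failure_le_of_sample_size hK hS hR hN hδ hδ1 ((le_max_left _ _).trans hM)
      ((le_max_right _ _).trans hM) hP
    exact ⟨h.1, fun _ => h.2⟩
  · exact ⟨measureReal_le_one.trans (not_lt.1 hδ1), fun h => absurd h hδ1⟩
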